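/- **Setting.** Let $\Omega\subset\mathbb R^d$ be a bounded open set, $T>0$, $I=(0,T)$, $(\cdot,\cdot)$ the inner product of $L^2(\Omega)$, $V=H^1_0(\Omega)$ and $V'$ its dual, with duality pairing $\langle\cdot,\cdot\rangle$. Let $0<\varepsilon\le1$; let $b$ (with values in $\mathbb R^d$) and $\alpha\ge 0$ be Borel measurable on $\mathbb R\times\mathbb R^d$ and bounded on $[0,T]\times\Omega$, with fixed everywhere defined representatives; let $u_0\in L^2(\Omega)$ and $f\in L^2(I;V')$. Put $$a(u)(\varphi)=(\varepsilon\nabla u,\nabla\varphi)+(b\cdot\nabla u,\varphi)+(\alpha u,\varphi).$$ Let $\mathcal W$ be the space of functions $w:[0,T]\to L^2(\Omega)$ with relatively compact range that belong to $L^2(I;V)$, normed by $\|w\|=\max(\sup_t\|w(t)\|_{L^2(\Omega)},\|w\|_{L^2(I;V)})$. It contains the following spaces. * $\mathcal V=\{v\in L^2(I;V):\partial_tv\in L^2(I;V')\}$, each $v$ being identified with its representative in $C([0,T];L^2(\Omega))$. * $\mathcal V_\tau^r$, for a partition $0=t_0<\dots<t_N=T$, $I_n=(t_{n-1},t_n]$,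 and $r\ge0$: the functions that on each $I_n$ are polynomials in $t$ of degree at most $r$ with values in $V$, and that have some value in $L^2(\Omega)$ at $t=0$. * $\mathcal V_{\tau h}^{r,p}$: the functions that on each $I_n$ are polynomials in $t$ of degree at most $r$ with values in $V_h^{p}(\mathcal T_{h,n})$ and whose value at $0$ lies in $V_h^p(\mathcal T_{h,1})$. Here $\mathcal T_{h,n}$ is a finite set of disjoint elements $K=T_K((0,1)^d)\subset\Omega$ with $\overline\Omega=\bigcup\overline K$; $T_K$ has components in $Q_p$ (polynomials of degree at most $p$ in each variable), is injective on $(0,1)^d$ and has positive Jacobian determinant on $[0,1]^d$; and $V_h^p(\mathcal T_{h,n})$ consists of the $v\in V$ that are continuous on $\overline\Omega$ with $v\circ T_K\in Q_p$ for all $K$. With one-sided limits $w_n^\pm=\lim_{t\to t_n\pm0}w(t)$ and jumps $[w]_n=w_n^+-w_n^-$, and with $\partial_t$ taken on each $I_n$ separately in $A_\tau$, put $$A(u)(\varphi)=\int_I\{\langle\partial_tu,\varphi\rangle+a(u)(\varphi)\}\,dt+(u(0),\varphi(0)),\qquad F(\varphi)=\int_I\langle f,\varphi\rangle\,dt+(u_0,\varphi(0)),$$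 $$A_\tau(u)(\varphi)=\sum_{n=1}^N\int_{I_n}\{\langle\partial_tu,\varphi\rangle+a(u)(\varphi)\}\,dt+\sum_{n=2}^N([u]_{n-1},\varphi_{n-1}^+)+(u_0^+,\varphi_0^+),\qquad F_\tau(\varphi)=\int_I\langle f,\varphi\rangle\,dt+(u_0,\varphi_0^+),$$ where in $(u_0^+,\varphi_0^+)$ the symbol $u_0^+$ is the right limit of $u$ at $t_0=0$, while in $F_\tau$ the symbol $u_0$ is the initial datum. If $f$ is given by a function in $L^2(I;L^2(\Omega))$, let $r(u)=\partial_tu-\nabla\cdot(\varepsilon\nabla u)+b\cdot\nabla u+\alpha u-f$ (elementwise), let $\delta_K\in\mathbb R$ be given for every $K\in\mathcal T_{h,n}$, $n=1,\dots,N$, and put $$S(u)(\varphi)=\sum_{n=1}^N\int_{I_n}\sum_{K\in\mathcal T_{h,n}}\delta_K(r(u),b\cdot\nabla\varphi)_K\,dt+\sum_{n=2}^N\sum_{K\in\mathcal T_{h,n}}\delta_K([u]_{n-1},b(t_{n-1})\cdot\nabla\varphi_{n-1}^+)_K+\sum_{K\in\mathcal T_{h,1}}\delta_K(u(0^+)-u_0,b(0)\cdot\nabla\varphi_0^+)_K,$$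 where $u(0^+)$ is the right limit of $u$ at $0$, and $A_S=A_\tau+S$. Let the goal functional be $J(w)=\int_0^TJ_t(w(t))\,dt+J_T(w(T))$, where $J_t:V\to\mathbb R$ (possibly depending on $t$ explicitly) and $J_T:L^2(\Omega)\to\mathbb R$ are such that $t\mapsto J_t(w(t))$ is integrable on $(0,T)$ for every $w\in\mathcal W$ and $J\in C^3(\mathcal W,\mathbb R)$. Define the Lagrangians $\mathcal L(u,z)=J(u)+F(z)-A(u)(z)$, $\mathcal L_\tau(u,z)=J(u)+F_\tau(z)-A_\tau(u)(z)$, $\mathcal L_{\tau h}(u,z)=J(u)+F_\tau(z)-A_S(u)(z)$, and the residuals $$\rho_\tau(u)(\varphi)=F_\tau(\varphi)-A_\tau(u)(\varphi),\qquad\rho_\tau^*(u,z)(\varphi)=J'(u)(\varphi)-A_\tau'(u)(\varphi,z);$$ a prime denotes the directional derivative with respect to the first argument, and a pair in $X\times X$ is called stationary on $X$ if all directional derivatives in directions in $X\times X$ vanish there. For $x,y\in\mathcal W$ and $e=x-y$ put $$\mathcal R(x,y)=\frac12\int_0^1J'''(y+se)(e,e,e)\,s(s-1)\,ds.$$ **Theorem.**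 Let $(u,z)\in\mathcal V\times\mathcal V$ be stationary for $\mathcal L$ on $\mathcal V$, and let $(u_\tau,z_\tau)\in\mathcal V_\tau^r\times\mathcal V_\tau^r$ be stationary for $\mathcal L_\tau$ on $\mathcal V_\tau^r$. Then: 1. $(u,z)$ is also stationary for $\mathcal L_\tau$ on $\mathcal V$, and on $\mathcal V+\mathcal V_\tau^r$ the residuals $\rho_\tau(u)$ and $\rho_\tau^*(u,z)$ are the partial directional derivatives of $\mathcal L_\tau$ at $(u,z)$ with respect to the second and the first argument. 2. For all $\tilde u_\tau,\tilde z_\tau\in\mathcal V_\tau^r$, $$J(u)-J(u_\tau)=\tfrac12\rho_\tau(u_\tau)(z-\tilde z_\tau)+\tfrac12\rho_\tau^*(u_\tau,z_\tau)(u-\tilde u_\tau)+\mathcal R_\tau,\qquad \mathcal R_\tau=\mathcal R(u,u_\tau).$$ 3. Suppose that $f$ is given by a function in $L^2(I;L^2(\Omega))$, and let $(u_{\tau h},z_{\tau h})\in\mathcal V_{\tau h}^{r,p}\times\mathcal V_{\tau h}^{r,p}$ be stationary for $\mathcal L_{\tau h}$ on $\mathcal V_{\tau h}^{r,p}$. Then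 for all $\tilde u_{\tau h},\tilde z_{\tau h}\in\mathcal V_{\tau h}^{r,p}$, $$J(u_\tau)-J(u_{\tau h})=\tfrac12\rho_\tau(u_{\tau h})(z_\tau-\tilde z_{\tau h})+\tfrac12\rho_\tau^*(u_{\tau h},z_{\tau h})(u_\tau-\tilde u_{\tau h})+\tfrac12S(u_{\tau h})(\tilde z_{\tau h}+z_{\tau h})+\tfrac12S'(u_{\tau h})(\tilde u_{\tau h}-u_{\tau h},z_{\tau h})+\mathcal R_h,$$ with $\mathcal R_h=\mathcal R(u_\tau,u_{\tau h})$. 4. The remainders are of third order in the errors: if $\|J'''(u_\tau+s(u-u_\tau))\|\le C$ for all $s\in[0,1]$, then $|\mathcal R_\tau|\le\frac C{12}\|u-u_\tau\|^3$, and in the situation of 3, if $\|J'''(u_{\tau h}+s(u_\tau-u_{\tau h}))\|\le C$ for all $s\in[0,1]$, then $|\mathcal R_h|\le\frac C{12}\|u_\tau-u_{\tau h}\|^3$. -/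

import Mathlib

open MeasureTheory Set Filter Topology
open scoped ENNReal ContDiff Laplacian

noncomputable section

namespace CDR

/-! ## Spaces in the space variable -/

/-- The physical space `ℝ^d`. -/
abbrev E (d : ℕ) : Type := EuclideanSpace ℝ (Fin d)

/-- `L²(Ω)`. -/
abbrev L2 {d : ℕ} (Ω : Set (E d)) : Type := Lp ℝ 2 (volume.restrict Ω)

/-- `L²(Ω)^d`. -/
abbrev L2vec {d : ℕ} (Ω : Set (E d)) : Type := Lp (E d) 2 (volume.restrict Ω)

/-- The graphs `(φ, ∇φ)` of the test functions `φ ∈ C_c^∞(Ω)`. -/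
def testGraph {d : ℕ} (Ω : Set (E d)) : Set (WithLp 2 (L2 Ω × L2vec Ω)) :=
  {x | ∃ φ : E d → ℝ, ContDiff ℝ ∞ φ ∧ HasCompactSupport φ ∧ tsupport φ ⊆ Ω ∧
    (x.fst : E d → ℝ) =ᵐ[volume.restrict Ω] φ ∧
    (x.snd : E d → E d) =ᵐ[volume.restrict Ω] gradient φ}

/-- `H_0^1(Ω)`: the closure of `C_c^∞(Ω)` in the norm `(‖v‖² + ‖∇v‖²)^{1/2}`. An element is stored
as the pair `(v, ∇v)` of the function and its weak gradient. -/
def H01 {d : ℕ} (Ω : Set (E d)) : Submodule ℝ (WithLp 2 (L2 Ω × L2vec Ω)) :=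
  (Submodule.span ℝ (testGraph Ω)).topologicalClosure

/-- `V = H_0^1(Ω)`. -/
abbrev V {d : ℕ} (Ω : Set (E d)) : Type := ↥(H01 Ω)

/-- The dual space `V'`. -/
abbrev V' {d : ℕ} (Ω : Set (E d)) : Type := StrongDual ℝ (V Ω)

/-- The embedding `V → L²(Ω)`. -/
def toL2 {d : ℕ} {Ω : Set (E d)} : V Ω →L[ℝ] L2 Ω :=
  (WithLp.fstL 2 ℝ (L2 Ω) (L2vec Ω)).comp (H01 Ω).subtypeL

/-- The weak gradient `V → L²(Ω)^d`. -/
def grad {d : ℕ} {Ω : Set (E d)} : V Ω →L[ℝ] L2vec Ω :=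
  (WithLp.sndL 2 ℝ (L2 Ω) (L2vec Ω)).comp (H01 Ω).subtypeL

/-- The embedding `L²(Ω) → V'`, `h ↦ (h, ·)`. -/
def toDual {d : ℕ} {Ω : Set (E d)} (h : L2 Ω) : V' Ω := (innerSL ℝ h).comp toL2

/-! ## Functions of time with values in `V` and `L²(Ω)` -/

/-- Pairs of a bounded function `[0,T] → L²(Ω)` and an element of `L²(I;V)`. -/
def Ambient {d : ℕ} (Ω : Set (E d)) (T : ℝ) : Type :=
  lp (fun _ : Icc (0 : ℝ) T => L2 Ω) ∞ × Lp (V Ω) 2 (volume.restrict (Ioc 0 T))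

instance {d : ℕ} (Ω : Set (E d)) (T : ℝ) : NormedAddCommGroup (Ambient Ω T) :=
  inferInstanceAs (NormedAddCommGroup
    (lp (fun _ : Icc (0 : ℝ) T => L2 Ω) ∞ × Lp (V Ω) 2 (volume.restrict (Ioc 0 T))))

instance {d : ℕ} (Ω : Set (E d)) (T : ℝ) : NormedSpace ℝ (Ambient Ω T) :=
  inferInstanceAs (NormedSpace ℝ
    (lp (fun _ : Icc (0 : ℝ) T => L2 Ω) ∞ × Lp (V Ω) 2 (volume.restrict (Ioc 0 T))))

/-- The common normed space in which the continuous and all discrete functions live: functions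
`w : [0,T] → L²(Ω)`, defined at every time, with relatively compact range, that belong to
`L²(I;V)`. It carries the norm `max (sup_t ‖w(t)‖_{L²(Ω)}) ‖w‖_{L²(I;V)}`. -/
def W {d : ℕ} (Ω : Set (E d)) (T : ℝ) : Submodule ℝ (Ambient Ω T) where
  carrier := {w | (∀ᵐ t ∂(volume.restrict (Ioc 0 T)), ∀ h : t ∈ Icc (0 : ℝ) T,
      w.1 ⟨t, h⟩ = toL2 (w.2 t)) ∧
    TotallyBounded (range fun t : Icc (0 : ℝ) T => w.1 t)}
  zero_mem' := by
    refine ⟨?_, ?_⟩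
    · filter_upwards [Lp.coeFn_zero (V Ω) 2 (volume.restrict (Ioc 0 T))] with t ht h
      exact (show (0 : L2 Ω) = toL2 ((0 : Lp (V Ω) 2 (volume.restrict (Ioc 0 T))) t) by
        rw [ht, Pi.zero_apply, map_zero])
    · refine TotallyBounded.subset ?_ (isCompact_singleton (x := (0 : L2 Ω))).totallyBounded
      rintro _ ⟨t, rfl⟩
      exact mem_singleton_iff.mpr rfl
  add_mem' := by
    rintro x y ⟨hx, hx'⟩ ⟨hy, hy'⟩
    refine ⟨?_, ?_⟩
    · filter_upwards [hx, hy, Lp.coeFn_add x.2 y.2] with t h1 h2 h3 h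
      exact (show x.1 ⟨t, h⟩ + y.1 ⟨t, h⟩ = toL2 ((x.2 + y.2 : Lp _ _ _) t) by
        rw [h3, Pi.add_apply, map_add, h1 h, h2 h])
    · have hc := ((hx'.closure.isCompact_of_isClosed isClosed_closure).prod
        (hy'.closure.isCompact_of_isClosed isClosed_closure)).image continuous_add
      refine TotallyBounded.subset ?_ hc.totallyBounded
      rintro _ ⟨t, rfl⟩
      exact ⟨(x.1 t, y.1 t), ⟨subset_closure ⟨t, rfl⟩, subset_closure ⟨t, rfl⟩⟩, rfl⟩
  smul_mem' := by
    rintro c x ⟨hx, hx'⟩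
    refine ⟨?_, ?_⟩
    · filter_upwards [hx, Lp.coeFn_smul c x.2] with t h1 h3 h
      exact (show c • x.1 ⟨t, h⟩ = toL2 ((c • x.2 : Lp _ _ _) t) by
        rw [h3, Pi.smul_apply, map_smul, h1 h])
    · refine TotallyBounded.subset ?_ (hx'.image (uniformContinuous_const_smul c))
      rintro _ ⟨t, rfl⟩
      exact ⟨x.1 t, ⟨t, rfl⟩, rfl⟩

section
variable {d : ℕ} {Ω : Set (E d)} {T : ℝ}

/-- The value `w(t) ∈ L²(Ω)` at a time `t ∈ [0,T]` (zero outside `[0,T]`). -/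
def val (w : W Ω T) (t : ℝ) : L2 Ω := if h : t ∈ Icc (0 : ℝ) T then w.1.1 ⟨t, h⟩ else 0

/-- `w` as an element of `L²(I;V)`. -/
def valV (w : W Ω T) : Lp (V Ω) 2 (volume.restrict (Ioc 0 T)) := w.1.2

/-- The limit `w(s⁺)` in `L²(Ω)`. -/
def limR (w : W Ω T) (s : ℝ) : L2 Ω := limUnder (𝓝[>] s) (val w)

/-- The limit `w(s⁻)` in `L²(Ω)`. -/
def limL (w : W Ω T) (s : ℝ) : L2 Ω := limUnder (𝓝[<] s) (val w)

/-- The jump `[w] = w(s⁺) - w(s⁻)`. -/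
def jump (w : W Ω T) (s : ℝ) : L2 Ω := limR w s - limL w s

/-- The limit `w(s⁺)` taken in `V`; as `w` is an almost everywhere defined function of time with
values in `V`, null sets of times are disregarded. -/
def limRV (w : W Ω T) (s : ℝ) : V Ω := limUnder (𝓝[>] s ⊓ ae volume) (valV w)

/-- `g ∈ L²(I;V')` is the weak time derivative of `w` on the interval `(a,b)`, in the sense of
`V'`-valued distributions: `∫ ψ' w dt = - ∫ ψ g dt` for all `ψ ∈ C_c^∞((a,b))`. -/
def HasTimeDeriv (w : W Ω T) (g : Lp (V' Ω) 2 (volume.restrict (Ioc 0 T))) (a b : ℝ) : Prop :=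
  ∀ ψ : ℝ → ℝ, ContDiff ℝ ∞ ψ → HasCompactSupport ψ → tsupport ψ ⊆ Ioo a b →
    ∫ t in Ioc 0 T, deriv ψ t • toDual (val w t) = - ∫ t in Ioc 0 T, ψ t • g t

open Classical in
/-- The weak time derivative `∂_t w ∈ L²(I;V')` on the whole of `I = (0,T)` (zero if there is
none). -/
def timeDeriv (w : W Ω T) : Lp (V' Ω) 2 (volume.restrict (Ioc 0 T)) :=
  if h : ∃ g, HasTimeDeriv w g 0 T then h.choose else 0

end

/-- The space `𝒱 = {v ∈ L²(I;V) | ∂_t v ∈ L²(I;V')}`. As usual, `v` is identified with its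
representative in `C([0,T]; L²(Ω))`. -/
def energySpace {d : ℕ} (Ω : Set (E d)) (T : ℝ) : Set (W Ω T) :=
  {w | Continuous (fun t : Icc (0 : ℝ) T => w.1.1 t) ∧ ∃ g, HasTimeDeriv w g 0 T}

/-! ## Discretization in time -/

/-- A partition `0 = t_0 < t_1 < … < t_N = T`, `N ≥ 1`, of `[0,T]`. The slab with index
`n ∈ {0, …, N-1}` is `(t_n, t_{n+1}]`. -/
structure TimePartition (T : ℝ) where
  N : ℕ
  one_le_N : 1 ≤ N
  t : ℕ → ℝ
  t_zero : t 0 = 0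
  t_last : t N = T
  lt_succ : ∀ n < N, t n < t (n + 1)

/-- The slab `(t_n, t_{n+1}]`. -/
def TimePartition.slab {T : ℝ} (P : TimePartition T) (n : ℕ) : Set ℝ := Ioc (P.t n) (P.t (n + 1))

/-- On the slab `n`, `w` is a polynomial in time of degree at most `r` with coefficients in `Z`. -/
def IsPolyOnSlab {d : ℕ} {Ω : Set (E d)} {T : ℝ} (P : TimePartition T) (r : ℕ) (Z : Set (V Ω))
    (w : W Ω T) (n : ℕ) : Prop :=
  ∃ c : Fin (r + 1) → V Ω, (∀ k, c k ∈ Z) ∧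
    (∀ t ∈ P.slab n, val w t = toL2 (∑ k : Fin (r + 1), t ^ (k : ℕ) • c k)) ∧
    (∀ᵐ t ∂(volume.restrict (P.slab n)), valV w t = ∑ k : Fin (r + 1), t ^ (k : ℕ) • c k)

/-- The semidiscrete space `𝒱_τ^r`. Its members have a value in `L²(Ω)` at `t = 0`, as all members
of `W` do. -/
def dGSpace {d : ℕ} (Ω : Set (E d)) {T : ℝ} (P : TimePartition T) (r : ℕ) : Set (W Ω T) :=
  {w | ∀ n < P.N, IsPolyOnSlab P r univ w n}

open Classical in
/-- The slabwise weak time derivative: the element of `L²(I;V')` that is the weak time derivative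
of `w` in the interior of each slab (zero if there is none). -/
def slabTimeDeriv {d : ℕ} {Ω : Set (E d)} {T : ℝ} (P : TimePartition T) (w : W Ω T) :
    Lp (V' Ω) 2 (volume.restrict (Ioc 0 T)) :=
  if h : ∃ g, ∀ n < P.N, HasTimeDeriv w g (P.t n) (P.t (n + 1)) then h.choose else 0

/-! ## Data of the problem, the continuous and the semidiscrete forms -/

/-- The data of the convection-diffusion-reaction problem on `Ω × (0,T)`. For `b` and `α`
everywhere defined representatives are fixed. -/
structure Data {d : ℕ} (Ω : Set (E d)) (T : ℝ) where
  /-- diffusion coefficient -/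
  ε : ℝ
  ε_pos : 0 < ε
  ε_le_one : ε ≤ 1
  /-- convection field -/
  b : ℝ → E d → E d
  b_meas : Measurable (Function.uncurry b)
  b_bdd : ∃ C, ∀ t ∈ Icc (0 : ℝ) T, ∀ x ∈ Ω, ‖b t x‖ ≤ C
  /-- reaction coefficient -/
  α : ℝ → E d → ℝ
  α_meas : Measurable (Function.uncurry α)
  α_bdd : ∃ C, ∀ t ∈ Icc (0 : ℝ) T, ∀ x ∈ Ω, α t x ≤ C
  α_nonneg : ∀ t ∈ Icc (0 : ℝ) T, ∀ x ∈ Ω, 0 ≤ α t x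
  /-- initial value -/
  u₀ : L2 Ω
  /-- right-hand side in `L²(I;V')` -/
  f : Lp (V' Ω) 2 (volume.restrict (Ioc 0 T))

section
variable {d : ℕ} {Ω : Set (E d)} {T : ℝ}

/-- `a(v)(φ) = (ε∇v, ∇φ) + (b(t)·∇v, φ) + (α(t)v, φ)`. -/
def Data.a (D : Data Ω T) (t : ℝ) (v φ : V Ω) : ℝ :=
  D.ε * inner ℝ (grad v) (grad φ)
    + (∫ x in Ω, inner ℝ (D.b t x) (grad v x) * toL2 φ x)
    + ∫ x in Ω, D.α t x * toL2 v x * toL2 φ x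

/-- `A(u)(φ) = ∫_I {⟨∂_t u, φ⟩ + a(u)(φ)} dt + (u(0), φ(0))`. -/
def Data.A (D : Data Ω T) (u φ : W Ω T) : ℝ :=
  (∫ t in Ioc 0 T, (timeDeriv u t (valV φ t) + D.a t (valV u t) (valV φ t)))
    + inner ℝ (val u 0) (val φ 0)

/-- `F(φ) = ∫_I ⟨f, φ⟩ dt + (u₀, φ(0))`. -/
def Data.F (D : Data Ω T) (φ : W Ω T) : ℝ :=
  (∫ t in Ioc 0 T, D.f t (valV φ t)) + inner ℝ D.u₀ (val φ 0)

/-- The semidiscrete form: the sum over the slabs of `∫ {⟨∂_t u, φ⟩ + a(u)(φ)} dt`, plus the terms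
`([u]_n, φ(t_n⁺))` at the interior nodes, plus `(u(0⁺), φ(0⁺))`. -/
def Data.Aτ (D : Data Ω T) (P : TimePartition T) (u φ : W Ω T) : ℝ :=
  (∑ n ∈ Finset.range P.N, ∫ t in P.slab n,
      (slabTimeDeriv P u t (valV φ t) + D.a t (valV u t) (valV φ t)))
    + (∑ n ∈ Finset.Ico 1 P.N, inner ℝ (jump u (P.t n)) (limR φ (P.t n)))
    + inner ℝ (limR u 0) (limR φ 0)

/-- `F_τ(φ) = ∫_I ⟨f, φ⟩ dt + (u₀, φ(0⁺))`. -/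
def Data.Fτ (D : Data Ω T) (φ : W Ω T) : ℝ :=
  (∫ t in Ioc 0 T, D.f t (valV φ t)) + inner ℝ D.u₀ (limR φ 0)

end

/-! ## Discretization in space and SUPG stabilization -/

/-- The reference element `(0,1)^d`. -/
def refCube (d : ℕ) : Set (E d) := {x | ∀ i, x i ∈ Ioo (0 : ℝ) 1}

/-- The closed reference element `[0,1]^d`. -/
def closedRefCube (d : ℕ) : Set (E d) := {x | ∀ i, x i ∈ Icc (0 : ℝ) 1}

/-- A decomposition of `Ω` into finitely many disjoint iso-parametric elements `K = T_K((0,1)^d)`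
whose closures cover `closure Ω`; the components of `T_K` lie in `Q_p`, the polynomials of degree
at most `p` in each variable, and `T_K` is orientation preserving and nondegenerate up to the
boundary of the reference element. Hanging nodes are allowed. -/
structure Mesh {d : ℕ} (Ω : Set (E d)) (p : ℕ) where
  /-- number of elements -/
  card : ℕ
  /-- components of the transformations -/
  poly : Fin card → Fin d → MvPolynomial (Fin d) ℝ
  /-- the transformation `T_K` -/
  map : Fin card → E d → E d
  map_apply : ∀ K x i, map K x i = MvPolynomial.eval (fun j => x j) (poly K i)
  poly_mem : ∀ K i, poly K i ∈ MvPolynomial.restrictDegree (Fin d) ℝ p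
  injOn : ∀ K, InjOn (map K) (refCube d)
  det_pos : ∀ K, ∀ x ∈ closedRefCube d, 0 < (fderiv ℝ (map K) x).det
  subset : ∀ K, map K '' refCube d ⊆ Ω
  disjoint : ∀ K L, K ≠ L → Disjoint (map K '' refCube d) (map L '' refCube d)
  cover : closure Ω = ⋃ K, closure (map K '' refCube d)

/-- The element `K` as a subset of `Ω`. -/
def Mesh.elem {d : ℕ} {Ω : Set (E d)} {p : ℕ} (M : Mesh Ω p) (K : Fin M.card) : Set (E d) :=
  M.map K '' refCube d

/-- The finite element space `V_h^p`: members of `V` with a representative that is continuous on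
`closure Ω` and in the mapped space `Q_p(K)` on every element. -/
def feSpace {d : ℕ} {Ω : Set (E d)} {p : ℕ} (M : Mesh Ω p) : Set (V Ω) :=
  {v | ∃ g : E d → ℝ, ContinuousOn g (closure Ω) ∧
    (toL2 v : E d → ℝ) =ᵐ[volume.restrict Ω] g ∧
    ∀ K, ∃ q ∈ MvPolynomial.restrictDegree (Fin d) ℝ p,
      ∀ x ∈ refCube d, g (M.map K x) = MvPolynomial.eval (fun j => x j) q}

/-- The fully discrete space `𝒱_{τh}^{r,p}`; the mesh may change from slab to slab. -/
def fullSpace {d : ℕ} {Ω : Set (E d)} {T : ℝ} (P : TimePartition T) (r : ℕ) {p : ℕ}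
    (M : ℕ → Mesh Ω p) : Set (W Ω T) :=
  {w | (∀ n < P.N, IsPolyOnSlab P r (feSpace (M n)) w n) ∧ ∃ v ∈ feSpace (M 0), val w 0 = toL2 v}

open Classical in
/-- The representative of `v` that is continuous on `Ω` (zero if there is none). -/
def contRep {d : ℕ} {Ω : Set (E d)} (v : V Ω) : E d → ℝ :=
  if h : ∃ g : E d → ℝ, ContinuousOn g Ω ∧ (toL2 v : E d → ℝ) =ᵐ[volume.restrict Ω] g
  then h.choose else 0

section
variable {d : ℕ} {Ω : Set (E d)} {T : ℝ}

/-- The residual `r(u) = ∂_t u - ∇·(ε∇u) + b·∇u + αu - g` of a discrete function `u` at the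
time `t` and at a point `x` inside an element; `g` is the right-hand side in `L²(I;L²(Ω))`. The
Laplacian is the classical one of the continuous representative. -/
def Data.res (D : Data Ω T) (g : Lp (L2 Ω) 2 (volume.restrict (Ioc 0 T))) (u : W Ω T)
    (t : ℝ) (x : E d) : ℝ :=
  deriv (val u) t x - D.ε * (Δ (contRep (valV u t))) x
    + inner ℝ (D.b t x) (grad (valV u t) x) + D.α t x * toL2 (valV u t) x - g t x

/-- The SUPG stabilization: the sums over the slabs and elements of
`∫ δ_K (r(u), b·∇φ)_K dt`, the terms `δ_K ([u]_n, b·∇φ(t_n⁺))_K` at the interior nodes, with the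
elements of the slab that follows, and the terms `δ_K (u(0⁺) - u₀, b·∇φ(0⁺))_K`. -/
def Data.S (D : Data Ω T) (P : TimePartition T) {p : ℕ} (M : ℕ → Mesh Ω p)
    (δ : (n : ℕ) → Fin (M n).card → ℝ) (g : Lp (L2 Ω) 2 (volume.restrict (Ioc 0 T)))
    (u φ : W Ω T) : ℝ :=
  (∑ n ∈ Finset.range P.N, ∫ t in P.slab n, ∑ K, δ n K *
      ∫ x in (M n).elem K, D.res g u t x * inner ℝ (D.b t x) (grad (valV φ t) x))
    + (∑ n ∈ Finset.Ico 1 P.N, ∑ K, δ n K *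
      ∫ x in (M n).elem K,
        jump u (P.t n) x * inner ℝ (D.b (P.t n) x) (grad (limRV φ (P.t n)) x))
    + ∑ K, δ 0 K *
      ∫ x in (M 0).elem K,
        (limR u 0 - D.u₀ : L2 Ω) x * inner ℝ (D.b 0 x) (grad (limRV φ 0) x)

/-- `A_S = A_τ + S`. -/
def Data.AS (D : Data Ω T) (P : TimePartition T) {p : ℕ} (M : ℕ → Mesh Ω p)
    (δ : (n : ℕ) → Fin (M n).card → ℝ) (g : Lp (L2 Ω) 2 (volume.restrict (Ioc 0 T)))
    (u φ : W Ω T) : ℝ :=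
  D.Aτ P u φ + D.S P M δ g u φ

/-! ## Goal functional, Lagrangians, residuals and remainder -/

/-- The goal functional `J(u) = ∫_0^T J_t(u(t)) dt + J_T(u(T))`. -/
def goal (Jt : ℝ → V Ω → ℝ) (JT : L2 Ω → ℝ) (u : W Ω T) : ℝ :=
  (∫ t in Ioc 0 T, Jt t (valV u t)) + JT (val u T)

/-- `ℒ(u,z) = J(u) + F(z) - A(u)(z)`. -/
def Data.lagr (D : Data Ω T) (J : W Ω T → ℝ) (y : W Ω T × W Ω T) : ℝ :=
  J y.1 + D.F y.2 - D.A y.1 y.2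

/-- `ℒ_τ(u,z) = J(u) + F_τ(z) - A_τ(u)(z)`. -/
def Data.lagrτ (D : Data Ω T) (P : TimePartition T) (J : W Ω T → ℝ) (y : W Ω T × W Ω T) : ℝ :=
  J y.1 + D.Fτ y.2 - D.Aτ P y.1 y.2

/-- `ℒ_{τh}(u,z) = J(u) + F_τ(z) - A_S(u)(z)`. -/
def Data.lagrτh (D : Data Ω T) (P : TimePartition T) {p : ℕ} (M : ℕ → Mesh Ω p)
    (δ : (n : ℕ) → Fin (M n).card → ℝ) (g : Lp (L2 Ω) 2 (volume.restrict (Ioc 0 T)))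
    (J : W Ω T → ℝ) (y : W Ω T × W Ω T) : ℝ :=
  J y.1 + D.Fτ y.2 - D.AS P M δ g y.1 y.2

/-- `y ∈ X × X` and the directional derivatives `L'(y)(δu, δz)` vanish for all `δu, δz ∈ X`. -/
def StationaryOn (L : W Ω T × W Ω T → ℝ) (X : Set (W Ω T)) (y : W Ω T × W Ω T) : Prop :=
  y.1 ∈ X ∧ y.2 ∈ X ∧ ∀ δu ∈ X, ∀ δz ∈ X, HasLineDerivAt ℝ L 0 y (δu, δz)

/-- The primal residual `ρ_τ(u)(φ) = F_τ(φ) - A_τ(u)(φ)`. -/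
def Data.ρ (D : Data Ω T) (P : TimePartition T) (u φ : W Ω T) : ℝ := D.Fτ φ - D.Aτ P u φ

/-- The adjoint residual `J'(u)(φ) - A_τ'(u)(φ,z)`. -/
def Data.ρstar (D : Data Ω T) (P : TimePartition T) (J : W Ω T → ℝ) (u z φ : W Ω T) : ℝ :=
  fderiv ℝ J u φ - lineDeriv ℝ (fun w => D.Aτ P w z) u φ

/-- The remainder `½ ∫_0^1 D³J(y + s e)(e,e,e) s (s-1) ds` with the error `e = x - y`. -/
def remainder (J : W Ω T → ℝ) (x y : W Ω T) : ℝ :=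
  1 / 2 * ∫ s in (0 : ℝ)..1,
    iteratedFDeriv ℝ 3 J (y + s • (x - y)) (fun _ => x - y) * (s * (s - 1))

end

end CDR

end

noncomputable section

namespace CDR

section
variable {d : ℕ} {Ω : Set (E d)} {T : ℝ}

/-! ## Instances -/

-- Every part of the Lagrangians except `J` is bilinear or linear on the spaces concerned, so the
-- nonlinearity sits in `J` alone. Along the segment from `y` to `x`, with `e = x - y`, the
-- trapezoidal rule gives `J x - J y = ½ J'(x)(e) + ½ J'(y)(e)` plus a remainder that contains only
-- `J'''` (`sub_eq_trapezoid`, `sub_eq_fderiv_trapezoid`). The stationarity conditions turn the two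
-- derivatives into residuals, and Galerkin orthogonality allows arbitrary discrete functions to be
-- subtracted from the weights. The constant in the bound is `½ ∫ s(1-s) ds = 1/12`.
--
-- This algebra needs one linear space on which `Aτ` is bilinear and which contains both the
-- continuous and the discrete functions. It is `slabRegular`: one-sided limits at the nodes and a
-- weak time derivative on each slab. On the energy space the jumps vanish and `Aτ`, `Fτ` reduce to
-- `A`, `F`, which settles the transfer of stationarity.
--
-- The real difficulty is that the semidiscrete space is not contained in the energy space.
-- Stationarity of `(u, z)` yields equations only for test functions continuous in time, and they
-- are needed for discontinuous ones.
--
-- For the primal equation, testing with `ψ(t) v` shows that for each fixed `v` the residual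
-- vanishes at almost every time, and a constant test function gives the initial condition. A
-- semidiscrete function uses finitely many vectors `v`, so the equation extends
-- (`Data.Aτ_eq_Fτ_of_weak`).
--
-- For the dual equation the test functions enter through `J'(u)`, and a step in time is no limit of
-- continuous functions in the supremum norm of `W`. What helps is that `J` is an integral over time
-- plus a final term: this makes `J'(u)` continuous under bounded pointwise convergence of `ζ_j(t)
-- c` (`tendsto_fderiv_goal`). Smoothed steps can then be replaced by steps. The derivatives of the
-- smoothed steps tend to Dirac measures, and the resulting point values regroup into the jump terms
-- of `Aτ` (`Data.fderiv_goal_eq_Aτ`).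
--
-- For the spatial error the discrete spaces are nested, but the stabilization perturbs the
-- orthogonality. At a stationary point `S` equals the primal residual and its derivative the
-- adjoint residual (`Data.stabilization_of_stationary`), which produces the two extra terms.
-- Linearity of `S` in the test function requires square integrable element residuals, hence a bound
-- for the Laplacian up to the element boundary (`exists_laplacian_bound`).

scoped instance : NormedAddCommGroup (V Ω) := inferInstance

scoped instance : NormedSpace ℝ (V Ω) := inferInstance

scoped instance : NormedAddCommGroup (V' Ω) := inferInstance

scoped instance : NormedSpace ℝ (V' Ω) := inferInstance

scoped instance : NormSMulClass ℝ (V' Ω) := @NormedSpace.toNormSMulClass ℝ (V' Ω) _ _ _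

scoped instance : IsBoundedSMul ℝ (V' Ω) := @NormedSpace.toIsBoundedSMul ℝ (V' Ω) _ _ _

scoped instance : ContinuousENorm (V' Ω) := @SeminormedAddGroup.toContinuousENorm (V' Ω) _

/-! ## The ambient space `W` -/

theorem val_of_mem (w : W Ω T) {t : ℝ} (h : t ∈ Icc (0 : ℝ) T) : val w t = w.1.1 ⟨t, h⟩ := dif_pos h

theorem val_of_notMem (w : W Ω T) {t : ℝ} (h : t ∉ Icc (0 : ℝ) T) : val w t = 0 := dif_neg h

theorem val_add (w w' : W Ω T) (t : ℝ) : val (w + w') t = val w t + val w' t := by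
  by_cases h : t ∈ Icc (0 : ℝ) T
  · simp only [val_of_mem _ h]; rfl
  · simp [val_of_notMem _ h]

theorem val_smul (c : ℝ) (w : W Ω T) (t : ℝ) : val (c • w) t = c • val w t := by
  by_cases h : t ∈ Icc (0 : ℝ) T
  · simp only [val_of_mem _ h]; rfl
  · simp [val_of_notMem _ h]

/-- The evaluation at a time as a linear map. -/
def valLin (t : ℝ) : W Ω T →ₗ[ℝ] L2 Ω where
  toFun w := val w t
  map_add' w w' := val_add w w' t
  map_smul' c w := val_smul c w t

theorem val_sum {ι : Type*} (s : Finset ι) (w : ι → W Ω T) (t : ℝ) :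
    val (∑ i ∈ s, w i) t = ∑ i ∈ s, val (w i) t := map_sum (valLin t) w s

theorem val_zero (t : ℝ) : val (0 : W Ω T) t = 0 := map_zero (valLin t)

theorem val_sub (w w' : W Ω T) (t : ℝ) : val (w - w') t = val w t - val w' t :=
  map_sub (valLin t) w w'

/-- The class in `L²(I;V)` as a linear map. -/
def valVLin : W Ω T →ₗ[ℝ] Lp (V Ω) 2 (volume.restrict (Ioc 0 T)) where
  toFun w := valV w
  map_add' _ _ := rfl
  map_smul' _ _ := rfl

theorem valV_add (w w' : W Ω T) : valV (w + w') = valV w + valV w' := rfl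

theorem valV_smul (c : ℝ) (w : W Ω T) : valV (c • w) = c • valV w := rfl

theorem valV_sub (w w' : W Ω T) : valV (w - w') = valV w - valV w' := map_sub valVLin w w'

theorem valV_add_ae (w w' : W Ω T) : ∀ᵐ t ∂(volume.restrict (Ioc 0 T)),
    valV (w + w') t = valV w t + valV w' t := Lp.coeFn_add _ _

theorem valV_smul_ae (c : ℝ) (w : W Ω T) : ∀ᵐ t ∂(volume.restrict (Ioc 0 T)),
    valV (c • w) t = c • valV w t := Lp.coeFn_smul _ _

theorem valV_sum_ae {ι : Type*} (s : Finset ι) (w : ι → W Ω T) :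
    ∀ᵐ t ∂(volume.restrict (Ioc 0 T)), valV (∑ i ∈ s, w i) t = ∑ i ∈ s, valV (w i) t := by
  classical
  induction s using Finset.induction_on with
  | empty =>
    filter_upwards [Lp.coeFn_zero (V Ω) 2 (volume.restrict (Ioc 0 T))] with t ht
    simp only [Finset.sum_empty]
    exact ht
  | insert i s hi ih =>
    rw [Finset.sum_insert hi]
    filter_upwards [ih, valV_add_ae (w i) (∑ j ∈ s, w j)] with t h1 h2
    rw [h2, h1, Finset.sum_insert hi]

/-- The class in `L²(I;V)` does not determine the values at single times, so both components have to
be compared. -/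
theorem ext_W {w w' : W Ω T} (h : ∀ t ∈ Icc (0 : ℝ) T, val w t = val w' t)
    (hV : ∀ᵐ t ∂(volume.restrict (Ioc 0 T)), valV w t = valV w' t) : w = w' := by
  refine Subtype.ext (Prod.ext ?_ (Lp.ext hV))
  refine lp.ext (funext fun t => ?_)
  have := h t.1 t.2
  rwa [val_of_mem _ t.2, val_of_mem _ t.2] at this

theorem val_ae_eq (w : W Ω T) :
    ∀ᵐ t ∂(volume.restrict (Ioc 0 T)), val w t = toL2 (valV w t) := by
  filter_upwards [w.2.1, ae_restrict_mem measurableSet_Ioc] with t ht hm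
  rw [val_of_mem w ⟨hm.1.le, hm.2⟩]
  exact ht _

theorem memLp_valV (w : W Ω T) : MemLp (valV w) 2 (volume.restrict (Ioc 0 T)) := Lp.memLp _

/-- Membership in `W` does not mention measurability of `t ↦ w(t)`; it is inherited from the class
in `L²(I;V)` through the almost everywhere identity. -/
theorem memLp_val (w : W Ω T) : MemLp (val w) 2 (volume.restrict (Ioc 0 T)) :=
  ((toL2 (Ω := Ω)).comp_memLp' (memLp_valV w)).ae_eq
    ((val_ae_eq w).mono fun _ h => h.symm)

/-- The embedding `L²(Ω) → V'` as a continuous linear map. -/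
def toDualL : L2 Ω →L[ℝ] V' Ω :=
  LinearMap.mkContinuous
    { toFun := toDual
      map_add' := fun x y => by ext v; simp [toDual]
      map_smul' := fun c x => by ext v; simp [toDual] }
    ‖toL2 (Ω := Ω)‖ fun x => by
      refine (ContinuousLinearMap.opNorm_comp_le _ _).trans ?_
      rw [innerSL_apply_norm, mul_comm]

theorem toDualL_apply (h : L2 Ω) : toDualL h = toDual h := rfl

theorem toDual_apply (h : L2 Ω) (v : V Ω) : toDual h v = inner ℝ h (toL2 v) := rfl

/-! ## Weak time derivatives -/

theorem memLp_toDual_val (w : W Ω T) :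
    MemLp (fun t => toDual (val w t)) 2 (volume.restrict (Ioc 0 T)) :=
  (toDualL (Ω := Ω)).comp_memLp' (memLp_val w)

theorem integrable_test_smul {F : Type*} [NormedAddCommGroup F] [NormedSpace ℝ F] {ψ : ℝ → ℝ}
    (hψ : Continuous ψ) (hc : HasCompactSupport ψ) {g : ℝ → F} {s : Set ℝ}
    [IsFiniteMeasure (volume.restrict s)]
    (hg : MemLp g 2 (volume.restrict s)) :
    Integrable (fun t => ψ t • g t) (volume.restrict s) := by
  obtain ⟨C, hC⟩ := hc.exists_bound_of_continuous hψ
  exact (hg.integrable (by norm_num)).bdd_smul C hψ.aestronglyMeasurable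
    (Eventually.of_forall hC)

theorem HasTimeDeriv.add {w w' : W Ω T} {g g' : Lp (V' Ω) 2 (volume.restrict (Ioc 0 T))}
    {a b : ℝ} (h : HasTimeDeriv w g a b) (h' : HasTimeDeriv w' g' a b) :
    HasTimeDeriv (w + w') (g + g') a b := by
  intro ψ h1 h2 h3
  have hd : Continuous (deriv ψ) := h1.continuous_deriv (by simp)
  have e1 : ∫ t in Ioc 0 T, deriv ψ t • toDual (val (w + w') t)
      = (∫ t in Ioc 0 T, deriv ψ t • toDual (val w t))
        + ∫ t in Ioc 0 T, deriv ψ t • toDual (val w' t) := by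
    rw [← integral_add (integrable_test_smul hd h2.deriv (memLp_toDual_val w))
      (integrable_test_smul hd h2.deriv (memLp_toDual_val w'))]
    refine integral_congr_ae (Eventually.of_forall fun t => ?_)
    simp only [val_add, ← toDualL_apply, map_add, smul_add]
  have e2 : ∫ t in Ioc 0 T, ψ t • (g + g') t
      = (∫ t in Ioc 0 T, ψ t • g t) + ∫ t in Ioc 0 T, ψ t • g' t := by
    rw [← integral_add (integrable_test_smul h1.continuous h2 (Lp.memLp g))
      (integrable_test_smul h1.continuous h2 (Lp.memLp g'))]
    refine integral_congr_ae ?_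
    filter_upwards [Lp.coeFn_add g g'] with t ht
    rw [ht, Pi.add_apply, smul_add]
  rw [e1, e2, h ψ h1 h2 h3, h' ψ h1 h2 h3, neg_add]

theorem HasTimeDeriv.smul (c : ℝ) {w : W Ω T} {g : Lp (V' Ω) 2 (volume.restrict (Ioc 0 T))}
    {a b : ℝ} (h : HasTimeDeriv w g a b) : HasTimeDeriv (c • w) (c • g) a b := by
  intro ψ h1 h2 h3
  have e1 : ∫ t in Ioc 0 T, deriv ψ t • toDual (val (c • w) t)
      = c • ∫ t in Ioc 0 T, deriv ψ t • toDual (val w t) := by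
    rw [← integral_smul]
    refine integral_congr_ae (Eventually.of_forall fun t => ?_)
    simp only [val_smul, ← toDualL_apply, map_smul, smul_comm c]
  have e2 : ∫ t in Ioc 0 T, ψ t • (c • g) t = c • ∫ t in Ioc 0 T, ψ t • g t := by
    rw [← integral_smul]
    refine integral_congr_ae ?_
    filter_upwards [Lp.coeFn_smul c g] with t ht
    rw [ht, Pi.smul_apply, smul_comm]
  rw [e1, e2, h ψ h1 h2 h3, smul_neg]

theorem hasTimeDeriv_zero (a b : ℝ) : HasTimeDeriv (0 : W Ω T) 0 a b := by
  intro ψ _ _ _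
  have h : ∫ t in Ioc 0 T, ψ t • (0 : Lp (V' Ω) 2 (volume.restrict (Ioc 0 T))) t = 0 := by
    rw [← integral_zero ℝ (V' Ω) (μ := volume.restrict (Ioc 0 T))]
    refine integral_congr_ae ?_
    filter_upwards [Lp.coeFn_zero (V' Ω) 2 (volume.restrict (Ioc 0 T))] with t ht
    rw [ht, Pi.zero_apply, smul_zero]
  rw [h]
  simp [val_zero, ← toDualL_apply]

theorem HasTimeDeriv.mono {w : W Ω T} {g : Lp (V' Ω) 2 (volume.restrict (Ioc 0 T))}
    {a b a' b' : ℝ} (h : HasTimeDeriv w g a b) (ha : a ≤ a') (hb : b' ≤ b) :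
    HasTimeDeriv w g a' b' :=
  fun ψ h1 h2 h3 => h ψ h1 h2 (h3.trans (Ioo_subset_Ioo ha hb))

/-- The weak time derivative only depends on the function and the derivative inside the interval. -/
theorem HasTimeDeriv.congr {w w' : W Ω T} {g g' : Lp (V' Ω) 2 (volume.restrict (Ioc 0 T))}
    {a b : ℝ} (h : HasTimeDeriv w g a b) (hw : ∀ t ∈ Ioo a b, val w' t = val w t)
    (hg : ∀ᵐ t ∂(volume.restrict (Ioc 0 T)), t ∈ Ioo a b → g' t = g t) :
    HasTimeDeriv w' g' a b := by
  intro ψ h1 h2 h3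
  have e1 : ∫ t in Ioc 0 T, deriv ψ t • toDual (val w' t)
      = ∫ t in Ioc 0 T, deriv ψ t • toDual (val w t) := by
    refine integral_congr_ae (Eventually.of_forall fun t => ?_)
    by_cases ht : t ∈ Ioo a b
    · simp only [hw t ht]
    · have : deriv ψ t = 0 := by
        by_contra hne
        exact ht (h3 (tsupport_deriv_subset (𝕜 := ℝ) (subset_tsupport _ hne)))
      simp [this]
  have e2 : ∫ t in Ioc 0 T, ψ t • g' t = ∫ t in Ioc 0 T, ψ t • g t := by
    refine integral_congr_ae ?_
    filter_upwards [hg] with t ht'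
    by_cases ht : t ∈ Ioo a b
    · simp only [ht' ht]
    · have : ψ t = 0 := by
        by_contra hne
        exact ht (h3 (subset_tsupport _ hne))
      simp [this]
  rw [e1, e2, h ψ h1 h2 h3]

/-- By the du Bois-Reymond lemma, as both candidates have the same integral against every test
function supported in `(a,b)`. This makes the choices inside `timeDeriv` and `slabTimeDeriv`
harmless. -/
theorem HasTimeDeriv.unique {w : W Ω T} {g g' : Lp (V' Ω) 2 (volume.restrict (Ioc 0 T))}
    {a b : ℝ} (ha : 0 ≤ a) (hb : b ≤ T) (h : HasTimeDeriv w g a b) (h' : HasTimeDeriv w g' a b) :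
    ∀ᵐ t ∂(volume.restrict (Ioc a b)), g t = g' t := by
  have hint : Integrable (fun t => g t - g' t) (volume.restrict (Ioc 0 T)) :=
    ((Lp.memLp g).sub (Lp.memLp g')).integrable (by norm_num)
  have hsub : Ioo a b ⊆ Ioc 0 T := fun t ht => ⟨ha.trans_lt ht.1, (ht.2.le).trans hb⟩
  have key := IsOpen.ae_eq_zero_of_integral_contDiff_smul_eq_zero (isOpen_Ioo (a := a) (b := b))
    (f := fun t => g t - g' t) (μ := volume.restrict (Ioc 0 T))
    (hint.locallyIntegrable.locallyIntegrableOn _) ?_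
  · rw [ae_restrict_iff' measurableSet_Ioc] at key
    have h1 : ∀ᵐ t ∂(volume.restrict (Ioo a b)), g t = g' t := by
      rw [ae_restrict_iff' measurableSet_Ioo]
      filter_upwards [key] with t ht hm
      exact sub_eq_zero.1 (ht (hsub hm) hm)
    have h2 : ae (volume.restrict (Ioc a b)) = ae (volume.restrict (Ioo a b)) := by
      rw [restrict_Ioo_eq_restrict_Ioc]
    exact h2 ▸ h1
  · intro ψ h1 h2 h3
    have e := h ψ h1 h2 h3
    rw [h' ψ h1 h2 h3, neg_inj] at e
    simp only [smul_sub]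
    rw [integral_sub (integrable_test_smul h1.continuous h2 (Lp.memLp g))
      (integrable_test_smul h1.continuous h2 (Lp.memLp g')), ← e, sub_self]

theorem hasTimeDeriv_timeDeriv {w : W Ω T} (h : ∃ g, HasTimeDeriv w g 0 T) :
    HasTimeDeriv w (timeDeriv w) 0 T := by
  unfold timeDeriv; rw [dif_pos h]; exact h.choose_spec

theorem timeDeriv_ae_eq {w : W Ω T} {g : Lp (V' Ω) 2 (volume.restrict (Ioc 0 T))}
    (h : HasTimeDeriv w g 0 T) : ∀ᵐ t ∂(volume.restrict (Ioc 0 T)), timeDeriv w t = g t :=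
  (hasTimeDeriv_timeDeriv ⟨g, h⟩).unique le_rfl le_rfl h

/-! ## Partitions of the time interval -/

section
variable (P : TimePartition T)

theorem TimePartition.t_mono {m n : ℕ} (h : m ≤ n) (hn : n ≤ P.N) : P.t m ≤ P.t n := by
  induction n, h using Nat.le_induction with
  | base => exact le_rfl
  | succ k _ ih => exact (ih (by omega)).trans (P.lt_succ k (by omega)).le

theorem TimePartition.t_nonneg {n : ℕ} (hn : n ≤ P.N) : 0 ≤ P.t n := by
  have := P.t_mono (Nat.zero_le n) hn
  rwa [P.t_zero] at this

theorem TimePartition.t_le {n : ℕ} (hn : n ≤ P.N) : P.t n ≤ T := by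
  have := P.t_mono hn le_rfl
  rwa [P.t_last] at this

theorem TimePartition.t_lt {n : ℕ} (hn : n < P.N) : P.t n < T :=
  (P.lt_succ n hn).trans_le (P.t_le hn)

theorem TimePartition.slab_subset {n : ℕ} (hn : n < P.N) : P.slab n ⊆ Ioc 0 T :=
  Ioc_subset_Ioc (P.t_nonneg hn.le) (P.t_le hn)

theorem TimePartition.measurableSet_slab (n : ℕ) : MeasurableSet (P.slab n) := measurableSet_Ioc

theorem TimePartition.ae_slab {n : ℕ} (hn : n < P.N) {p : ℝ → Prop}
    (h : ∀ᵐ t ∂(volume.restrict (Ioc 0 T)), p t) : ∀ᵐ t ∂(volume.restrict (P.slab n)), p t :=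
  ae_restrict_of_ae_restrict_of_subset (P.slab_subset hn) h

theorem TimePartition.slab_disjoint {m n : ℕ} (hm : m < P.N) (hn : n < P.N) (h : m ≠ n) :
    Disjoint (P.slab m) (P.slab n) := by
  wlog hlt : m < n generalizing m n
  · exact (this hn hm h.symm (by omega)).symm
  refine Set.disjoint_left.2 fun t h1 h2 => ?_
  exact absurd (h1.2.trans (P.t_mono (Nat.succ_le_of_lt hlt) hn.le)) (not_le.2 h2.1)

theorem TimePartition.exists_mem_slab {t : ℝ} (ht : t ∈ Ioc 0 T) : ∃ n < P.N, t ∈ P.slab n := by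
  -- The right end of the slab is the first node that is not before `t`. It is not the node `0`
  -- because `t > 0`, so it has a predecessor.
  have hex : ∃ n, t ≤ P.t n := ⟨P.N, by rw [P.t_last]; exact ht.2⟩
  classical
  have h0 : Nat.find hex ≠ 0 := by
    intro h
    have := Nat.find_spec hex
    rw [h, P.t_zero] at this
    exact absurd ht.1 (not_lt.2 this)
  obtain ⟨n, hn⟩ := Nat.exists_eq_succ_of_ne_zero h0
  have hle : Nat.find hex ≤ P.N := Nat.find_min' hex (by rw [P.t_last]; exact ht.2)
  refine ⟨n, by omega, not_le.1 (Nat.find_min hex (m := n) (by omega)), ?_⟩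
  have := Nat.find_spec hex
  rwa [hn] at this

theorem TimePartition.iUnion_slab : ⋃ n ∈ Finset.range P.N, P.slab n = Ioc 0 T := by
  ext t
  simp only [Finset.mem_range, mem_iUnion, exists_prop]
  exact ⟨fun ⟨n, hn, ht⟩ => P.slab_subset hn ht, P.exists_mem_slab⟩

theorem TimePartition.sum_integral_slab {F : Type*} [NormedAddCommGroup F] [NormedSpace ℝ F]
    {f : ℝ → F} (hf : IntegrableOn f (Ioc 0 T)) :
    ∑ n ∈ Finset.range P.N, ∫ t in P.slab n, f t = ∫ t in Ioc 0 T, f t := by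
  rw [← P.iUnion_slab, integral_biUnion_finset _ (fun n _ => P.measurableSet_slab n)]
  · intro m hm n hn h
    exact P.slab_disjoint (Finset.mem_range.1 hm) (Finset.mem_range.1 hn) h
  · intro n hn
    exact hf.mono_set (P.slab_subset (Finset.mem_range.1 hn))

theorem TimePartition.ae_of_ae_slab {p : ℝ → Prop}
    (h : ∀ n < P.N, ∀ᵐ t ∂(volume.restrict (P.slab n)), p t) :
    ∀ᵐ t ∂(volume.restrict (Ioc 0 T)), p t := by
  rw [← P.iUnion_slab, ae_restrict_biUnion_finset_iff]
  exact fun n hn => h n (Finset.mem_range.1 hn)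

end

/-! ## Functions with one-sided limits at the nodes and slabwise time derivatives -/

/-- The functions that have one-sided limits at the nodes and a weak time derivative on each
slab. -/
def slabRegular (Ω : Set (E d)) (P : TimePartition T) : Submodule ℝ (W Ω T) where
  carrier := {w | (∀ n < P.N, (∃ y, Tendsto (val w) (𝓝[>] P.t n) (𝓝 y)) ∧
      ∃ y, Tendsto (val w) (𝓝[<] P.t (n + 1)) (𝓝 y)) ∧
    ∃ g, ∀ n < P.N, HasTimeDeriv w g (P.t n) (P.t (n + 1))}
  zero_mem' := by
    have hv : val (0 : W Ω T) = fun _ => 0 := funext val_zero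
    refine ⟨fun n _ => ⟨⟨0, ?_⟩, ⟨0, ?_⟩⟩, 0, fun n _ => hasTimeDeriv_zero _ _⟩
    · rw [hv]; exact tendsto_const_nhds
    · rw [hv]; exact tendsto_const_nhds
  add_mem' := by
    rintro w w' ⟨h, g, hg⟩ ⟨h', g', hg'⟩
    have hv : val (w + w') = fun t => val w t + val w' t := funext (val_add w w')
    refine ⟨fun n hn => ?_, g + g', fun n hn => (hg n hn).add (hg' n hn)⟩
    obtain ⟨⟨y, hy⟩, x, hx⟩ := h n hn
    obtain ⟨⟨y', hy'⟩, x', hx'⟩ := h' n hn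
    rw [hv]
    exact ⟨⟨_, hy.add hy'⟩, _, hx.add hx'⟩
  smul_mem' := by
    rintro c w ⟨h, g, hg⟩
    have hv : val (c • w) = fun t => c • val w t := funext (val_smul c w)
    refine ⟨fun n hn => ?_, c • g, fun n hn => (hg n hn).smul c⟩
    obtain ⟨⟨y, hy⟩, x, hx⟩ := h n hn
    rw [hv]
    exact ⟨⟨_, hy.const_smul c⟩, _, hx.const_smul c⟩

section
variable {P : TimePartition T} {w w' : W Ω T}

theorem tendsto_limR (hw : w ∈ slabRegular Ω P) {n : ℕ} (hn : n < P.N) :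
    Tendsto (val w) (𝓝[>] P.t n) (𝓝 (limR w (P.t n))) := tendsto_nhds_limUnder (hw.1 n hn).1

theorem tendsto_limL (hw : w ∈ slabRegular Ω P) {n : ℕ} (hn : n < P.N) :
    Tendsto (val w) (𝓝[<] P.t (n + 1)) (𝓝 (limL w (P.t (n + 1)))) :=
  tendsto_nhds_limUnder (hw.1 n hn).2

theorem limR_add (hw : w ∈ slabRegular Ω P) (hw' : w' ∈ slabRegular Ω P) {n : ℕ} (hn : n < P.N) :
    limR (w + w') (P.t n) = limR w (P.t n) + limR w' (P.t n) := by
  refine Tendsto.limUnder_eq ?_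
  simpa only [← val_add] using (tendsto_limR hw hn).add (tendsto_limR hw' hn)

theorem limR_smul (c : ℝ) (hw : w ∈ slabRegular Ω P) {n : ℕ} (hn : n < P.N) :
    limR (c • w) (P.t n) = c • limR w (P.t n) := by
  refine Tendsto.limUnder_eq ?_
  simpa only [← val_smul] using (tendsto_limR hw hn).const_smul c

theorem limL_add (hw : w ∈ slabRegular Ω P) (hw' : w' ∈ slabRegular Ω P) {n : ℕ} (hn : n < P.N) :
    limL (w + w') (P.t (n + 1)) = limL w (P.t (n + 1)) + limL w' (P.t (n + 1)) := by
  refine Tendsto.limUnder_eq ?_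
  simpa only [← val_add] using (tendsto_limL hw hn).add (tendsto_limL hw' hn)

theorem limL_smul (c : ℝ) (hw : w ∈ slabRegular Ω P) {n : ℕ} (hn : n < P.N) :
    limL (c • w) (P.t (n + 1)) = c • limL w (P.t (n + 1)) := by
  refine Tendsto.limUnder_eq ?_
  simpa only [← val_smul] using (tendsto_limL hw hn).const_smul c

theorem jump_add (hw : w ∈ slabRegular Ω P) (hw' : w' ∈ slabRegular Ω P) {n : ℕ}
    (hn : n ∈ Finset.Ico 1 P.N) : jump (w + w') (P.t n) = jump w (P.t n) + jump w' (P.t n) := by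
  obtain ⟨h1, h2⟩ := Finset.mem_Ico.1 hn
  -- The right limit at node `m + 1` belongs to slab `m + 1`, the left limit to slab `m`.
  obtain ⟨m, rfl⟩ := Nat.exists_eq_add_of_le' h1
  rw [jump, jump, jump, limR_add hw hw' h2, limL_add hw hw' (Nat.lt_of_succ_lt h2)]
  abel

theorem jump_smul (c : ℝ) (hw : w ∈ slabRegular Ω P) {n : ℕ}
    (hn : n ∈ Finset.Ico 1 P.N) : jump (c • w) (P.t n) = c • jump w (P.t n) := by
  obtain ⟨h1, h2⟩ := Finset.mem_Ico.1 hn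
  obtain ⟨m, rfl⟩ := Nat.exists_eq_add_of_le' h1
  rw [jump, jump, limR_smul c hw h2, limL_smul c hw (Nat.lt_of_succ_lt h2), smul_sub]

theorem hasTimeDeriv_slabTimeDeriv (hw : w ∈ slabRegular Ω P) {n : ℕ} (hn : n < P.N) :
    HasTimeDeriv w (slabTimeDeriv P w) (P.t n) (P.t (n + 1)) := by
  unfold slabTimeDeriv; rw [dif_pos hw.2]; exact hw.2.choose_spec n hn

theorem slabTimeDeriv_ae_eq {g : Lp (V' Ω) 2 (volume.restrict (Ioc 0 T))}
    (hw : w ∈ slabRegular Ω P) {n : ℕ} (hn : n < P.N)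
    (h : HasTimeDeriv w g (P.t n) (P.t (n + 1))) :
    ∀ᵐ t ∂(volume.restrict (P.slab n)), slabTimeDeriv P w t = g t :=
  (hasTimeDeriv_slabTimeDeriv hw hn).unique (P.t_nonneg hn.le) (P.t_le hn) h

/-- `slabTimeDeriv` is a choice, so it is additive only through uniqueness, almost everywhere on
each slab. -/
theorem slabTimeDeriv_add (hw : w ∈ slabRegular Ω P) (hw' : w' ∈ slabRegular Ω P) {n : ℕ}
    (hn : n < P.N) : ∀ᵐ t ∂(volume.restrict (P.slab n)),
      slabTimeDeriv P (w + w') t = slabTimeDeriv P w t + slabTimeDeriv P w' t := by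
  filter_upwards [slabTimeDeriv_ae_eq (add_mem hw hw') hn ((hasTimeDeriv_slabTimeDeriv hw hn).add
    (hasTimeDeriv_slabTimeDeriv hw' hn)), P.ae_slab hn (Lp.coeFn_add (slabTimeDeriv P w)
      (slabTimeDeriv P w'))] with t h1 h2
  rw [h1, h2, Pi.add_apply]

theorem slabTimeDeriv_smul (c : ℝ) (hw : w ∈ slabRegular Ω P) {n : ℕ}
    (hn : n < P.N) : ∀ᵐ t ∂(volume.restrict (P.slab n)),
      slabTimeDeriv P (c • w) t = c • slabTimeDeriv P w t := by
  filter_upwards [slabTimeDeriv_ae_eq ((slabRegular Ω P).smul_mem c hw) hn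
    ((hasTimeDeriv_slabTimeDeriv hw hn).smul c),
    P.ae_slab hn (Lp.coeFn_smul c (slabTimeDeriv P w))] with t h1 h2
  rw [h1, h2, Pi.smul_apply]

end

/-! ## The energy space -/

theorem continuousOn_val {w : W Ω T} (h : Continuous (fun t : Icc (0 : ℝ) T => w.1.1 t)) :
    ContinuousOn (val w) (Icc 0 T) := by
  rw [continuousOn_iff_continuous_domRestrict]
  convert h using 1
  funext t
  exact val_of_mem w t.2

theorem tendsto_val_right {w : W Ω T} (h : ContinuousOn (val w) (Icc 0 T)) {s : ℝ}
    (h0 : 0 ≤ s) (hs : s < T) : Tendsto (val w) (𝓝[>] s) (𝓝 (val w s)) := by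
  refine (h s ⟨h0, hs.le⟩).mono_left ?_
  rw [nhdsWithin_le_iff]
  filter_upwards [Ioo_mem_nhdsGT hs] with t ht using ⟨h0.trans ht.1.le, ht.2.le⟩

theorem tendsto_val_left {w : W Ω T} (h : ContinuousOn (val w) (Icc 0 T)) {s : ℝ}
    (h0 : 0 < s) (hs : s ≤ T) : Tendsto (val w) (𝓝[<] s) (𝓝 (val w s)) := by
  refine (h s ⟨h0.le, hs⟩).mono_left ?_
  rw [nhdsWithin_le_iff]
  filter_upwards [Ioo_mem_nhdsLT h0] with t ht using ⟨ht.1.le, ht.2.le.trans hs⟩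

theorem energySpace_subset_slabRegular (P : TimePartition T) :
    energySpace Ω T ⊆ slabRegular Ω P := by
  rintro w ⟨hc, g, hg⟩
  have hc' := continuousOn_val hc
  refine ⟨fun n hn => ⟨⟨_, tendsto_val_right hc' (P.t_nonneg hn.le) (P.t_lt hn)⟩,
    ⟨_, tendsto_val_left hc' ((P.t_nonneg hn.le).trans_lt (P.lt_succ n hn)) (P.t_le hn)⟩⟩,
    g, fun n hn => hg.mono (P.t_nonneg hn.le) (P.t_le hn)⟩

theorem energySpace_add {w w' : W Ω T} (h : w ∈ energySpace Ω T) (h' : w' ∈ energySpace Ω T) :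
    w + w' ∈ energySpace Ω T := by
  obtain ⟨hc, g, hg⟩ := h
  obtain ⟨hc', g', hg'⟩ := h'
  exact ⟨hc.add hc', g + g', hg.add hg'⟩

theorem energySpace_smul (c : ℝ) {w : W Ω T} (h : w ∈ energySpace Ω T) :
    c • w ∈ energySpace Ω T := by
  obtain ⟨hc, g, hg⟩ := h
  exact ⟨hc.const_smul c, c • g, hg.smul c⟩

theorem limR_energySpace {w : W Ω T} (h : w ∈ energySpace Ω T) {s : ℝ} (h0 : 0 ≤ s)
    (hs : s < T) : limR w s = val w s :=
  (tendsto_val_right (continuousOn_val h.1) h0 hs).limUnder_eq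

theorem jump_energySpace {w : W Ω T} (h : w ∈ energySpace Ω T) {s : ℝ} (h0 : 0 < s)
    (hs : s < T) : jump w s = 0 := by
  rw [jump, limR_energySpace h h0.le hs, limL,
    (tendsto_val_left (continuousOn_val h.1) h0 hs.le).limUnder_eq, sub_self]

theorem slabTimeDeriv_energySpace (P : TimePartition T) {w : W Ω T} (h : w ∈ energySpace Ω T) :
    ∀ᵐ t ∂(volume.restrict (Ioc 0 T)), slabTimeDeriv P w t = timeDeriv w t :=
  P.ae_of_ae_slab fun _ hn => slabTimeDeriv_ae_eq (energySpace_subset_slabRegular P h) hn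
    ((hasTimeDeriv_timeDeriv h.2).mono (P.t_nonneg hn.le) (P.t_le hn))

end

/-! ## Multiplication operators and measurability -/

section

/-- A Carathéodory family of continuous linear maps maps strongly measurable functions to strongly
measurable functions. -/
theorem stronglyMeasurable_clm_apply {X F G : Type*} [MeasurableSpace X] [NormedAddCommGroup F]
    [NormedSpace ℝ F] [NormedAddCommGroup G] [NormedSpace ℝ G] {M : X → F →L[ℝ] G}
    (hM : ∀ y, StronglyMeasurable fun t => M t y) {p : X → F} (hp : StronglyMeasurable p) :
    StronglyMeasurable fun t => M t (p t) := by
  classical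
  -- For a simple function in place of `p` the composition is a finite sum of cut-offs of the
  -- measurable `t ↦ M t y`; continuity of each `M t` then passes to the limit.
  refine stronglyMeasurable_of_tendsto (f := fun n t => M t (hp.approx n t)) atTop (fun n => ?_) ?_
  · have : (fun t => M t (hp.approx n t)) = fun t => ∑ y ∈ (hp.approx n).range,
        (hp.approx n ⁻¹' {y}).indicator (fun t => M t y) t := by
      funext t
      rw [Finset.sum_eq_single (hp.approx n t)]
      · simp
      · intro y _ hy
        refine indicator_of_notMem (fun h => hy ?_) _
        exact (mem_singleton_iff.1 h).symm
      · intro h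
        exact absurd (SimpleFunc.mem_range_self _ t) h
    rw [this]
    exact Finset.stronglyMeasurable_fun_sum _ fun y _ =>
      (hM y).indicator ((hp.approx n).measurableSet_preimage _)
  · rw [tendsto_pi_nhds]
    exact fun t => ((M t).continuous.tendsto _).comp (hp.tendsto_approx t)

theorem aestronglyMeasurable_clm_apply {X F G : Type*} [MeasurableSpace X] {ν : Measure X}
    [NormedAddCommGroup F] [NormedSpace ℝ F] [NormedAddCommGroup G] [NormedSpace ℝ G]
    {M : X → F →L[ℝ] G} (hM : ∀ y, StronglyMeasurable fun t => M t y) {p : X → F}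
    (hp : AEStronglyMeasurable p ν) : AEStronglyMeasurable (fun t => M t (p t)) ν :=
  ⟨_, stronglyMeasurable_clm_apply hM hp.stronglyMeasurable_mk, by
    filter_upwards [hp.ae_eq_mk] with t ht
    rw [ht]⟩

/-- In a separable space, a function is strongly measurable if its distances to all points are
measurable. -/
theorem stronglyMeasurable_of_measurable_dist {X F : Type*} [MeasurableSpace X]
    [PseudoMetricSpace F] [SecondCountableTopology F] {f : X → F}
    (h : ∀ y, Measurable fun t => dist (f t) y) : StronglyMeasurable f := by
  let : MeasurableSpace F := borel F
  have : BorelSpace F := ⟨rfl⟩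
  refine Measurable.stronglyMeasurable (measurable_of_isOpen fun U hU => ?_)
  have hc : ∀ y : U, ∃ r > 0, Metric.ball y.1 r ⊆ U := fun y => Metric.isOpen_iff.1 hU y.1 y.2
  choose r hr hrU using hc
  -- Lindelöf property: countably many of the balls inside `U` already cover `U`.
  obtain ⟨S, hS, hSU⟩ := TopologicalSpace.isOpen_iUnion_countable
    (fun y : U => Metric.ball y.1 (r y)) (fun y => Metric.isOpen_ball)
  have hU' : U = ⋃ y ∈ S, Metric.ball y.1 (r y) := by
    rw [hSU]
    refine Subset.antisymm (fun y hy => mem_iUnion.2 ⟨⟨y, hy⟩, Metric.mem_ball_self (hr _)⟩) ?_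
    exact iUnion_subset hrU
  rw [hU', preimage_iUnion₂]
  exact MeasurableSet.biUnion hS fun y _ => measurableSet_lt (h y.1) measurable_const

variable {X F : Type*} [MeasurableSpace X] {μ : Measure X} [NormedAddCommGroup F]
  [InnerProductSpace ℝ F]

theorem memLp_inner_bdd {β : X → F} (hm : StronglyMeasurable β) {C : ℝ} (hb : ∀ x, ‖β x‖ ≤ C)
    {G : X → F} (hG : MemLp G 2 μ) : MemLp (fun x => inner ℝ (β x) (G x)) 2 μ := by
  refine hG.of_le_mul (c := C) (hm.aestronglyMeasurable.inner hG.1)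
    (Eventually.of_forall fun x => ?_)
  exact (norm_inner_le_norm _ _).trans (mul_le_mul_of_nonneg_right (hb x) (norm_nonneg _))

/-- The operator `G ↦ β · G` from `L²(μ;F)` to `L²(μ)` for a bounded measurable `β`. -/
def mulOp (μ : Measure X) (β : X → F) (hm : StronglyMeasurable β) (C : ℝ)
    (hb : ∀ x, ‖β x‖ ≤ C) : Lp F 2 μ →L[ℝ] Lp ℝ 2 μ :=
  LinearMap.mkContinuous
    { toFun := fun G => (memLp_inner_bdd hm hb (Lp.memLp G)).toLp _
      map_add' := fun G H => by
        refine Lp.ext ?_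
        refine (MemLp.coeFn_toLp _).trans ?_
        filter_upwards [Lp.coeFn_add G H, Lp.coeFn_add ((memLp_inner_bdd hm hb (Lp.memLp G)).toLp _)
          ((memLp_inner_bdd hm hb (Lp.memLp H)).toLp _),
          (memLp_inner_bdd hm hb (Lp.memLp G)).coeFn_toLp,
          (memLp_inner_bdd hm hb (Lp.memLp H)).coeFn_toLp] with x h1 h2 h3 h4
        rw [h2, h1, Pi.add_apply, Pi.add_apply, h3, h4, inner_add_right]
      map_smul' := fun c G => by
        refine Lp.ext ?_
        refine (MemLp.coeFn_toLp _).trans ?_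
        filter_upwards [Lp.coeFn_smul c G,
          Lp.coeFn_smul c ((memLp_inner_bdd hm hb (Lp.memLp G)).toLp _),
          (memLp_inner_bdd hm hb (Lp.memLp G)).coeFn_toLp] with x h1 h2 h3
        simp only [RingHom.id_apply]
        rw [h2, h1, Pi.smul_apply, Pi.smul_apply, h3, inner_smul_right, smul_eq_mul] }
    C fun G => by
      refine Lp.norm_le_mul_norm_of_ae_le_mul ?_
      filter_upwards [(memLp_inner_bdd hm hb (Lp.memLp G)).coeFn_toLp] with x hx
      simp only [LinearMap.coe_mk, AddHom.coe_mk]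
      rw [hx]
      exact (norm_inner_le_norm _ _).trans (mul_le_mul_of_nonneg_right (hb x) (norm_nonneg _))

theorem mulOp_ae {β : X → F} (hm : StronglyMeasurable β) {C : ℝ} (hb : ∀ x, ‖β x‖ ≤ C)
    (G : Lp F 2 μ) : ∀ᵐ x ∂μ, mulOp μ β hm C hb G x = inner ℝ (β x) (G x) :=
  (memLp_inner_bdd hm hb (Lp.memLp G)).coeFn_toLp

theorem norm_mulOp_apply_le {β : X → F} (hm : StronglyMeasurable β) {C : ℝ}
    (hb : ∀ x, ‖β x‖ ≤ C) (G : Lp F 2 μ) : ‖mulOp μ β hm C hb G‖ ≤ C * ‖G‖ := by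
  refine Lp.norm_le_mul_norm_of_ae_le_mul ?_
  filter_upwards [mulOp_ae hm hb G] with x hx
  rw [hx]
  exact (norm_inner_le_norm _ _).trans (mul_le_mul_of_nonneg_right (hb x) (norm_nonneg _))

/-- The coefficient is only measurable in time, so no continuity of `t ↦ β(t)·G` is available. The
distance to a fixed `w` is a power of an integral over `X` of a jointly measurable function, hence
measurable in `t` by Tonelli; separability of `L²` does the rest. -/
theorem stronglyMeasurable_mulOp [SFinite μ] [IsSeparable μ] {β : ℝ → X → F}
    (hj : StronglyMeasurable (Function.uncurry β)) (hm : ∀ t, StronglyMeasurable (β t)) {C : ℝ}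
    (hb : ∀ t x, ‖β t x‖ ≤ C) (G : Lp F 2 μ) :
    StronglyMeasurable fun t => mulOp μ (β t) (hm t) C (hb t) G := by
  have : Fact ((2 : ℝ≥0∞) ≠ ⊤) := ⟨ENNReal.ofNat_ne_top⟩
  refine stronglyMeasurable_of_measurable_dist fun w => ?_
  have key : ∀ t, dist (mulOp μ (β t) (hm t) C (hb t) G) w
      = ((∫⁻ x, ‖inner ℝ (β t x) (G x) - w x‖ₑ ^ (2 : ℝ) ∂μ) ^ (1 / (2 : ℝ))).toReal := by
    intro t
    rw [dist_eq_norm, Lp.norm_def]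
    congr 1
    rw [eLpNorm_eq_lintegral_rpow_enorm_toReal (by norm_num) (by norm_num)]
    simp only [ENNReal.toReal_ofNat]
    congr 1
    refine lintegral_congr_ae ?_
    filter_upwards [mulOp_ae (hm t) (hb t) G, Lp.coeFn_sub (mulOp μ (β t) (hm t) C (hb t) G) w]
      with x h1 h2
    rw [h2, Pi.sub_apply, h1]
  simp_rw [key]
  refine Measurable.ennreal_toReal (Measurable.pow_const ?_ _)
  refine Measurable.lintegral_prod_right' (f := fun q : ℝ × X =>
    ‖inner ℝ (β q.1 q.2) (G q.2) - w q.2‖ₑ ^ (2 : ℝ)) ?_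
  have h1 : StronglyMeasurable fun q : ℝ × X => inner ℝ (β q.1 q.2) (G q.2) :=
    hj.inner ((Lp.stronglyMeasurable G).comp_measurable measurable_snd)
  exact ((h1.sub ((Lp.stronglyMeasurable w).comp_measurable measurable_snd)).enorm).pow_const _

end

/-! ### Convection and reaction as families of bounded operators, and the spatial form -/

section
variable {d : ℕ} {Ω : Set (E d)} {T : ℝ} (D : Data Ω T)

/-- A bound of the convection field. -/
def Data.bBound : ℝ := max D.b_bdd.choose 0

theorem Data.norm_b_le {t : ℝ} (ht : t ∈ Icc (0 : ℝ) T) {x : E d} (hx : x ∈ Ω) :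
    ‖D.b t x‖ ≤ D.bBound := (D.b_bdd.choose_spec t ht x hx).trans (le_max_left _ _)

/-- A bound of the reaction coefficient. -/
def Data.αBound : ℝ := max D.α_bdd.choose 0

theorem Data.norm_α_le {t : ℝ} (ht : t ∈ Icc (0 : ℝ) T) {x : E d} (hx : x ∈ Ω) :
    ‖D.α t x‖ ≤ D.αBound := by
  rw [Real.norm_of_nonneg (D.α_nonneg t ht x hx)]
  exact (D.α_bdd.choose_spec t ht x hx).trans (le_max_left _ _)

open Classical in
/-- The convection field, set to zero where it violates its bound. -/
def Data.bTrunc (t : ℝ) (x : E d) : E d := if ‖D.b t x‖ ≤ D.bBound then D.b t x else 0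

open Classical in
/-- The reaction coefficient, set to zero where it violates its bound. -/
def Data.αTrunc (t : ℝ) (x : E d) : ℝ := if ‖D.α t x‖ ≤ D.αBound then D.α t x else 0

theorem Data.bTrunc_meas : StronglyMeasurable (Function.uncurry D.bTrunc) :=
  (Measurable.ite (measurableSet_le D.b_meas.norm measurable_const) D.b_meas
    measurable_const).stronglyMeasurable

theorem Data.αTrunc_meas : StronglyMeasurable (Function.uncurry D.αTrunc) :=
  (Measurable.ite (measurableSet_le D.α_meas.norm measurable_const) D.α_meas
    measurable_const).stronglyMeasurable

theorem Data.bTrunc_meas_slice (t : ℝ) : StronglyMeasurable (D.bTrunc t) :=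
  D.bTrunc_meas.comp_measurable (g := fun x : E d => (t, x)) measurable_prodMk_left

theorem Data.αTrunc_meas_slice (t : ℝ) : StronglyMeasurable (D.αTrunc t) :=
  D.αTrunc_meas.comp_measurable (g := fun x : E d => (t, x)) measurable_prodMk_left

theorem Data.norm_bTrunc_le (t : ℝ) (x : E d) : ‖D.bTrunc t x‖ ≤ D.bBound := by
  unfold Data.bTrunc
  split_ifs with h
  · exact h
  · rw [norm_zero]; exact le_max_right _ _

theorem Data.norm_αTrunc_le (t : ℝ) (x : E d) : ‖D.αTrunc t x‖ ≤ D.αBound := by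
  unfold Data.αTrunc
  split_ifs with h
  · exact h
  · rw [norm_zero]; exact le_max_right _ _

/-- The coefficients are bounded only on `[0,T] × Ω`. Truncation makes them bounded everywhere, as
`mulOp` demands, keeps them measurable, and changes nothing where the forms evaluate them. -/
theorem Data.bTrunc_eq {t : ℝ} (ht : t ∈ Icc (0 : ℝ) T) {x : E d} (hx : x ∈ Ω) :
    D.bTrunc t x = D.b t x := if_pos (D.norm_b_le ht hx)

theorem Data.αTrunc_eq {t : ℝ} (ht : t ∈ Icc (0 : ℝ) T) {x : E d} (hx : x ∈ Ω) :
    D.αTrunc t x = D.α t x := if_pos (D.norm_α_le ht hx)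

/-- The operator `G ↦ b(t) · G`. -/
def Data.mulB (t : ℝ) : L2vec Ω →L[ℝ] L2 Ω :=
  mulOp (F := E d) (volume.restrict Ω) (D.bTrunc t) (D.bTrunc_meas_slice t) D.bBound
    (D.norm_bTrunc_le t)

/-- The operator `v ↦ α(t) v`. -/
def Data.mulα (t : ℝ) : L2 Ω →L[ℝ] L2 Ω :=
  mulOp (F := ℝ) (volume.restrict Ω) (D.αTrunc t) (D.αTrunc_meas_slice t) D.αBound
    (D.norm_αTrunc_le t)

theorem Data.mulB_ae (hΩ : MeasurableSet Ω) {t : ℝ} (ht : t ∈ Icc (0 : ℝ) T) (G : L2vec Ω) :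
    ∀ᵐ x ∂(volume.restrict Ω), D.mulB t G x = inner ℝ (D.b t x) (G x) := by
  filter_upwards [mulOp_ae (D.bTrunc_meas_slice t)
    (D.norm_bTrunc_le t) G, ae_restrict_mem hΩ] with x h1 h2
  rw [← D.bTrunc_eq ht h2]; exact h1

theorem Data.mulα_ae (hΩ : MeasurableSet Ω) {t : ℝ} (ht : t ∈ Icc (0 : ℝ) T) (v : L2 Ω) :
    ∀ᵐ x ∂(volume.restrict Ω), D.mulα t v x = D.α t x * v x := by
  filter_upwards [mulOp_ae (D.αTrunc_meas_slice t)
    (D.norm_αTrunc_le t) v, ae_restrict_mem hΩ] with x h1 h2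
  rw [← D.αTrunc_eq ht h2, mul_comm]; exact h1

theorem Data.norm_mulB_le (t : ℝ) (G : L2vec Ω) : ‖D.mulB t G‖ ≤ D.bBound * ‖G‖ :=
  norm_mulOp_apply_le _ _ _

theorem Data.norm_mulα_le (t : ℝ) (v : L2 Ω) : ‖D.mulα t v‖ ≤ D.αBound * ‖v‖ :=
  norm_mulOp_apply_le _ _ _

theorem Data.stronglyMeasurable_mulB (G : L2vec Ω) : StronglyMeasurable fun t => D.mulB t G :=
  stronglyMeasurable_mulOp D.bTrunc_meas D.bTrunc_meas_slice D.norm_bTrunc_le G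

theorem Data.stronglyMeasurable_mulα (v : L2 Ω) : StronglyMeasurable fun t => D.mulα t v :=
  stronglyMeasurable_mulOp D.αTrunc_meas D.αTrunc_meas_slice D.norm_αTrunc_le v

theorem Data.memLp_mulB {s : Set ℝ} {G : ℝ → L2vec Ω} (hG : MemLp G 2 (volume.restrict s)) :
    MemLp (fun t => D.mulB t (G t)) 2 (volume.restrict s) :=
  hG.of_le_mul (aestronglyMeasurable_clm_apply D.stronglyMeasurable_mulB hG.1)
    (Eventually.of_forall fun t => D.norm_mulB_le t (G t))

theorem Data.memLp_mulα {s : Set ℝ} {v : ℝ → L2 Ω} (hv : MemLp v 2 (volume.restrict s)) :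
    MemLp (fun t => D.mulα t (v t)) 2 (volume.restrict s) :=
  hv.of_le_mul (aestronglyMeasurable_clm_apply D.stronglyMeasurable_mulα hv.1)
    (Eventually.of_forall fun t => D.norm_mulα_le t (v t))

/-- The spatial form in terms of inner products. -/
theorem Data.a_eq (hΩ : MeasurableSet Ω) {t : ℝ} (ht : t ∈ Icc (0 : ℝ) T) (v φ : V Ω) :
    D.a t v φ = D.ε * inner ℝ (grad v) (grad φ) + inner ℝ (D.mulB t (grad v)) (toL2 φ)
      + inner ℝ (D.mulα t (toL2 v)) (toL2 φ) := by
  unfold Data.a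
  rw [L2.inner_def, L2.inner_def, L2.inner_def]
  congr 1
  · congr 1
    refine integral_congr_ae ?_
    filter_upwards [D.mulB_ae hΩ ht (grad v)] with x hx
    simp only [hx, RCLike.inner_apply, conj_trivial]
    ring
  · refine integral_congr_ae ?_
    filter_upwards [D.mulα_ae hΩ ht (toL2 v)] with x hx
    simp only [hx, RCLike.inner_apply, conj_trivial]
    ring

/-- The spatial form as a bilinear map. -/
def Data.aForm (t : ℝ) : V Ω →ₗ[ℝ] V Ω →ₗ[ℝ] ℝ :=
  LinearMap.mk₂ ℝ (fun v φ => D.ε * inner ℝ (grad v) (grad φ)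
      + inner ℝ (D.mulB t (grad v)) (toL2 φ) + inner ℝ (D.mulα t (toL2 v)) (toL2 φ))
    (fun v v' φ => by simp only [map_add, inner_add_left]; ring)
    (fun c v φ => by simp only [map_smul, real_inner_smul_left, smul_eq_mul]; ring)
    (fun v φ φ' => by simp only [map_add, inner_add_right]; ring)
    (fun c v φ => by simp only [map_smul, real_inner_smul_right, smul_eq_mul]; ring)

theorem Data.a_eq_aForm (hΩ : MeasurableSet Ω) {t : ℝ} (ht : t ∈ Icc (0 : ℝ) T) (v φ : V Ω) :
    D.a t v φ = D.aForm t v φ := D.a_eq hΩ ht v φ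

theorem integrable_inner_of_memLp {F : Type*} [NormedAddCommGroup F] [InnerProductSpace ℝ F]
    {X : Type*} [MeasurableSpace X] {ν : Measure X} {f g : X → F} (hf : MemLp f 2 ν)
    (hg : MemLp g 2 ν) : Integrable (fun t => inner ℝ (f t) (g t)) ν :=
  memLp_one_iff_integrable.1 ((innerSL ℝ).memLp_of_bilin 1 hf hg)

theorem Data.integrable_aForm {s : Set ℝ} {v φ : ℝ → V Ω} (hv : MemLp v 2 (volume.restrict s))
    (hφ : MemLp φ 2 (volume.restrict s)) :
    Integrable (fun t => D.aForm t (v t) (φ t)) (volume.restrict s) := by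
  have h1 := (grad (Ω := Ω)).comp_memLp' hv
  have h2 := (grad (Ω := Ω)).comp_memLp' hφ
  have h3 := (toL2 (Ω := Ω)).comp_memLp' hv
  have h4 := (toL2 (Ω := Ω)).comp_memLp' hφ
  exact (((integrable_inner_of_memLp h1 h2).const_mul D.ε).add
    (integrable_inner_of_memLp (D.memLp_mulB h1) h4)).add
    (integrable_inner_of_memLp (D.memLp_mulα h3) h4)

theorem integrable_dual_apply {s : Set ℝ} {g : ℝ → V' Ω} {φ : ℝ → V Ω}
    (hg : MemLp g 2 (volume.restrict s)) (hφ : MemLp φ 2 (volume.restrict s)) :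
    Integrable (fun t => g t (φ t)) (volume.restrict s) :=
  memLp_one_iff_integrable.1
    ((ContinuousLinearMap.id ℝ (V' Ω)).memLp_of_bilin 1 hg hφ)

end

/-! ## Linearity of the forms -/

section
variable {d : ℕ} {Ω : Set (E d)} {T : ℝ} (D : Data Ω T) (P : TimePartition T)

theorem Data.a_ae_eq_aForm (hΩ : MeasurableSet Ω) (v φ : ℝ → V Ω) :
    ∀ᵐ t ∂(volume.restrict (Ioc 0 T)), D.a t (v t) (φ t) = D.aForm t (v t) (φ t) := by
  filter_upwards [ae_restrict_mem measurableSet_Ioc] with t ht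
  exact D.a_eq_aForm hΩ ⟨ht.1.le, ht.2⟩ _ _

/-- The integral of a nonintegrable function is zero by convention, so every later splitting of
integrals rests on this bound by products of square integrable functions. -/
theorem Data.integrableOn_form (hΩ : MeasurableSet Ω) (g : Lp (V' Ω) 2 (volume.restrict (Ioc 0 T)))
    (u φ : W Ω T) :
    IntegrableOn (fun t => g t (valV φ t) + D.a t (valV u t) (valV φ t)) (Ioc 0 T) := by
  refine Integrable.add (integrable_dual_apply (Lp.memLp g) (memLp_valV φ)) ?_
  exact (D.integrable_aForm (memLp_valV u) (memLp_valV φ)).congr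
    ((D.a_ae_eq_aForm hΩ _ _).mono fun _ h => h.symm)

theorem Data.integrableOn_slab_form (hΩ : MeasurableSet Ω)
    (g : Lp (V' Ω) 2 (volume.restrict (Ioc 0 T))) (u φ : W Ω T) {n : ℕ} (hn : n < P.N) :
    IntegrableOn (fun t => g t (valV φ t) + D.a t (valV u t) (valV φ t)) (P.slab n) :=
  (D.integrableOn_form hΩ g u φ).mono_set (P.slab_subset hn)

variable {P} {u u' φ φ' : W Ω T}

/-- Limits and derivatives that do not exist are replaced by default values, so additivity is
available only where they exist, which is what `slabRegular` guarantees. The fixed argument `φ` may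
be arbitrary, since it enters only through `valV φ` and `limR φ`. -/
theorem Data.Aτ_add_left (hΩ : MeasurableSet Ω) (hu : u ∈ slabRegular Ω P)
    (hu' : u' ∈ slabRegular Ω P) (φ : W Ω T) :
    D.Aτ P (u + u') φ = D.Aτ P u φ + D.Aτ P u' φ := by
  unfold Data.Aτ
  have h1 : ∑ n ∈ Finset.range P.N, ∫ t in P.slab n, (slabTimeDeriv P (u + u') t (valV φ t)
        + D.a t (valV (u + u') t) (valV φ t))
      = ∑ n ∈ Finset.range P.N, ((∫ t in P.slab n, (slabTimeDeriv P u t (valV φ t)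
        + D.a t (valV u t) (valV φ t))) + ∫ t in P.slab n, (slabTimeDeriv P u' t (valV φ t)
        + D.a t (valV u' t) (valV φ t))) := by
    refine Finset.sum_congr rfl fun n hn => ?_
    have hn := Finset.mem_range.1 hn
    rw [← integral_add (D.integrableOn_slab_form P hΩ _ u φ hn)
      (D.integrableOn_slab_form P hΩ _ u' φ hn)]
    refine integral_congr_ae ?_
    filter_upwards [slabTimeDeriv_add hu hu' hn, P.ae_slab hn (valV_add_ae u u'),
      P.ae_slab hn (D.a_ae_eq_aForm hΩ (valV u) (valV φ)),
      P.ae_slab hn (D.a_ae_eq_aForm hΩ (valV u') (valV φ)),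
      P.ae_slab hn (D.a_ae_eq_aForm hΩ (valV (u + u')) (valV φ))] with t e1 e2 e3 e4 e5
    rw [e3, e4, e5, e1, e2, map_add, LinearMap.add_apply, add_apply]
    ring
  have h2 : ∑ n ∈ Finset.Ico 1 P.N, inner ℝ (jump (u + u') (P.t n)) (limR φ (P.t n))
      = ∑ n ∈ Finset.Ico 1 P.N, (inner ℝ (jump u (P.t n)) (limR φ (P.t n))
        + inner ℝ (jump u' (P.t n)) (limR φ (P.t n))) := by
    refine Finset.sum_congr rfl fun n hn => ?_
    rw [jump_add hu hu' hn, inner_add_left]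
  have h3 : limR (u + u') 0 = limR u 0 + limR u' 0 := by
    have := limR_add hu hu' (n := 0) P.one_le_N
    rwa [P.t_zero] at this
  rw [h1, h2, h3, inner_add_left, Finset.sum_add_distrib, Finset.sum_add_distrib]
  ring

theorem Data.Aτ_smul_left (hΩ : MeasurableSet Ω) (c : ℝ) (hu : u ∈ slabRegular Ω P)
    (φ : W Ω T) : D.Aτ P (c • u) φ = c * D.Aτ P u φ := by
  unfold Data.Aτ
  have h1 : ∑ n ∈ Finset.range P.N, ∫ t in P.slab n, (slabTimeDeriv P (c • u) t (valV φ t)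
        + D.a t (valV (c • u) t) (valV φ t))
      = ∑ n ∈ Finset.range P.N, c * ∫ t in P.slab n, (slabTimeDeriv P u t (valV φ t)
        + D.a t (valV u t) (valV φ t)) := by
    refine Finset.sum_congr rfl fun n hn => ?_
    have hn := Finset.mem_range.1 hn
    rw [← integral_const_mul]
    refine integral_congr_ae ?_
    filter_upwards [slabTimeDeriv_smul c hu hn, P.ae_slab hn (valV_smul_ae c u),
      P.ae_slab hn (D.a_ae_eq_aForm hΩ (valV u) (valV φ)),
      P.ae_slab hn (D.a_ae_eq_aForm hΩ (valV (c • u)) (valV φ))] with t e1 e2 e3 e5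
    rw [e3, e5, e1, e2, map_smul, LinearMap.smul_apply, smul_apply,
      smul_eq_mul, smul_eq_mul]
    ring
  have h2 : ∑ n ∈ Finset.Ico 1 P.N, inner ℝ (jump (c • u) (P.t n)) (limR φ (P.t n))
      = ∑ n ∈ Finset.Ico 1 P.N, c * inner ℝ (jump u (P.t n)) (limR φ (P.t n)) := by
    refine Finset.sum_congr rfl fun n hn => ?_
    rw [jump_smul c hu hn, real_inner_smul_left]
  have h3 : limR (c • u) 0 = c • limR u 0 := by
    have := limR_smul c hu (n := 0) P.one_le_N
    rwa [P.t_zero] at this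
  rw [h1, h2, h3, real_inner_smul_left, ← Finset.mul_sum, ← Finset.mul_sum]
  ring

theorem Data.Aτ_add_right (hΩ : MeasurableSet Ω) (u : W Ω T) (hφ : φ ∈ slabRegular Ω P)
    (hφ' : φ' ∈ slabRegular Ω P) :
    D.Aτ P u (φ + φ') = D.Aτ P u φ + D.Aτ P u φ' := by
  unfold Data.Aτ
  have h1 : ∑ n ∈ Finset.range P.N, ∫ t in P.slab n, (slabTimeDeriv P u t (valV (φ + φ') t)
        + D.a t (valV u t) (valV (φ + φ') t))
      = ∑ n ∈ Finset.range P.N, ((∫ t in P.slab n, (slabTimeDeriv P u t (valV φ t)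
        + D.a t (valV u t) (valV φ t))) + ∫ t in P.slab n, (slabTimeDeriv P u t (valV φ' t)
        + D.a t (valV u t) (valV φ' t))) := by
    refine Finset.sum_congr rfl fun n hn => ?_
    have hn := Finset.mem_range.1 hn
    rw [← integral_add (D.integrableOn_slab_form P hΩ _ u φ hn)
      (D.integrableOn_slab_form P hΩ _ u φ' hn)]
    refine integral_congr_ae ?_
    filter_upwards [P.ae_slab hn (valV_add_ae φ φ'),
      P.ae_slab hn (D.a_ae_eq_aForm hΩ (valV u) (valV φ)),
      P.ae_slab hn (D.a_ae_eq_aForm hΩ (valV u) (valV φ')),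
      P.ae_slab hn (D.a_ae_eq_aForm hΩ (valV u) (valV (φ + φ')))] with t e2 e3 e4 e5
    rw [e3, e4, e5, e2, map_add, map_add]
    ring
  have h2 : ∑ n ∈ Finset.Ico 1 P.N, inner ℝ (jump u (P.t n)) (limR (φ + φ') (P.t n))
      = ∑ n ∈ Finset.Ico 1 P.N, (inner ℝ (jump u (P.t n)) (limR φ (P.t n))
        + inner ℝ (jump u (P.t n)) (limR φ' (P.t n))) := by
    refine Finset.sum_congr rfl fun n hn => ?_
    rw [limR_add hφ hφ' (Finset.mem_Ico.1 hn).2, inner_add_right]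
  have h3 : limR (φ + φ') 0 = limR φ 0 + limR φ' 0 := by
    have := limR_add hφ hφ' (n := 0) P.one_le_N
    rwa [P.t_zero] at this
  rw [h1, h2, h3, inner_add_right, Finset.sum_add_distrib, Finset.sum_add_distrib]
  ring

theorem Data.Aτ_smul_right (hΩ : MeasurableSet Ω) (c : ℝ) (u : W Ω T)
    (hφ : φ ∈ slabRegular Ω P) : D.Aτ P u (c • φ) = c * D.Aτ P u φ := by
  unfold Data.Aτ
  have h1 : ∑ n ∈ Finset.range P.N, ∫ t in P.slab n, (slabTimeDeriv P u t (valV (c • φ) t)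
        + D.a t (valV u t) (valV (c • φ) t))
      = ∑ n ∈ Finset.range P.N, c * ∫ t in P.slab n, (slabTimeDeriv P u t (valV φ t)
        + D.a t (valV u t) (valV φ t)) := by
    refine Finset.sum_congr rfl fun n hn => ?_
    have hn := Finset.mem_range.1 hn
    rw [← integral_const_mul]
    refine integral_congr_ae ?_
    filter_upwards [P.ae_slab hn (valV_smul_ae c φ),
      P.ae_slab hn (D.a_ae_eq_aForm hΩ (valV u) (valV φ)),
      P.ae_slab hn (D.a_ae_eq_aForm hΩ (valV u) (valV (c • φ)))] with t e2 e3 e5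
    rw [e3, e5, e2, map_smul, map_smul, smul_eq_mul, smul_eq_mul]
    ring
  have h2 : ∑ n ∈ Finset.Ico 1 P.N, inner ℝ (jump u (P.t n)) (limR (c • φ) (P.t n))
      = ∑ n ∈ Finset.Ico 1 P.N, c * inner ℝ (jump u (P.t n)) (limR φ (P.t n)) := by
    refine Finset.sum_congr rfl fun n hn => ?_
    rw [limR_smul c hφ (Finset.mem_Ico.1 hn).2, real_inner_smul_right]
  have h3 : limR (c • φ) 0 = c • limR φ 0 := by
    have := limR_smul c hφ (n := 0) P.one_le_N
    rwa [P.t_zero] at this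
  rw [h1, h2, h3, real_inner_smul_right, ← Finset.mul_sum, ← Finset.mul_sum]
  ring

theorem Data.Fτ_add (hφ : φ ∈ slabRegular Ω P) (hφ' : φ' ∈ slabRegular Ω P) :
    D.Fτ (φ + φ') = D.Fτ φ + D.Fτ φ' := by
  unfold Data.Fτ
  have h3 : limR (φ + φ') 0 = limR φ 0 + limR φ' 0 := by
    have := limR_add hφ hφ' (n := 0) P.one_le_N
    rwa [P.t_zero] at this
  have h1 : ∫ t in Ioc 0 T, D.f t (valV (φ + φ') t)
      = (∫ t in Ioc 0 T, D.f t (valV φ t)) + ∫ t in Ioc 0 T, D.f t (valV φ' t) := by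
    rw [← integral_add (integrable_dual_apply (Lp.memLp D.f) (memLp_valV φ))
      (integrable_dual_apply (Lp.memLp D.f) (memLp_valV φ'))]
    refine integral_congr_ae ?_
    filter_upwards [valV_add_ae φ φ'] with t e2
    rw [e2, map_add]
  rw [h1, h3, inner_add_right]
  ring

theorem Data.Fτ_smul (c : ℝ) (hφ : φ ∈ slabRegular Ω P) :
    D.Fτ (c • φ) = c * D.Fτ φ := by
  unfold Data.Fτ
  have h3 : limR (c • φ) 0 = c • limR φ 0 := by
    have := limR_smul c hφ (n := 0) P.one_le_N
    rwa [P.t_zero] at this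
  have h1 : ∫ t in Ioc 0 T, D.f t (valV (c • φ) t) = c * ∫ t in Ioc 0 T, D.f t (valV φ t) := by
    rw [← integral_const_mul]
    refine integral_congr_ae ?_
    filter_upwards [valV_smul_ae c φ] with t e2
    rw [e2, map_smul, smul_eq_mul]
  rw [h1, h3, real_inner_smul_right]
  ring

/-! ## Agreement of the continuous and the semidiscrete forms on the energy space -/

theorem Data.Fτ_eq_F (hT : 0 < T) (hφ : φ ∈ energySpace Ω T) : D.Fτ φ = D.F φ := by
  rw [Data.Fτ, Data.F, limR_energySpace hφ le_rfl hT]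

/-- For a continuous function, the jump terms of the semidiscrete form vanish. -/
theorem Data.Aτ_energySpace_left (hΩ : MeasurableSet Ω) (hT : 0 < T)
    (hu : u ∈ energySpace Ω T) (φ : W Ω T) :
    D.Aτ P u φ = (∫ t in Ioc 0 T, (timeDeriv u t (valV φ t) + D.a t (valV u t) (valV φ t)))
      + inner ℝ (val u 0) (limR φ 0) := by
  have h1 : ∑ n ∈ Finset.range P.N, ∫ t in P.slab n, (slabTimeDeriv P u t (valV φ t)
        + D.a t (valV u t) (valV φ t))
      = ∫ t in Ioc 0 T, (timeDeriv u t (valV φ t) + D.a t (valV u t) (valV φ t)) := by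
    rw [P.sum_integral_slab (D.integrableOn_form hΩ _ u φ)]
    refine integral_congr_ae ?_
    filter_upwards [slabTimeDeriv_energySpace P hu] with t ht
    rw [ht]
  have h2 : ∑ n ∈ Finset.Ico 1 P.N, inner ℝ (jump u (P.t n)) (limR φ (P.t n)) = 0 := by
    refine Finset.sum_eq_zero fun n hn => ?_
    obtain ⟨hn1, hn2⟩ := Finset.mem_Ico.1 hn
    have h0 : 0 < P.t n := by
      have := (P.lt_succ 0 (by omega)).trans_le (P.t_mono hn1 hn2.le)
      rwa [P.t_zero] at this
    rw [jump_energySpace hu h0 (P.t_lt hn2), inner_zero_left]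
  rw [Data.Aτ, h1, h2, add_zero, limR_energySpace hu le_rfl hT]

theorem Data.Aτ_eq_A (hΩ : MeasurableSet Ω) (hT : 0 < T)
    (hu : u ∈ energySpace Ω T) (hφ : φ ∈ energySpace Ω T) : D.Aτ P u φ = D.A u φ := by
  rw [D.Aτ_energySpace_left hΩ hT hu, Data.A, limR_energySpace hφ le_rfl hT]

end

/-! ## Products of a scalar function of time and an element of `V` -/

/-- Measurable functions of time that are bounded on `[0,T]`. -/
def BddMeasurable (T : ℝ) (θ : ℝ → ℝ) : Prop :=
  Measurable θ ∧ ∃ C, ∀ t ∈ Icc (0 : ℝ) T, |θ t| ≤ C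

section
variable {T : ℝ} {θ η : ℝ → ℝ}

theorem BddMeasurable.of_continuous (h : Continuous θ) : BddMeasurable T θ := by
  refine ⟨h.measurable, ?_⟩
  obtain ⟨C, hC⟩ := (isCompact_Icc (a := (0 : ℝ)) (b := T)).exists_bound_of_continuousOn
    h.continuousOn
  exact ⟨C, hC⟩

theorem BddMeasurable.mul (h : BddMeasurable T θ) (h' : BddMeasurable T η) :
    BddMeasurable T (fun t => θ t * η t) := by
  obtain ⟨hm, C, hC⟩ := h
  obtain ⟨hm', C', hC'⟩ := h'
  refine ⟨hm.mul hm', C * C', fun t ht => ?_⟩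
  rw [abs_mul]
  exact mul_le_mul (hC t ht) (hC' t ht) (abs_nonneg _) ((abs_nonneg _).trans (hC t ht))

theorem BddMeasurable.sub (h : BddMeasurable T θ) (h' : BddMeasurable T η) :
    BddMeasurable T (fun t => θ t - η t) := by
  obtain ⟨hm, C, hC⟩ := h
  obtain ⟨hm', C', hC'⟩ := h'
  exact ⟨hm.sub hm', C + C', fun t ht =>
    (abs_sub _ _).trans (add_le_add (hC t ht) (hC' t ht))⟩

theorem BddMeasurable.of_bound (hm : Measurable θ) {C : ℝ} (h : ∀ t, |θ t| ≤ C) :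
    BddMeasurable T θ := ⟨hm, C, fun t _ => h t⟩

theorem BddMeasurable.memLp {F : Type*} [NormedAddCommGroup F] [NormedSpace ℝ F]
    (h : BddMeasurable T θ) (c : F) :
    MemLp (fun t => θ t • c) 2 (volume.restrict (Ioc 0 T)) := by
  obtain ⟨hm, C, hC⟩ := h
  refine MemLp.of_bound (hm.stronglyMeasurable.smul_const c).aestronglyMeasurable (C * ‖c‖) ?_
  filter_upwards [ae_restrict_mem measurableSet_Ioc] with t ht
  rw [norm_smul]
  exact mul_le_mul_of_nonneg_right (hC t ⟨ht.1.le, ht.2⟩) (norm_nonneg _)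

end

section
variable {d : ℕ} {Ω : Set (E d)} {T : ℝ} {θ η : ℝ → ℝ}

/-- The function `t ↦ θ(t) c`. -/
def timesVec (θ : ℝ → ℝ) (hθ : BddMeasurable T θ) (c : V Ω) : W Ω T :=
  ⟨(⟨fun t => θ t • toL2 c, by
      obtain ⟨_, C, hC⟩ := hθ
      refine memℓp_infty ⟨C * ‖toL2 c‖, ?_⟩
      rintro _ ⟨t, rfl⟩
      change ‖θ t • toL2 c‖ ≤ _
      rw [norm_smul]
      exact mul_le_mul_of_nonneg_right (hC t t.2) (norm_nonneg _)⟩, (hθ.memLp c).toLp _), by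
    refine ⟨?_, ?_⟩
    · filter_upwards [(hθ.memLp c).coeFn_toLp] with t ht h
      exact (show θ t • toL2 c = toL2 ((hθ.memLp c).toLp _ t) by rw [ht, map_smul])
    · obtain ⟨_, C, hC⟩ := hθ
      -- The range lies in the compact segment `[-C, C] · c`.
      refine TotallyBounded.subset ?_ ((isCompact_Icc (a := -C) (b := C)).image
        (continuous_id.smul (continuous_const (y := toL2 c)))).totallyBounded
      rintro _ ⟨t, rfl⟩
      exact ⟨θ t, abs_le.1 (hC t t.2), rfl⟩⟩

theorem val_timesVec (hθ : BddMeasurable T θ) (c : V Ω) {t : ℝ} (ht : t ∈ Icc (0 : ℝ) T) :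
    val (timesVec θ hθ c) t = θ t • toL2 c := val_of_mem _ ht

theorem valV_timesVec (hθ : BddMeasurable T θ) (c : V Ω) :
    ∀ᵐ t ∂(volume.restrict (Ioc 0 T)), valV (timesVec θ hθ c) t = θ t • c :=
  (hθ.memLp c).coeFn_toLp

/-- The norm of `θ c` in `W` is controlled by the supremum of `θ`, with a constant that depends only
on `c` and `T`. Uniformly small perturbations of `θ`, such as rounding, are therefore small in `W`.
-/
theorem exists_norm_timesVec_le (T : ℝ) (c : V Ω) : ∃ K, 0 ≤ K ∧ ∀ (θ : ℝ → ℝ)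
    (hθ : BddMeasurable T θ) (C : ℝ), 0 ≤ C → (∀ t ∈ Icc (0 : ℝ) T, |θ t| ≤ C) →
      ‖timesVec θ hθ c‖ ≤ C * K := by
  -- The `L²` norm of the constant `1` on `(0,T]`.
  set m : ℝ := (measureUnivNNReal (volume.restrict (Ioc (0 : ℝ) T)) : ℝ) ^ (2 : ℝ≥0∞).toReal⁻¹
  have hm : 0 ≤ m := by positivity
  refine ⟨max ‖toL2 c‖ (m * ‖c‖), le_max_of_le_left (norm_nonneg _), fun θ hθ C hC hb => ?_⟩
  refine max_le ?_ ?_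
  · refine (lp.norm_le_of_forall_le (by positivity) fun t => ?_).trans
      (mul_le_mul_of_nonneg_left (le_max_left _ _) hC)
    change ‖θ t • toL2 c‖ ≤ _
    rw [norm_smul]
    exact mul_le_mul_of_nonneg_right (hb t t.2) (norm_nonneg _)
  · refine (Lp.norm_le_of_ae_bound (C := C * ‖c‖) (by positivity) ?_).trans (le_of_eq_of_le ?_
      (mul_le_mul_of_nonneg_left (le_max_right ‖toL2 c‖ (m * ‖c‖)) hC))
    · filter_upwards [valV_timesVec hθ c, ae_restrict_mem measurableSet_Ioc] with t h1 h2
      change ‖valV (timesVec θ hθ c) t‖ ≤ _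
      rw [h1, norm_smul]
      exact mul_le_mul_of_nonneg_right (hb t ⟨h2.1.le, h2.2⟩) (norm_nonneg _)
    · change m * (C * ‖c‖) = _
      ring

theorem timesVec_sub (hθ : BddMeasurable T θ) (hη : BddMeasurable T η) (c : V Ω) :
    timesVec θ hθ c - timesVec η hη c = timesVec (fun t => θ t - η t) (hθ.sub hη) c := by
  refine ext_W (fun t ht => ?_) ?_
  · rw [val_sub, val_timesVec _ _ ht, val_timesVec _ _ ht, val_timesVec _ _ ht, sub_smul]
  · filter_upwards [valV_timesVec hθ c, valV_timesVec hη c, valV_timesVec (hθ.sub hη) c,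
      Lp.coeFn_sub (valV (timesVec θ hθ c)) (valV (timesVec η hη c))] with t h1 h2 h3 h4
    rw [valV_sub, h4, h3, Pi.sub_apply, h1, h2, sub_smul]

/-- Once the fixed vector is pulled out of the integrals, this is scalar integration by parts,
without boundary terms because `ψ` vanishes at `0` and `T`. -/
theorem hasTimeDeriv_timesVec (hT : 0 ≤ T) (hs : ContDiff ℝ 1 θ) (hθ : BddMeasurable T θ)
    (hd : BddMeasurable T (deriv θ)) (c : V Ω) :
    HasTimeDeriv (timesVec θ hθ c) ((hd.memLp (toDual (toL2 c))).toLp _) 0 T := by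
  intro ψ h1 h2 h3
  have e1 : ∫ t in Ioc 0 T, deriv ψ t • toDual (val (timesVec θ hθ c) t)
      = (∫ t in Ioc 0 T, deriv ψ t * θ t) • toDual (toL2 c) := by
    rw [← integral_smul_const]
    refine integral_congr_ae ?_
    filter_upwards [ae_restrict_mem measurableSet_Ioc] with t ht
    rw [val_timesVec _ _ ⟨ht.1.le, ht.2⟩, ← toDualL_apply, map_smul, mul_smul, toDualL_apply]
  have e2 : ∫ t in Ioc 0 T, ψ t • (hd.memLp (toDual (toL2 c))).toLp _ t
      = (∫ t in Ioc 0 T, ψ t * deriv θ t) • toDual (toL2 c) := by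
    rw [← integral_smul_const]
    refine integral_congr_ae ?_
    filter_upwards [(hd.memLp (toDual (toL2 c))).coeFn_toLp] with t ht
    rw [ht, mul_smul]
  have e3 : ∫ t in Ioc 0 T, deriv ψ t * θ t = - ∫ t in Ioc 0 T, ψ t * deriv θ t := by
    have hψ : ∀ s, s ∉ Ioo 0 T → ψ s = 0 := fun s hs => by
      by_contra hne
      exact hs (h3 (subset_tsupport _ hne))
    have := intervalIntegral.integral_mul_deriv_eq_deriv_mul (a := 0) (b := T) (u := ψ) (v := θ)
      (u' := deriv ψ) (v' := deriv θ)
      (fun x _ => (h1.differentiable (by simp) x).hasDerivAt)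
      (fun x _ => (hs.differentiable (by simp) x).hasDerivAt)
      ((h1.continuous_deriv (by simp)).intervalIntegrable _ _)
      ((hs.continuous_deriv (by simp)).intervalIntegrable _ _)
    rw [hψ 0 (by simp), hψ T (by simp), zero_mul, zero_mul, sub_zero, zero_sub,
      intervalIntegral.integral_of_le hT, intervalIntegral.integral_of_le hT] at this
    rw [this, neg_neg]
  rw [e1, e3, neg_smul, ← e2]

theorem timesVec_mem_energySpace (hT : 0 ≤ T) (hs : ContDiff ℝ 1 θ) (hθ : BddMeasurable T θ)
    (c : V Ω) : timesVec θ hθ c ∈ energySpace Ω T :=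
  ⟨(hs.continuous.comp continuous_subtype_val).smul continuous_const, _,
    hasTimeDeriv_timesVec hT hs hθ (.of_continuous (hs.continuous_deriv (by simp))) c⟩

theorem timeDeriv_timesVec (hT : 0 ≤ T) (hs : ContDiff ℝ 1 θ) (hθ : BddMeasurable T θ)
    (c : V Ω) : ∀ᵐ t ∂(volume.restrict (Ioc 0 T)),
      timeDeriv (timesVec θ hθ c) t = deriv θ t • toDual (toL2 c) := by
  have hd : BddMeasurable T (deriv θ) := .of_continuous (hs.continuous_deriv (by simp))
  filter_upwards [timeDeriv_ae_eq (hasTimeDeriv_timesVec hT hs hθ hd c),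
    (hd.memLp (toDual (toL2 c))).coeFn_toLp] with t h1 h2
  rw [h1]
  exact h2

theorem zero_mem_energySpace : (0 : W Ω T) ∈ energySpace Ω T :=
  ⟨continuous_const, 0, hasTimeDeriv_zero 0 T⟩

theorem energySpace_sum {ι : Type*} (s : Finset ι) {w : ι → W Ω T}
    (h : ∀ i ∈ s, w i ∈ energySpace Ω T) :
    ∑ i ∈ s, w i ∈ energySpace Ω T := by
  classical
  induction s using Finset.induction_on with
  | empty => simpa using zero_mem_energySpace
  | insert i s hi ih =>
    rw [Finset.sum_insert hi]
    exact energySpace_add (h i (by simp)) (ih fun j hj => h j (by simp [hj]))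

/-! ## Polynomials in time -/

theorem BddMeasurable.pow (T : ℝ) (k : ℕ) : BddMeasurable T (fun t => t ^ k) :=
  .of_continuous (continuous_pow k)

/-- The polynomial `t ↦ ∑ t^k c_k` on the whole time interval. -/
def timePoly (T : ℝ) {r : ℕ} (c : Fin (r + 1) → V Ω) : W Ω T :=
  ∑ k : Fin (r + 1), timesVec (fun t => t ^ (k : ℕ)) (.pow T k) (c k)

variable {r : ℕ} (c : Fin (r + 1) → V Ω)

theorem val_timePoly {t : ℝ} (ht : t ∈ Icc (0 : ℝ) T) :
    val (timePoly T c) t = toL2 (∑ k : Fin (r + 1), t ^ (k : ℕ) • c k) := by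
  rw [timePoly, val_sum, map_sum]
  exact Finset.sum_congr rfl fun k _ => by rw [val_timesVec _ _ ht, map_smul]

/-- The purpose of extending the polynomial of one slab to all of `[0,T]`: one-sided limits and weak
derivatives of a semidiscrete function on that slab can be read off from a function of the energy
space. -/
theorem timePoly_mem_energySpace (hT : 0 ≤ T) : timePoly T c ∈ energySpace Ω T :=
  energySpace_sum _ (fun _ _ => timesVec_mem_energySpace hT (contDiff_id.pow _) _ _)

theorem HasTimeDeriv.sum {ι : Type*} (s : Finset ι) {w : ι → W Ω T}
    {g : ι → Lp (V' Ω) 2 (volume.restrict (Ioc 0 T))}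
    (h : ∀ i ∈ s, HasTimeDeriv (w i) (g i) 0 T) :
    HasTimeDeriv (∑ i ∈ s, w i) (∑ i ∈ s, g i) 0 T := by
  classical
  induction s using Finset.induction_on with
  | empty => exact hasTimeDeriv_zero 0 T
  | insert i s hi ih =>
    rw [Finset.sum_insert hi, Finset.sum_insert hi]
    exact (h i (by simp)).add (ih fun j hj => h j (by simp [hj]))

theorem timeDeriv_sum {ι : Type*} (s : Finset ι) {w : ι → W Ω T}
    (h : ∀ i ∈ s, w i ∈ energySpace Ω T) : ∀ᵐ t ∂(volume.restrict (Ioc 0 T)),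
      timeDeriv (∑ i ∈ s, w i) t = ∑ i ∈ s, timeDeriv (w i) t := by
  have h1 := timeDeriv_ae_eq (HasTimeDeriv.sum s fun i hi => hasTimeDeriv_timeDeriv (h i hi).2)
  have h2 : ∀ s : Finset ι, ∀ᵐ t ∂(volume.restrict (Ioc 0 T)),
      (∑ i ∈ s, timeDeriv (w i) : Lp (V' Ω) 2 (volume.restrict (Ioc 0 T))) t
        = ∑ i ∈ s, timeDeriv (w i) t := by
    classical
    intro s
    induction s using Finset.induction_on with
    | empty =>
      filter_upwards [Lp.coeFn_zero (V' Ω) 2 (volume.restrict (Ioc 0 T))] with t ht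
      simp only [Finset.sum_empty]
      exact ht
    | insert i s hi ih =>
      filter_upwards [ih, Lp.coeFn_add (timeDeriv (w i)) (∑ i ∈ s, timeDeriv (w i))] with t e1 e2
      rw [Finset.sum_insert hi, Finset.sum_insert hi, ← e1]
      exact e2
  filter_upwards [h1, h2 s] with t e1 e2
  rw [e1, e2]

theorem timeDeriv_timePoly (hT : 0 ≤ T) : ∀ᵐ t ∂(volume.restrict (Ioc 0 T)),
    timeDeriv (timePoly T c) t
      = ∑ k : Fin (r + 1), deriv (fun t : ℝ => t ^ (k : ℕ)) t • toDual (toL2 (c k)) := by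
  have h : ∀ᵐ t ∂(volume.restrict (Ioc 0 T)), ∀ k : Fin (r + 1),
      timeDeriv (timesVec (fun t => t ^ (k : ℕ)) (.pow T k) (c k)) t
        = deriv (fun t : ℝ => t ^ (k : ℕ)) t • toDual (toL2 (c k)) :=
    ae_all_iff.2 fun k => timeDeriv_timesVec hT (contDiff_id.pow _) _ _
  filter_upwards [h, timeDeriv_sum Finset.univ fun (k : Fin (r + 1)) _ =>
    timesVec_mem_energySpace hT (contDiff_id.pow _) (.pow T k) (c k)] with t h1 h2
  rw [timePoly]
  refine Eq.trans h2 ?_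
  exact Finset.sum_congr rfl fun k _ => h1 k

/-! ## The semidiscrete space -/

variable {P : TimePartition T} {Z : Set (V Ω)} {w w' : W Ω T} {n : ℕ}

theorem IsPolyOnSlab.add (hZ : ∀ x ∈ Z, ∀ y ∈ Z, x + y ∈ Z) (h : IsPolyOnSlab P r Z w n)
    (h' : IsPolyOnSlab P r Z w' n) (hn : n < P.N) : IsPolyOnSlab P r Z (w + w') n := by
  obtain ⟨c, h1, h2, h3⟩ := h
  obtain ⟨c', h1', h2', h3'⟩ := h'
  refine ⟨fun k => c k + c' k, fun k => hZ _ (h1 k) _ (h1' k), fun t ht => ?_, ?_⟩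
  · rw [val_add, h2 t ht, h2' t ht, ← map_add, ← Finset.sum_add_distrib]
    simp only [smul_add]
  · filter_upwards [h3, h3', P.ae_slab hn (valV_add_ae w w')] with t e1 e2 e3
    rw [e3, e1, e2, ← Finset.sum_add_distrib]
    simp only [smul_add]

theorem IsPolyOnSlab.smul (hZ : ∀ a : ℝ, ∀ x ∈ Z, a • x ∈ Z) (a : ℝ)
    (h : IsPolyOnSlab P r Z w n) (hn : n < P.N) : IsPolyOnSlab P r Z (a • w) n := by
  obtain ⟨c, h1, h2, h3⟩ := h
  refine ⟨fun k => a • c k, fun k => hZ a _ (h1 k), fun t ht => ?_, ?_⟩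
  · rw [val_smul, h2 t ht, ← map_smul, Finset.smul_sum]
    simp only [smul_comm a]
  · filter_upwards [h3, P.ae_slab hn (valV_smul_ae a w)] with t e1 e3
    rw [e3, e1, Finset.smul_sum]
    simp only [smul_comm a]

theorem dGSpace_smul (a : ℝ) (h : w ∈ dGSpace Ω P r) : a • w ∈ dGSpace Ω P r :=
  fun n hn => (h n hn).smul (fun _ _ _ => mem_univ _) a hn

theorem zero_mem_dGSpace : (0 : W Ω T) ∈ dGSpace Ω P r := by
  refine fun n hn => ⟨fun _ => 0, fun _ => mem_univ _, fun t _ => by simp [val_zero], ?_⟩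
  filter_upwards [P.ae_slab hn (Lp.coeFn_zero (V Ω) 2 (volume.restrict (Ioc 0 T)))] with t ht
  simp only [smul_zero, Finset.sum_const_zero]
  exact ht

theorem val_eq_timePoly (h : ∀ t ∈ P.slab n, val w t = toL2 (∑ k : Fin (r + 1), t ^ (k : ℕ) • c k))
    (hn : n < P.N) {t : ℝ} (ht : t ∈ P.slab n) : val w t = val (timePoly T c) t := by
  have := P.slab_subset hn ht
  rw [h t ht, val_timePoly c ⟨this.1.le, this.2⟩]

theorem tendsto_right_of_poly (hT : 0 < T)
    (h : ∀ t ∈ P.slab n, val w t = toL2 (∑ k : Fin (r + 1), t ^ (k : ℕ) • c k))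
    (hn : n < P.N) : Tendsto (val w) (𝓝[>] P.t n) (𝓝 (val (timePoly T c) (P.t n))) := by
  refine (tendsto_val_right (continuousOn_val (timePoly_mem_energySpace c hT.le).1)
    (P.t_nonneg hn.le) (P.t_lt hn)).congr' ?_
  filter_upwards [Ioc_mem_nhdsGT (P.lt_succ n hn)] with t ht
  exact (val_eq_timePoly c h hn ht).symm

theorem tendsto_left_of_poly (hT : 0 < T)
    (h : ∀ t ∈ P.slab n, val w t = toL2 (∑ k : Fin (r + 1), t ^ (k : ℕ) • c k))
    (hn : n < P.N) :
    Tendsto (val w) (𝓝[<] P.t (n + 1)) (𝓝 (val (timePoly T c) (P.t (n + 1)))) := by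
  refine (tendsto_val_left (continuousOn_val (timePoly_mem_energySpace c hT.le).1)
    ((P.t_nonneg hn.le).trans_lt (P.lt_succ n hn)) (P.t_le hn)).congr' ?_
  filter_upwards [Ioo_mem_nhdsLT (P.lt_succ n hn)] with t ht
  exact (val_eq_timePoly c h hn ⟨ht.1, ht.2.le⟩).symm

/-- Weak derivatives are local: a test function supported in the open slab sees `w` only where it
coincides with the extended polynomial. -/
theorem hasTimeDeriv_of_poly (hT : 0 < T)
    (h : ∀ t ∈ P.slab n, val w t = toL2 (∑ k : Fin (r + 1), t ^ (k : ℕ) • c k))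
    (hn : n < P.N) {g : Lp (V' Ω) 2 (volume.restrict (Ioc 0 T))}
    (hg : ∀ᵐ t ∂(volume.restrict (P.slab n)), g t = timeDeriv (timePoly T c) t) :
    HasTimeDeriv w g (P.t n) (P.t (n + 1)) := by
  refine ((hasTimeDeriv_timeDeriv (timePoly_mem_energySpace c hT.le).2).mono (P.t_nonneg hn.le)
    (P.t_le hn)).congr (fun t ht => val_eq_timePoly c h hn ⟨ht.1, ht.2.le⟩) ?_
  rw [ae_restrict_iff' (P.measurableSet_slab n)] at hg
  filter_upwards [ae_restrict_of_ae hg] with t ht ht'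
  exact ht ⟨ht'.1, ht'.2.le⟩

/-- Elements of `L²` can be glued together slab by slab. -/
theorem exists_glue {F : Type*} [NormedAddCommGroup F]
    (P : TimePartition T) (G : ℕ → Lp F 2 (volume.restrict (Ioc 0 T))) :
    ∃ g : Lp F 2 (volume.restrict (Ioc 0 T)),
      ∀ n < P.N, ∀ᵐ t ∂(volume.restrict (P.slab n)), g t = G n t := by
  have hm : MemLp (fun t => ∑ m ∈ Finset.range P.N, (P.slab m).indicator (G m) t) 2
      (volume.restrict (Ioc 0 T)) :=
    memLp_finsetSum _ fun m _ => (Lp.memLp (G m)).indicator (P.measurableSet_slab m)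
  refine ⟨hm.toLp _, fun n hn => ?_⟩
  filter_upwards [P.ae_slab hn hm.coeFn_toLp, ae_restrict_mem (P.measurableSet_slab n)]
    with t h1 h2
  rw [h1, Finset.sum_eq_single n]
  · exact indicator_of_mem h2 _
  · intro m hm hmn
    exact indicator_of_notMem
      (fun h => Set.disjoint_left.1 (P.slab_disjoint (Finset.mem_range.1 hm) hn hmn) h h2) _
  · exact fun h => absurd (Finset.mem_range.2 hn) h

/-- `slabRegular` asks for a single element of `L²(I;V')` serving all slabs; it is glued from the
derivatives of the extended slab polynomials. -/
theorem dGSpace_subset_slabRegular (hT : 0 < T) : dGSpace Ω P r ⊆ slabRegular Ω P := by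
  classical
  intro w hw
  -- Dummy coefficients zero beyond the last slab, so that the choice gives a family over all
  -- indices.
  have hex : ∀ n, ∃ c : Fin (r + 1) → V Ω, n < P.N →
      ∀ t ∈ P.slab n, val w t = toL2 (∑ k : Fin (r + 1), t ^ (k : ℕ) • c k) := fun n => by
    by_cases hn : n < P.N
    · obtain ⟨c, _, h, _⟩ := hw n hn
      exact ⟨c, fun _ => h⟩
    · exact ⟨0, fun h => absurd h hn⟩
  choose c hc using hex
  obtain ⟨g, hg⟩ := exists_glue P fun n => timeDeriv (timePoly T (c n))
  exact ⟨fun n hn => ⟨⟨_, tendsto_right_of_poly (c n) hT (hc n hn) hn⟩,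
    ⟨_, tendsto_left_of_poly (c n) hT (hc n hn) hn⟩⟩, g,
    fun n hn => hasTimeDeriv_of_poly (c n) hT (hc n hn) hn (hg n hn)⟩

end

/-! ## Smoothed steps in time -/

section

/-- The smoothed unit step at `a`, with transition on `[a, a + 1/j]`. -/
def smoothStep (a : ℝ) (j : ℕ) (t : ℝ) : ℝ := Real.smoothTransition (j * (t - a))

/-- The unit step `1_{t > a}`. -/
def unitStep (a : ℝ) : ℝ → ℝ := (Ioi a).indicator fun _ => 1

theorem unitStep_of_lt {a t : ℝ} (h : a < t) : unitStep a t = 1 := indicator_of_mem h _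

theorem unitStep_of_le {a t : ℝ} (h : t ≤ a) : unitStep a t = 0 :=
  indicator_of_notMem (not_lt.2 h) _

theorem bddMeasurable_unitStep (T a : ℝ) : BddMeasurable T (unitStep a) := by
  refine .of_bound (measurable_const.indicator measurableSet_Ioi) (C := 1) fun t => ?_
  rcases lt_or_ge a t with h | h
  · simp [unitStep_of_lt h]
  · simp [unitStep_of_le h]

theorem contDiff_smoothStep (a : ℝ) (j : ℕ) : ContDiff ℝ 1 (smoothStep a j) :=
  Real.smoothTransition.contDiff.comp (contDiff_const.mul (contDiff_id.sub contDiff_const))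

theorem smoothStep_of_le {a t : ℝ} (h : t ≤ a) (j : ℕ) : smoothStep a j t = 0 :=
  Real.smoothTransition.zero_of_nonpos (mul_nonpos_of_nonneg_of_nonpos j.cast_nonneg (by linarith))

theorem smoothStep_of_ge {a t : ℝ} {j : ℕ} (h : 1 ≤ j * (t - a)) : smoothStep a j t = 1 :=
  Real.smoothTransition.one_of_one_le h

theorem abs_smoothStep_le (a : ℝ) (j : ℕ) (t : ℝ) : |smoothStep a j t| ≤ 1 := by
  rw [smoothStep, abs_of_nonneg (Real.smoothTransition.nonneg _)]
  exact Real.smoothTransition.le_one _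

theorem eventually_smoothStep_eq {a t : ℝ} (h : a < t) :
    ∀ᶠ j : ℕ in atTop, smoothStep a j t = 1 := by
  filter_upwards [(tendsto_natCast_atTop_atTop (R := ℝ)).eventually_ge_atTop (1 / (t - a))]
    with j hj
  refine smoothStep_of_ge ?_
  rwa [div_le_iff₀ (by linarith)] at hj

theorem tendsto_smoothStep (a t : ℝ) :
    Tendsto (fun j => smoothStep a j t) atTop (𝓝 (unitStep a t)) := by
  rcases lt_or_ge a t with h | h
  · rw [unitStep_of_lt h]
    exact tendsto_const_nhds.congr' ((eventually_smoothStep_eq h).mono fun j hj => hj.symm)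
  · rw [unitStep_of_le h]
    simp only [smoothStep_of_le h]
    exact tendsto_const_nhds

theorem deriv_smoothStep_nonneg (a : ℝ) (j : ℕ) (t : ℝ) : 0 ≤ deriv (smoothStep a j) t :=
  Monotone.deriv_nonneg fun s t hst => Real.smoothTransition.monotone
    (mul_le_mul_of_nonneg_left (by linarith) j.cast_nonneg)

theorem deriv_smoothStep_of_lt {a t : ℝ} (h : t < a) (j : ℕ) : deriv (smoothStep a j) t = 0 := by
  have : smoothStep a j =ᶠ[𝓝 t] fun _ => 0 := by
    filter_upwards [gt_mem_nhds h] with s hs using smoothStep_of_le (le_of_lt hs) j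
  rw [this.deriv_eq, deriv_const]

theorem deriv_smoothStep_of_gt {a t : ℝ} {j : ℕ} (h : 1 < j * (t - a)) :
    deriv (smoothStep a j) t = 0 := by
  have hc : Continuous fun s : ℝ => (j : ℝ) * (s - a) := by fun_prop
  have : smoothStep a j =ᶠ[𝓝 t] fun _ => 1 := by
    filter_upwards [hc.continuousAt.eventually (lt_mem_nhds h)] with s hs
    exact smoothStep_of_ge (le_of_lt hs)
  rw [this.deriv_eq, deriv_const]

/-- The derivatives of the smoothed steps tend to the Dirac measure. -/
theorem tendsto_integral_deriv_smoothStep {T a : ℝ} (ha : 0 ≤ a) (haT : a < T) {h : ℝ → ℝ}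
    (hh : ContinuousOn h (Icc 0 T)) :
    Tendsto (fun j => ∫ t in Ioc 0 T, deriv (smoothStep a j) t * h t) atTop (𝓝 (h a)) := by
  have hcd : ∀ j, Continuous (deriv (smoothStep a j)) := fun j =>
    (contDiff_smoothStep a j).continuous_deriv le_rfl
  have hint : ∀ j, IntegrableOn (deriv (smoothStep a j)) (Ioc 0 T) := fun j =>
    (hcd j).integrableOn_Ioc
  -- The mass is the increment of the step over `[0,T]`: it starts from zero because `0 ≤ a`, and
  -- reaches one as soon as the transition ends before `T`. Since the transition lies to the right
  -- of `a`, the full mass is kept even for `a = 0`.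
  have hone : ∀ᶠ j in atTop, ∫ t in Ioc 0 T, deriv (smoothStep a j) t = 1 := by
    filter_upwards [eventually_smoothStep_eq haT] with j hj
    rw [← intervalIntegral.integral_of_le (ha.trans haT.le), intervalIntegral.integral_deriv_eq_sub
      (fun x _ => (contDiff_smoothStep a j).differentiable (by simp) x)
      ((hcd j).intervalIntegrable _ _), hj, smoothStep_of_le ha, sub_zero]
  rw [Metric.tendsto_atTop']
  intro ε hε
  obtain ⟨δ, hδ, hδ'⟩ := Metric.continuousOn_iff.1 hh a ⟨ha, haT.le⟩ (ε / 2) (by linarith)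
  obtain ⟨N, hN⟩ := eventually_atTop.1 (hone.and
    ((tendsto_natCast_atTop_atTop (R := ℝ)).eventually_gt_atTop (1 / δ)))
  refine ⟨N, fun j hj => ?_⟩
  obtain ⟨h1, h2⟩ := hN j hj.le
  have hih : IntegrableOn (fun t => deriv (smoothStep a j) t * h t) (Ioc 0 T) :=
    (((hcd j).continuousOn.mul hh).integrableOn_Icc).mono_set Ioc_subset_Icc_self
  have e : (∫ t in Ioc 0 T, deriv (smoothStep a j) t * h t) - h a
      = ∫ t in Ioc 0 T, deriv (smoothStep a j) t * (h t - h a) := by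
    simp only [mul_sub]
    rw [integral_sub hih ((hint j).mul_const _), integral_mul_const, h1, one_mul]
  rw [dist_eq_norm, e]
  refine (norm_integral_le_of_norm_le ((hint j).const_mul (ε / 2)) ?_).trans_lt ?_
  · filter_upwards [ae_restrict_mem measurableSet_Ioc] with t ht
    rw [norm_mul, Real.norm_of_nonneg (deriv_smoothStep_nonneg a j t), mul_comm]
    -- Close to `a`, continuity of `h` bounds the difference; farther away the derivative vanishes,
    -- because the transition has length `1/j < δ`.
    by_cases hta : |t - a| < δ
    · exact mul_le_mul_of_nonneg_right (hδ' t ⟨ht.1.le, ht.2⟩ hta).le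
        (deriv_smoothStep_nonneg a j t)
    · have : deriv (smoothStep a j) t = 0 := by
        rcases lt_or_ge t a with h3 | h3
        · exact deriv_smoothStep_of_lt h3 j
        · refine deriv_smoothStep_of_gt ?_
          rw [abs_of_nonneg (by linarith), not_lt] at hta
          rw [div_lt_iff₀ hδ] at h2
          exact h2.trans_le (mul_le_mul_of_nonneg_left hta j.cast_nonneg)
      rw [this, mul_zero, mul_zero]
  · rw [integral_const_mul, h1]
    linarith

/-- Passage to the limit from smoothed steps to steps in a first-order form. -/
theorem tendsto_integral_smoothStep_mul {T a : ℝ} (ha : 0 ≤ a) (haT : a < T) {ξ ζ κ : ℝ → ℝ}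
    (hξ : ContDiff ℝ 1 ξ) (hζ : ContinuousOn ζ (Icc 0 T)) (hκ : IntegrableOn κ (Ioc 0 T)) :
    Tendsto (fun j => ∫ t in Ioc 0 T, (deriv (fun t => smoothStep a j t * ξ t) t * ζ t
        + smoothStep a j t * ξ t * κ t)) atTop
      (𝓝 ((∫ t in Ioc a T, (deriv ξ t * ζ t + ξ t * κ t)) + ξ a * ζ a)) := by
  have hξc : Continuous (deriv ξ) := hξ.continuous_deriv le_rfl
  have hG : IntegrableOn (fun t => deriv ξ t * ζ t + ξ t * κ t) (Ioc 0 T) := by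
    refine Integrable.add ?_ ?_
    · exact ((hξc.continuousOn.mul hζ).integrableOn_Icc).mono_set Ioc_subset_Icc_self
    · obtain ⟨C, hC⟩ := (isCompact_Icc (a := (0 : ℝ)) (b := T)).exists_bound_of_continuousOn
        hξ.continuous.continuousOn
      refine Integrable.bdd_mul hκ (c := C) hξ.continuous.aestronglyMeasurable ?_
      filter_upwards [ae_restrict_mem measurableSet_Ioc] with t ht
      exact hC t ⟨ht.1.le, ht.2⟩
  -- The product rule isolates the derivative of the step, which produces the point value at `a`;
  -- the rest converges by domination.
  have hsplit : ∀ j, ∫ t in Ioc 0 T, (deriv (fun t => smoothStep a j t * ξ t) t * ζ t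
        + smoothStep a j t * ξ t * κ t)
      = (∫ t in Ioc 0 T, smoothStep a j t * (deriv ξ t * ζ t + ξ t * κ t))
        + ∫ t in Ioc 0 T, deriv (smoothStep a j) t * (ξ t * ζ t) := by
    intro j
    rw [← integral_add]
    · refine integral_congr_ae (Eventually.of_forall fun t => ?_)
      have : deriv (fun t => smoothStep a j t * ξ t) t
          = deriv (smoothStep a j) t * ξ t + smoothStep a j t * deriv ξ t :=
        (((contDiff_smoothStep a j).differentiable (by simp) t).hasDerivAt.mul
          (hξ.differentiable (by simp) t).hasDerivAt).deriv
      simp only [this]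
      ring
    · exact Integrable.bdd_mul hG (c := 1) (contDiff_smoothStep a j).continuous.aestronglyMeasurable
        (Eventually.of_forall fun t => abs_smoothStep_le a j t)
    · exact (((((contDiff_smoothStep a j).continuous_deriv le_rfl).continuousOn).mul
        (hξ.continuous.continuousOn.mul hζ)).integrableOn_Icc).mono_set Ioc_subset_Icc_self
  simp only [hsplit]
  refine Tendsto.add ?_ (tendsto_integral_deriv_smoothStep ha haT
    (hξ.continuous.continuousOn.mul hζ))
  have e : ∫ t in Ioc a T, (deriv ξ t * ζ t + ξ t * κ t)
      = ∫ t in Ioc 0 T, unitStep a t * (deriv ξ t * ζ t + ξ t * κ t) := by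
    have h1 : (fun t => unitStep a t * (deriv ξ t * ζ t + ξ t * κ t))
        = (Ioi a).indicator fun t => deriv ξ t * ζ t + ξ t * κ t := by
      funext t
      rcases lt_or_ge a t with h | h
      · rw [unitStep_of_lt h, one_mul, indicator_of_mem (mem_Ioi.2 h)]
      · rw [unitStep_of_le h, zero_mul, indicator_of_notMem (by simpa using h)]
    rw [h1, setIntegral_indicator measurableSet_Ioi]
    congr 2
    ext t
    simp only [mem_Ioc, mem_inter_iff, mem_Ioi]
    exact ⟨fun h => ⟨⟨ha.trans_lt h.1, h.2⟩, h.1⟩, fun h => ⟨h.2, h.1.2⟩⟩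
  rw [e]
  refine tendsto_integral_of_dominated_convergence
    (fun t => ‖deriv ξ t * ζ t + ξ t * κ t‖)
    (fun j => (contDiff_smoothStep a j).continuous.aestronglyMeasurable.mul hG.1) hG.norm
    (fun j => Eventually.of_forall fun t => ?_) (Eventually.of_forall fun t => ?_)
  · rw [norm_mul]
    exact mul_le_of_le_one_left (norm_nonneg _) (abs_smoothStep_le a j t)
  · exact (tendsto_smoothStep a t).mul_const _

end

/-! ## Countable additivity of the derivative of the goal functional -/

/-- Rounding to the grid of width `η`. -/
def gridRound (η x : ℝ) : ℝ := η * (round (x / η) : ℤ)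

theorem abs_sub_gridRound_le {η : ℝ} (hη : 0 < η) (x : ℝ) : |x - gridRound η x| ≤ η := by
  have h1 : x - gridRound η x = η * (x / η - (round (x / η) : ℤ)) := by
    rw [gridRound]; field_simp
  rw [h1, abs_mul, abs_of_pos hη]
  have := abs_sub_round (x / η)
  nlinarith

/-- Rounding turns convergence to zero at a time into being exactly zero for all large indices, the
form of convergence used in `tendsto_goal_sub`. -/
theorem gridRound_eq_zero {η x : ℝ} (hη : 0 < η) (hx : |x| < η / 2) : gridRound η x = 0 := by
  have : round (x / η) = 0 := by
    rw [round_eq_zero_iff]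
    obtain ⟨h1, h2⟩ := abs_lt.1 hx
    constructor
    · rw [le_div_iff₀ hη]; linarith
    · rw [div_lt_iff₀ hη]; linarith
  rw [gridRound, this, Int.cast_zero, mul_zero]

theorem measurable_gridRound (η : ℝ) : Measurable (gridRound η) := by
  have : gridRound η = fun x => η * ((⌊x / η + 1 / 2⌋ : ℤ) : ℝ) := by
    funext x
    rw [gridRound, round_eq]
  rw [this]
  exact measurable_const.mul ((measurable_from_top (f := fun n : ℤ => (n : ℝ))).comp
    (Int.measurable_floor.comp ((measurable_id.div_const η).add_const _)))

section
variable {d : ℕ} {Ω : Set (E d)} {T : ℝ} {Jt : ℝ → V Ω → ℝ} {JT : L2 Ω → ℝ}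

/-- If boundedly many multiples `q_j(t) c` of `c` with values in a fixed finite set tend to zero
pointwise, then the increments of the goal functional tend to zero. -/
theorem tendsto_goal_sub
    (hJt : ∀ w : W Ω T, IntegrableOn (fun t => Jt t (valV w t)) (Ioc 0 T))
    (u : W Ω T) (c : V Ω) {q : ℕ → ℝ → ℝ} (hq : ∀ j, BddMeasurable T (q j)) (S : Finset ℝ)
    (hS : ∀ j, ∀ t ∈ Icc (0 : ℝ) T, q j t ∈ S)
    (hlim : ∀ t ∈ Ioc 0 T, ∀ᶠ j in atTop, q j t = 0) (hT : 0 < T) :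
    Tendsto (fun j => goal Jt JT (u + timesVec (q j) (hq j) c) - goal Jt JT u) atTop (𝓝 0) := by
  have hTm : T ∈ Icc (0 : ℝ) T := ⟨hT.le, le_rfl⟩
  have e : ∀ᶠ j in atTop, ∫ t in Ioc 0 T, (Jt t (valV (u + timesVec (q j) (hq j) c) t)
        - Jt t (valV u t)) = goal Jt JT (u + timesVec (q j) (hq j) c) - goal Jt JT u := by
    -- At the final time `q_j` is eventually zero, so the `J_T` terms cancel and no continuity of
    -- `J_T` is needed.
    filter_upwards [hlim T ⟨hT, le_rfl⟩] with j hj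
    have : val (u + timesVec (q j) (hq j) c) T = val u T := by
      rw [val_add, val_timesVec _ _ hTm, hj, zero_smul, add_zero]
    rw [goal, goal, this, integral_sub (hJt _) (hJt _)]
    ring
  refine Tendsto.congr' e ?_
  set k : ℝ → W Ω T := fun s =>
    timesVec (fun _ => s) (.of_continuous continuous_const) c with hk
  have h1 : ∀ᵐ t ∂(volume.restrict (Ioc 0 T)), ∀ j,
      valV (u + timesVec (q j) (hq j) c) t = valV u t + q j t • c := by
    refine ae_all_iff.2 fun j => ?_
    filter_upwards [valV_add_ae u (timesVec (q j) (hq j) c), valV_timesVec (hq j) c] with t h h'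
    rw [h, h']
  have h2 : ∀ᵐ t ∂(volume.restrict (Ioc 0 T)), ∀ s : S,
      valV (u + k s) t = valV u t + s.1 • c := by
    refine ae_all_iff.2 fun s => ?_
    filter_upwards [valV_add_ae u (k s), valV_timesVec (.of_continuous continuous_const) c]
      with t h h'
    rw [h, hk, h']
  have key : Tendsto (fun j => ∫ t in Ioc 0 T, (Jt t (valV (u + timesVec (q j) (hq j) c) t)
      - Jt t (valV u t))) atTop (𝓝 (∫ _ in Ioc 0 T, (0 : ℝ))) := by
    -- Neither continuity nor a growth bound is known for `J_t`. Domination comes from the finitely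
    -- many values: at each time the increment is one of the increments for the constant shifts `s
    -- c` with `s ∈ S`, and each of these is integrable.
    refine tendsto_integral_of_dominated_convergence
      (fun t => ∑ s : S, |Jt t (valV (u + k s) t) - Jt t (valV u t)|)
      (fun j => ((hJt (u + timesVec (q j) (hq j) c)).sub (hJt u)).1)
      (integrable_finsetSum _ fun s _ => ((hJt _).sub (hJt _)).abs)
      (fun j => ?_) ?_
    · filter_upwards [h1, h2, ae_restrict_mem measurableSet_Ioc] with t e1 e2 ht
      have hm := hS j t ⟨ht.1.le, ht.2⟩
      refine le_trans (le_of_eq ?_) (Finset.single_le_sum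
        (f := fun s : S => |Jt t (valV (u + k s) t) - Jt t (valV u t)|)
        (fun s _ => abs_nonneg _) (Finset.mem_univ ⟨q j t, hm⟩))
      simp only
      rw [e1 j, e2 ⟨q j t, hm⟩, Real.norm_eq_abs]
    · filter_upwards [h1, ae_restrict_mem measurableSet_Ioc] with t e1 ht
      refine tendsto_const_nhds.congr' ?_
      filter_upwards [hlim t ht] with j hj
      rw [e1, hj, zero_smul, add_zero, sub_self]
  simpa using key

/-- The derivative of the goal functional is continuous along bounded pointwise convergent
sequences `ζ_j(t) c`. -/
theorem tendsto_fderiv_goal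
    (hJt : ∀ w : W Ω T, IntegrableOn (fun t => Jt t (valV w t)) (Ioc 0 T))
    {u : W Ω T} (hd : DifferentiableAt ℝ (goal Jt JT) u) (c : V Ω) {ζ : ℕ → ℝ → ℝ}
    (hζ : ∀ j, BddMeasurable T (ζ j)) {C : ℝ} (hC : ∀ j, ∀ t ∈ Icc (0 : ℝ) T, |ζ j t| ≤ C)
    (hlim : ∀ t ∈ Ioc 0 T, Tendsto (fun j => ζ j t) atTop (𝓝 0)) (hT : 0 < T) :
    Tendsto (fun j => fderiv ℝ (goal Jt JT) u (timesVec (ζ j) (hζ j) c)) atTop (𝓝 0) := by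
  -- The functions `ζ_j c` need not tend to zero in `W`, so continuity of `L` alone does not
  -- suffice. After rounding they take finitely many values, so the true increments of the goal
  -- functional along `h q_j c` tend to zero; differentiability with a fixed small `h` translates
  -- this into a bound for `L (q_j c)`.
  set L := fderiv ℝ (goal Jt JT) u with hL
  obtain ⟨K, hK0, hK⟩ := exists_norm_timesVec_le T c
  have hC0 : 0 ≤ C := (abs_nonneg _).trans (hC 0 0 ⟨le_rfl, hT.le⟩)
  rw [Metric.tendsto_atTop']
  intro ε hε
  -- the width of the grid
  set η : ℝ := ε / (3 * (‖L‖ * K + 1)) with hη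
  have hLK : 0 ≤ ‖L‖ * K := by positivity
  have hη0 : 0 < η := by positivity
  -- The share of the rounding error: one third of `ε`.
  have hη1 : ‖L‖ * (η * K) ≤ ε / 3 := by
    have : ‖L‖ * (η * K) = ε / 3 * ((‖L‖ * K) / (‖L‖ * K + 1)) := by
      rw [hη]; field_simp
    rw [this]
    exact mul_le_of_le_one_right (by positivity) ((div_le_one (by positivity)).2 (by linarith))
  set q : ℕ → ℝ → ℝ := fun j t => gridRound η (ζ j t) with hqdef
  set B : ℝ := C + η with hB
  have hB0 : 0 < B := by positivity
  have hqB : ∀ j, ∀ t ∈ Icc (0 : ℝ) T, |q j t| ≤ B := fun j t ht => by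
    have h1 := abs_sub_gridRound_le hη0 (ζ j t)
    have h2 := hC j t ht
    have h3 : q j t = ζ j t - (ζ j t - gridRound η (ζ j t)) := by simp [hqdef]
    rw [h3]
    exact (abs_sub _ _).trans (add_le_add h2 h1)
  have hq : ∀ j, BddMeasurable T (q j) := fun j =>
    ⟨(measurable_gridRound η).comp (hζ j).1, B, hqB j⟩
  -- the radius of linearization
  have hBK : 0 ≤ B * K := by positivity
  set ε' : ℝ := ε / (3 * (B * K + 1)) with hε'
  have hε'0 : 0 < ε' := by positivity
  have hlin := (hasFDerivAt_iff_isLittleO_nhds_zero.1 hd.hasFDerivAt).def hε'0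
  obtain ⟨ρ, hρ, hρ'⟩ := Metric.eventually_nhds_iff.1 hlin
  -- Independent of `j`: this factor brings every `h q_j c` into the ball of radius `ρ`, where the
  -- linearization error is at most `ε'` times the norm.
  set h : ℝ := ρ / (2 * (B * K + 1)) with hh
  have hh0 : 0 < h := by positivity
  have hhq : ∀ j, BddMeasurable T fun t => h * q j t := fun j =>
    (BddMeasurable.of_continuous continuous_const).mul (hq j)
  have hsm : ∀ j, timesVec (fun t => h * q j t) (hhq j) c = h • timesVec (q j) (hq j) c := by
    intro j
    refine ext_W (fun t ht => ?_) ?_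
    · rw [val_smul, val_timesVec _ _ ht, val_timesVec _ _ ht, mul_smul]
    · filter_upwards [valV_timesVec (hhq j) c, valV_timesVec (hq j) c,
        valV_smul_ae h (timesVec (q j) (hq j) c)] with t e1 e2 e3
      rw [e1, e3, e2, mul_smul]
  have hnorm : ∀ j, ‖timesVec (fun t => h * q j t) (hhq j) c‖ ≤ h * (B * K) := by
    intro j
    rw [hsm, norm_smul, Real.norm_of_nonneg hh0.le]
    exact mul_le_mul_of_nonneg_left (hK _ (hq j) B hB0.le (hqB j)) hh0.le
  have hsmall : h * (B * K) < ρ := by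
    have : h * (B * K) = ρ / 2 * ((B * K) / (B * K + 1)) := by rw [hh]; field_simp
    rw [this]
    have : (B * K) / (B * K + 1) ≤ 1 := (div_le_one (by positivity)).2 (by linarith)
    nlinarith
  -- the values of the rounded functions
  have hfin : ∃ S : Finset ℝ, ∀ j, ∀ t ∈ Icc (0 : ℝ) T, h * q j t ∈ S := by
    refine ⟨(Finset.Icc (-⌈B / η⌉) ⌈B / η⌉).image fun n : ℤ => h * (η * n), fun j t ht => ?_⟩
    refine Finset.mem_image.2 ⟨round (ζ j t / η), ?_, rfl⟩
    have h1 : |((round (ζ j t / η) : ℤ) : ℝ)| ≤ B / η := by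
      rw [le_div_iff₀ hη0]
      have := hqB j t ht
      simp only [hqdef] at this
      rw [gridRound, abs_mul, abs_of_pos hη0] at this
      linarith
    have h2 : ((|round (ζ j t / η)| : ℤ) : ℝ) ≤ (⌈B / η⌉ : ℤ) := by
      rw [Int.cast_abs]
      exact h1.trans (Int.le_ceil _)
    rw [Finset.mem_Icc]
    exact abs_le.1 (Int.cast_le.1 h2)
  obtain ⟨S, hS⟩ := hfin
  have hq0 : ∀ t ∈ Ioc 0 T, ∀ᶠ j in atTop, h * q j t = 0 := fun t ht => by
    filter_upwards [(hlim t ht).eventually (Metric.ball_mem_nhds 0 (half_pos hη0))] with j hj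
    rw [dist_zero_right] at hj
    simp only [hqdef]
    rw [gridRound_eq_zero hη0 hj, mul_zero]
  -- Since `h` is fixed, the increments may be compared with `h ε / 3`; dividing by `h` afterwards
  -- costs nothing.
  have hinc := tendsto_goal_sub (JT := JT) hJt u c hhq S hS hq0 hT
  obtain ⟨N, hN⟩ := eventually_atTop.1 (hinc.eventually (Metric.ball_mem_nhds 0
    (show 0 < h * (ε / 3) by positivity)))
  refine ⟨N, fun j hj => ?_⟩
  have h1 := hN j hj.le
  rw [dist_zero_right, Real.norm_eq_abs] at h1
  have h2 := hρ' (y := timesVec (fun t => h * q j t) (hhq j) c)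
    (by rw [dist_zero_right]; exact (hnorm j).trans_lt hsmall)
  have h3 : ε' * ‖timesVec (fun t => h * q j t) (hhq j) c‖ ≤ h * (ε / 3) := by
    refine (mul_le_mul_of_nonneg_left (hnorm j) hε'0.le).trans ?_
    have : ε' * (h * (B * K)) = h * (ε / 3) * ((B * K) / (B * K + 1)) := by
      rw [hε']; field_simp
    rw [this]
    exact mul_le_of_le_one_right (by positivity) ((div_le_one (by positivity)).2 (by linarith))
  rw [← hL, hsm, map_smul, smul_eq_mul, Real.norm_eq_abs] at h2
  rw [hsm] at h1 h3
  -- One third comes from the increment of the goal functional, one from the linearization error.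
  have h4 : h * |L (timesVec (q j) (hq j) c)| < h * (2 * (ε / 3)) := by
    rw [← abs_of_pos hh0, ← abs_mul, abs_of_pos hh0]
    have h5 := abs_lt.1 h1
    have h6 := abs_le.1 (h2.trans h3)
    rw [abs_lt]
    constructor <;> linarith [h5.1, h5.2, h6.1, h6.2]
  have h5 : |L (timesVec (q j) (hq j) c)| < 2 * (ε / 3) := lt_of_mul_lt_mul_left h4 hh0.le
  have h6 : |L (timesVec (ζ j) (hζ j) c) - L (timesVec (q j) (hq j) c)| ≤ ε / 3 := by
    rw [← map_sub, timesVec_sub]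
    refine (L.le_opNorm _).trans ((mul_le_mul_of_nonneg_left (hK _ _ η hη0.le fun t _ =>
      abs_sub_gridRound_le hη0 (ζ j t)) (norm_nonneg _)).trans hη1)
  rw [dist_zero_right, Real.norm_eq_abs]
  have h7 := abs_lt.1 h5
  have h8 := abs_le.1 h6
  rw [abs_lt]
  constructor <;> linarith [h7.1, h7.2, h8.1, h8.2]

end

/-! ## Galerkin orthogonality on the semidiscrete space: the primal equation -/

section
variable {d : ℕ} {Ω : Set (E d)} {T : ℝ} (D : Data Ω T) {P : TimePartition T} {r : ℕ}

theorem exists_slab_coeffs {w : W Ω T} (hw : w ∈ dGSpace Ω P r) :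
    ∃ c : ℕ → Fin (r + 1) → V Ω, ∀ n < P.N,
      (∀ t ∈ P.slab n, val w t = toL2 (∑ k : Fin (r + 1), t ^ (k : ℕ) • c n k)) ∧
      (∀ᵐ t ∂(volume.restrict (P.slab n)),
        valV w t = ∑ k : Fin (r + 1), t ^ (k : ℕ) • c n k) := by
  have hex : ∀ n, ∃ c : Fin (r + 1) → V Ω, n < P.N →
      (∀ t ∈ P.slab n, val w t = toL2 (∑ k : Fin (r + 1), t ^ (k : ℕ) • c k)) ∧
      (∀ᵐ t ∂(volume.restrict (P.slab n)),
        valV w t = ∑ k : Fin (r + 1), t ^ (k : ℕ) • c k) := fun n => by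
    by_cases hn : n < P.N
    · obtain ⟨c, _, h, h'⟩ := hw n hn
      exact ⟨c, fun _ => ⟨h, h'⟩⟩
    · exact ⟨0, fun h => absurd h hn⟩
  choose c hc using hex
  exact ⟨c, hc⟩

theorem limR_of_poly (hT : 0 < T) {w : W Ω T} {c : Fin (r + 1) → V Ω} {n : ℕ} (hn : n < P.N)
    (h : ∀ t ∈ P.slab n, val w t = toL2 (∑ k : Fin (r + 1), t ^ (k : ℕ) • c k)) :
    limR w (P.t n) = toL2 (∑ k : Fin (r + 1), P.t n ^ (k : ℕ) • c k) := by
  rw [limR, (tendsto_right_of_poly c hT h hn).limUnder_eq,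
    val_timePoly c ⟨P.t_nonneg hn.le, P.t_le hn.le⟩]

theorem limL_of_poly (hT : 0 < T) {w : W Ω T} {c : Fin (r + 1) → V Ω} {n : ℕ} (hn : n < P.N)
    (h : ∀ t ∈ P.slab n, val w t = toL2 (∑ k : Fin (r + 1), t ^ (k : ℕ) • c k)) :
    limL w (P.t (n + 1)) = toL2 (∑ k : Fin (r + 1), P.t (n + 1) ^ (k : ℕ) • c k) := by
  rw [limL, (tendsto_left_of_poly c hT h hn).limUnder_eq,
    val_timePoly c ⟨P.t_nonneg hn, P.t_le hn⟩]

/-- The residual of `u` as a functional on `V` at almost every time. -/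
def Data.strongRes (u : W Ω T) (t : ℝ) : V Ω →ₗ[ℝ] ℝ :=
  (D.f t).toLinearMap - (timeDeriv u t).toLinearMap - D.aForm t (valV u t)

theorem Data.strongRes_apply (u : W Ω T) (t : ℝ) (v : V Ω) :
    D.strongRes u t v = D.f t v - timeDeriv u t v - D.aForm t (valV u t) v := rfl

theorem Data.integrable_strongRes (u : W Ω T) {φ : ℝ → V Ω}
    (hφ : MemLp φ 2 (volume.restrict (Ioc 0 T))) :
    IntegrableOn (fun t => D.strongRes u t (φ t)) (Ioc 0 T) :=
  ((integrable_dual_apply (Lp.memLp D.f) hφ).sub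
    (integrable_dual_apply (Lp.memLp (timeDeriv u)) hφ)).sub
    (D.integrable_aForm (memLp_valV u) hφ)

theorem Data.integral_strongRes (hΩ : MeasurableSet Ω) (u φ : W Ω T) :
    ∫ t in Ioc 0 T, D.strongRes u t (valV φ t) = (∫ t in Ioc 0 T, D.f t (valV φ t))
      - ∫ t in Ioc 0 T, (timeDeriv u t (valV φ t) + D.a t (valV u t) (valV φ t)) := by
  rw [← integral_sub (integrable_dual_apply (Lp.memLp D.f) (memLp_valV φ))
    (D.integrableOn_form hΩ _ u φ)]
  refine integral_congr_ae ?_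
  filter_upwards [D.a_ae_eq_aForm hΩ (valV u) (valV φ)] with t ht
  rw [ht, D.strongRes_apply]
  ring

/-- Testing with `ψ(t) v`, where `ψ` has compact support in `(0,T)`, removes the initial term and
leaves a du Bois-Reymond argument in time. The exceptional set of times may depend on `v`. -/
theorem Data.strongRes_ae_eq_zero (hΩ : MeasurableSet Ω) (hT : 0 < T) {u : W Ω T}
    (h : ∀ φ ∈ energySpace Ω T, D.A u φ = D.F φ) (v : V Ω) :
    ∀ᵐ t ∂(volume.restrict (Ioc 0 T)), D.strongRes u t v = 0 := by
  have hint := D.integrable_strongRes u (memLp_const v)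
  have key := IsOpen.ae_eq_zero_of_integral_contDiff_smul_eq_zero (isOpen_Ioo (a := 0) (b := T))
    (f := fun t => D.strongRes u t v) (μ := volume.restrict (Ioc 0 T))
    (hint.locallyIntegrable.locallyIntegrableOn _) ?_
  · rw [ae_restrict_iff' measurableSet_Ioc] at key ⊢
    have hne : ∀ᵐ t : ℝ, t ≠ T := by simp [ae_iff]
    filter_upwards [key, hne] with t h1 h2 h3
    exact h1 h3 ⟨h3.1, lt_of_le_of_ne h3.2 h2⟩
  · intro ψ h1 h2 h3
    have hb : BddMeasurable T ψ := .of_continuous h1.continuous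
    have hm := timesVec_mem_energySpace hT.le (h1.of_le (by simp)) hb v
    have e := h _ hm
    have h0 : val (timesVec ψ hb v) 0 = 0 := by
      rw [val_timesVec hb v ⟨le_rfl, hT.le⟩]
      have : ψ 0 = 0 := by
        by_contra hne
        exact absurd (h3 (subset_tsupport _ hne)).1 (lt_irrefl _)
      rw [this, zero_smul]
    rw [Data.A, Data.F, h0, inner_zero_right, inner_zero_right, add_zero, add_zero] at e
    have e2 := D.integral_strongRes hΩ u (timesVec ψ hb v)
    rw [e, sub_self] at e2
    refine Eq.trans (integral_congr_ae ?_) e2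
    filter_upwards [valV_timesVec hb v] with t ht
    rw [ht, map_smul]

/-- For the test function constantly equal to `v` the time integrals cancel by
`Data.strongRes_ae_eq_zero`, and only the initial terms remain. -/
theorem Data.inner_initial_residual (hΩ : MeasurableSet Ω) (hT : 0 < T) {u : W Ω T}
    (h : ∀ φ ∈ energySpace Ω T, D.A u φ = D.F φ) (v : V Ω) :
    inner ℝ (val u 0) (toL2 v) = inner ℝ D.u₀ (toL2 v) := by
  have hc : BddMeasurable T (fun _ => (1 : ℝ)) := .of_continuous continuous_const
  have e := h _ (timesVec_mem_energySpace hT.le contDiff_const hc v)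
  have e2 := D.integral_strongRes hΩ u (timesVec _ hc v)
  have e3 : ∫ t in Ioc 0 T, D.strongRes u t (valV (timesVec _ hc v) t) = 0 := by
    refine integral_eq_zero_of_ae ?_
    filter_upwards [valV_timesVec hc v, D.strongRes_ae_eq_zero hΩ hT h v] with t h1 h2
    rw [h1, one_smul, h2, Pi.zero_apply]
  rw [Data.A, Data.F, val_timesVec hc v ⟨le_rfl, hT.le⟩, one_smul] at e
  linarith

/-- The weak solution satisfies the semidiscrete equation on the semidiscrete space. -/
theorem Data.Aτ_eq_Fτ_of_weak (hΩ : MeasurableSet Ω) (hT : 0 < T) {u φ : W Ω T}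
    (hu : u ∈ energySpace Ω T) (h : ∀ φ ∈ energySpace Ω T, D.A u φ = D.F φ)
    (hφ : φ ∈ dGSpace Ω P r) : D.Aτ P u φ = D.Fτ φ := by
  obtain ⟨c, hc⟩ := exists_slab_coeffs hφ
  have h0 := limR_of_poly hT P.one_le_N (hc 0 P.one_le_N).1
  rw [P.t_zero] at h0
  have e3 : ∫ t in Ioc 0 T, D.strongRes u t (valV φ t) = 0 := by
    refine integral_eq_zero_of_ae (P.ae_of_ae_slab fun n hn => ?_)
    -- A slab involves only finitely many vectors, so the exceptional sets depending on the vector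
    -- do no harm.
    have hk : ∀ᵐ t ∂(volume.restrict (Ioc 0 T)), ∀ k : Fin (r + 1),
        D.strongRes u t (c n k) = 0 := ae_all_iff.2 fun k => D.strongRes_ae_eq_zero hΩ hT h _
    filter_upwards [(hc n hn).2, P.ae_slab hn hk] with t h1 h2
    rw [h1, map_sum, Pi.zero_apply]
    exact Finset.sum_eq_zero fun k _ => by rw [map_smul, h2 k, smul_zero]
  have e2 := D.integral_strongRes hΩ u φ
  rw [D.Aτ_energySpace_left hΩ hT hu, Data.Fτ, h0, D.inner_initial_residual hΩ hT h]
  linarith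

end

/-! ## Galerkin orthogonality on the semidiscrete space: the dual equation -/

section
variable {d : ℕ} {Ω : Set (E d)} {T : ℝ} (D : Data Ω T) {P : TimePartition T} {r : ℕ}
  {Jt : ℝ → V Ω → ℝ} {JT : L2 Ω → ℝ} {u z : W Ω T}

/-- The derivative of the goal functional only sees the class in `L²(I;V)` and the final value. -/
theorem fderiv_goal_congr (hd : DifferentiableAt ℝ (goal Jt JT) u) {w w' : W Ω T}
    (h : valV w = valV w') (hT : val w T = val w' T) :
    fderiv ℝ (goal Jt JT) u w = fderiv ℝ (goal Jt JT) u w' := by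
  rw [← hd.lineDeriv_eq_fderiv, ← hd.lineDeriv_eq_fderiv, lineDeriv, lineDeriv]
  congr 1
  funext s
  rw [goal, goal, valV_add, valV_smul, h, val_add, val_smul, hT, ← val_smul, ← val_add,
    ← valV_smul, ← valV_add]

theorem continuousOn_inner_val (hz : z ∈ energySpace Ω T) (c : V Ω) :
    ContinuousOn (fun t => inner ℝ (toL2 c) (val z t)) (Icc 0 T) :=
  continuousOn_const.inner (𝕜 := ℝ) (continuousOn_val hz.1)

theorem Data.integrableOn_aForm_const (z : W Ω T) (c : V Ω) :
    IntegrableOn (fun t => D.aForm t c (valV z t)) (Ioc 0 T) :=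
  D.integrable_aForm (memLp_const c) (memLp_valV z)

/-- The dual equation for a smooth time factor, in scalar form: the duality pairing with the
derivative of `θ c` becomes `θ' (c, z)`, because `z` agrees almost everywhere with its class in
`L²(I;V)`. -/
theorem Data.fderiv_goal_timesVec (hΩ : MeasurableSet Ω) (hT : 0 < T)
    (h : ∀ φ ∈ energySpace Ω T, fderiv ℝ (goal Jt JT) u φ = D.A φ z) {θ : ℝ → ℝ}
    (hs : ContDiff ℝ 1 θ) (hθ : BddMeasurable T θ) (c : V Ω) :
    fderiv ℝ (goal Jt JT) u (timesVec θ hθ c)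
      = (∫ t in Ioc 0 T, (deriv θ t * inner ℝ (toL2 c) (val z t)
        + θ t * D.aForm t c (valV z t))) + θ 0 * inner ℝ (toL2 c) (val z 0) := by
  rw [h _ (timesVec_mem_energySpace hT.le hs hθ c), Data.A,
    val_timesVec hθ c ⟨le_rfl, hT.le⟩, real_inner_smul_left]
  congr 1
  refine integral_congr_ae ?_
  filter_upwards [timeDeriv_timesVec hT.le hs hθ c, valV_timesVec hθ c, val_ae_eq z,
    D.a_ae_eq_aForm hΩ (valV (timesVec θ hθ c)) (valV z)] with t h1 h2 h3 h4
  rw [h4, h1, h2, map_smul, h3, LinearMap.smul_apply, smul_apply, toDual_apply,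
    smul_eq_mul, smul_eq_mul]

/-- A step is not in the energy space, so it is approached by smoothed steps. The left side
converges by `tendsto_fderiv_goal`; on the right the derivatives of the smoothed steps concentrate
at `a` and leave the point value there. All smoothed steps vanish at `0`, so the initial term of `A`
contributes nothing; for `a = 0` its value is recovered in the limit. -/
theorem Data.fderiv_goal_unitStep (hΩ : MeasurableSet Ω) (hT : 0 < T)
    (hJt : ∀ w : W Ω T, IntegrableOn (fun t => Jt t (valV w t)) (Ioc 0 T))
    (hd : DifferentiableAt ℝ (goal Jt JT) u) (hz : z ∈ energySpace Ω T)
    (h : ∀ φ ∈ energySpace Ω T, fderiv ℝ (goal Jt JT) u φ = D.A φ z) {a : ℝ} (ha : 0 ≤ a)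
    (haT : a < T) {ξ : ℝ → ℝ} (hξ : ContDiff ℝ 1 ξ)
    (hb : BddMeasurable T fun t => unitStep a t * ξ t) (c : V Ω) :
    fderiv ℝ (goal Jt JT) u (timesVec (fun t => unitStep a t * ξ t) hb c)
      = (∫ t in Ioc a T, (deriv ξ t * inner ℝ (toL2 c) (val z t)
        + ξ t * D.aForm t c (valV z t))) + ξ a * inner ℝ (toL2 c) (val z a) := by
  have hbξ : BddMeasurable T ξ := .of_continuous hξ.continuous
  have hbj : ∀ j, BddMeasurable T fun t => smoothStep a j t * ξ t := fun j =>
    .of_continuous ((contDiff_smoothStep a j).continuous.mul hξ.continuous)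
  obtain ⟨_, C, hC⟩ := hbξ
  have hC0 : 0 ≤ C := (abs_nonneg _).trans (hC 0 ⟨le_rfl, hT.le⟩)
  have h1 := tendsto_fderiv_goal (JT := JT) hJt hd c (fun j => (hbj j).sub hb) (C := C + C)
    (fun j t ht => ?_) (fun t _ => ?_) hT
  · have h2 := tendsto_integral_smoothStep_mul ha haT hξ (continuousOn_inner_val hz c)
      (D.integrableOn_aForm_const z c)
    have h3 : ∀ j, fderiv ℝ (goal Jt JT) u (timesVec _ (hbj j) c)
        = ∫ t in Ioc 0 T, (deriv (fun t => smoothStep a j t * ξ t) t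
            * inner ℝ (toL2 c) (val z t) + smoothStep a j t * ξ t * D.aForm t c (valV z t)) := by
      intro j
      rw [D.fderiv_goal_timesVec hΩ hT h ((contDiff_smoothStep a j).mul hξ) (hbj j) c,
        smoothStep_of_le ha, zero_mul, zero_mul, add_zero]
    have h4 : Tendsto (fun j => fderiv ℝ (goal Jt JT) u (timesVec _ (hbj j) c)) atTop
        (𝓝 (fderiv ℝ (goal Jt JT) u (timesVec (fun t => unitStep a t * ξ t) hb c))) := by
      have := h1.add_const (fderiv ℝ (goal Jt JT) u (timesVec (fun t => unitStep a t * ξ t) hb c))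
      simp only [zero_add] at this
      refine this.congr fun j => ?_
      rw [← timesVec_sub (hbj j) hb, map_sub, sub_add_cancel]
    simp only [h3] at h4
    exact tendsto_nhds_unique h4 h2
  · refine (abs_sub _ _).trans (add_le_add ?_ ?_)
    · rw [abs_mul]
      exact (mul_le_of_le_one_left (abs_nonneg _) (abs_smoothStep_le a j t)).trans (hC t ht)
    · rcases lt_or_ge a t with hat | hat
      · rw [unitStep_of_lt hat, one_mul]; exact hC t ht
      · rw [unitStep_of_le hat, zero_mul, abs_zero]; exact hC0
  · have := ((tendsto_smoothStep a t).sub_const (unitStep a t)).mul_const (ξ t)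
    rw [sub_self, zero_mul] at this
    refine this.congr fun j => ?_
    ring

theorem BddMeasurable.indicator {θ : ℝ → ℝ} (h : BddMeasurable T θ) (a b : ℝ) :
    BddMeasurable T ((Ioc a b).indicator θ) := by
  obtain ⟨hm, C, hC⟩ := h
  refine ⟨hm.indicator measurableSet_Ioc, C, fun t ht => ?_⟩
  exact (norm_indicator_le_norm_self θ t).trans (hC t ht)

/-- The indicator of `(a,b]` is a difference of two unit steps. For `b = T` the second one vanishes
on `[0,T]`, hence no term at the final time. -/
theorem Data.fderiv_goal_slab (hΩ : MeasurableSet Ω) (hT : 0 < T)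
    (hJt : ∀ w : W Ω T, IntegrableOn (fun t => Jt t (valV w t)) (Ioc 0 T))
    (hd : DifferentiableAt ℝ (goal Jt JT) u) (hz : z ∈ energySpace Ω T)
    (h : ∀ φ ∈ energySpace Ω T, fderiv ℝ (goal Jt JT) u φ = D.A φ z) {a b : ℝ} (ha : 0 ≤ a)
    (hab : a < b) (hbT : b ≤ T) {ξ : ℝ → ℝ} (hξ : ContDiff ℝ 1 ξ) (hbξ : BddMeasurable T ξ)
    (c : V Ω) :
    fderiv ℝ (goal Jt JT) u (timesVec _ (hbξ.indicator a b) c)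
      = (∫ t in Ioc a b, (deriv ξ t * inner ℝ (toL2 c) (val z t)
        + ξ t * D.aForm t c (valV z t))) + ξ a * inner ℝ (toL2 c) (val z a)
        - if b < T then ξ b * inner ℝ (toL2 c) (val z b) else 0 := by
  have ba := (bddMeasurable_unitStep T a).mul hbξ
  have bb := (bddMeasurable_unitStep T b).mul hbξ
  have e : timesVec _ (hbξ.indicator a b) c = timesVec _ ba c - timesVec _ bb c := by
    have hp : ∀ t, (Ioc a b).indicator ξ t = unitStep a t * ξ t - unitStep b t * ξ t := by
      intro t
      rcases le_or_gt t a with h1 | h1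
      · rw [unitStep_of_le h1, unitStep_of_le (h1.trans hab.le),
          indicator_of_notMem (fun hm => absurd hm.1 (not_lt.2 h1))]
        ring
      · rcases le_or_gt t b with h2 | h2
        · rw [unitStep_of_lt h1, unitStep_of_le h2, indicator_of_mem (mem_Ioc.2 ⟨h1, h2⟩)]
          ring
        · rw [unitStep_of_lt h1, unitStep_of_lt h2,
            indicator_of_notMem (fun hm => absurd hm.2 (not_le.2 h2))]
          ring
    rw [timesVec_sub]
    congr 1
    exact funext hp
  have hG : IntegrableOn (fun t => deriv ξ t * inner ℝ (toL2 c) (val z t)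
        + ξ t * D.aForm t c (valV z t)) (Ioc 0 T) := by
    refine Integrable.add ?_ ?_
    · exact (((hξ.continuous_deriv le_rfl).continuousOn.mul
        (continuousOn_inner_val hz c)).integrableOn_Icc).mono_set Ioc_subset_Icc_self
    · obtain ⟨hm, C, hC⟩ := hbξ
      refine Integrable.bdd_mul (D.integrableOn_aForm_const z c) (c := C)
        hm.aestronglyMeasurable ?_
      filter_upwards [ae_restrict_mem measurableSet_Ioc] with t ht
      exact hC t ⟨ht.1.le, ht.2⟩
  rw [e, map_sub, D.fderiv_goal_unitStep hΩ hT hJt hd hz h ha (hab.trans_le hbT) hξ ba c]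
  rcases hbT.lt_or_eq with hlt | heq
  · rw [D.fderiv_goal_unitStep hΩ hT hJt hd hz h (ha.trans hab.le) hlt hξ bb c, if_pos hlt]
    have : Ioc a T = Ioc a b ∪ Ioc b T := (Ioc_union_Ioc_eq_Ioc hab.le hbT).symm
    rw [this, setIntegral_union (Ioc_disjoint_Ioc_of_le le_rfl) measurableSet_Ioc
      (hG.mono_set (Ioc_subset_Ioc ha hbT))
      (hG.mono_set (Ioc_subset_Ioc (ha.trans hab.le) le_rfl))]
    ring
  · have hz0 : timesVec _ bb c = 0 := by
      have hu : ∀ t ∈ Icc (0 : ℝ) T, unitStep b t * ξ t = 0 := fun t ht => by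
        rw [unitStep_of_le (ht.2.trans heq.ge), zero_mul]
      refine ext_W (fun t ht => ?_) ?_
      · rw [val_timesVec _ _ ht, val_zero, hu t ht, zero_smul]
      · filter_upwards [valV_timesVec bb c, ae_restrict_mem measurableSet_Ioc,
          Lp.coeFn_zero (V Ω) 2 (volume.restrict (Ioc 0 T))] with t h1 h2 h3
        rw [h1, hu t ⟨h2.1.le, h2.2⟩, zero_smul]
        exact h3.symm
    rw [hz0, map_zero, if_neg (by rw [heq]; exact lt_irrefl T), heq]

/-- Regrouping by nodes: the start term of slab `n` meets the end term of slab `n - 1`, the first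
start term stays alone, and the last end term is absent. -/
theorem sum_range_sub_sum_ite {N : ℕ} (hN : 1 ≤ N) (A B : ℕ → ℝ) :
    ∑ n ∈ Finset.range N, (A n - if n + 1 < N then B n else 0)
      = ∑ n ∈ Finset.Ico 1 N, (A n - B (n - 1)) + A 0 := by
  obtain ⟨M, rfl⟩ := Nat.exists_eq_add_of_le' hN
  rw [Finset.sum_sub_distrib, Finset.sum_range_succ', Finset.sum_range_succ (fun n => ite _ _ _),
    if_neg (lt_irrefl _), Finset.sum_Ico_eq_sum_range, Nat.add_sub_cancel]
  have : ∑ n ∈ Finset.range M, (if n + 1 < M + 1 then B n else 0) = ∑ n ∈ Finset.range M, B n :=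
    Finset.sum_congr rfl fun n hn => if_pos (by simpa using hn)
  rw [this, Finset.sum_sub_distrib]
  simp only [add_comm 1, Nat.add_sub_cancel]
  ring

theorem P_t_lt_iff (P : TimePartition T) {n : ℕ} (hn : n ≤ P.N) : P.t n < T ↔ n < P.N := by
  refine ⟨fun h => lt_of_le_of_ne hn fun e => ?_, P.t_lt⟩
  rw [e, P.t_last] at h
  exact lt_irrefl _ h

/-- The dual solution satisfies the semidiscrete dual equation on the semidiscrete space. -/
theorem Data.fderiv_goal_eq_Aτ (hΩ : MeasurableSet Ω) (hT : 0 < T)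
    (hJt : ∀ w : W Ω T, IntegrableOn (fun t => Jt t (valV w t)) (Ioc 0 T))
    (hd : DifferentiableAt ℝ (goal Jt JT) u) (hz : z ∈ energySpace Ω T)
    (h : ∀ φ ∈ energySpace Ω T, fderiv ℝ (goal Jt JT) u φ = D.A φ z) {φ : W Ω T}
    (hφ : φ ∈ dGSpace Ω P r) : fderiv ℝ (goal Jt JT) u φ = D.Aτ P φ z := by
  obtain ⟨c, hc⟩ := exists_slab_coeffs hφ
  have hreg := dGSpace_subset_slabRegular hT hφ
  -- This function agrees with `φ` on `(0,T]` but vanishes at `0`, where `φ` has an arbitrary value.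
  -- The derivative of the goal functional does not see the difference, by `fderiv_goal_congr`.
  set w : W Ω T := ∑ n ∈ Finset.range P.N, ∑ k : Fin (r + 1), timesVec _
    ((BddMeasurable.pow T (k : ℕ)).indicator (P.t n) (P.t (n + 1))) (c n k) with hw
  have hind : ∀ {F : Type _} [AddCommGroup F] [Module ℝ F] (f : ℕ → Fin (r + 1) → F) {m : ℕ},
      m < P.N → ∀ t ∈ P.slab m, ∑ n ∈ Finset.range P.N, ∑ k : Fin (r + 1),
        (Ioc (P.t n) (P.t (n + 1))).indicator (fun t : ℝ => t ^ (k : ℕ)) t • f n k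
        = ∑ k : Fin (r + 1), t ^ (k : ℕ) • f m k := by
    intro F _ _ f m hm t ht
    rw [Finset.sum_eq_single m]
    · refine Finset.sum_congr rfl fun k _ => ?_
      rw [indicator_of_mem (show t ∈ Ioc (P.t m) (P.t (m + 1)) from ht)]
    · intro n hn hne
      refine Finset.sum_eq_zero fun k _ => ?_
      have hnt : t ∉ Ioc (P.t n) (P.t (n + 1)) := fun hmem => Set.disjoint_left.1
        (P.slab_disjoint (Finset.mem_range.1 hn) hm hne) hmem ht
      rw [indicator_of_notMem hnt, zero_smul]
    · exact fun hn => absurd (Finset.mem_range.2 hm) hn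
  have hwV : valV φ = valV w := by
    refine Lp.ext (P.ae_of_ae_slab fun m hm => ?_)
    have h1 : ∀ᵐ t ∂(volume.restrict (Ioc 0 T)), ∀ n, ∀ k : Fin (r + 1),
        valV (timesVec _ ((BddMeasurable.pow T (k : ℕ)).indicator (P.t n) (P.t (n + 1))) (c n k)) t
          = (Ioc (P.t n) (P.t (n + 1))).indicator (fun t : ℝ => t ^ (k : ℕ)) t • c n k :=
      ae_all_iff.2 fun n => ae_all_iff.2 fun k => valV_timesVec _ _
    have h2 : ∀ᵐ t ∂(volume.restrict (Ioc 0 T)), ∀ n,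
        valV (∑ k : Fin (r + 1), timesVec _
          ((BddMeasurable.pow T (k : ℕ)).indicator (P.t n) (P.t (n + 1))) (c n k)) t
          = ∑ k : Fin (r + 1), valV (timesVec _
          ((BddMeasurable.pow T (k : ℕ)).indicator (P.t n) (P.t (n + 1))) (c n k)) t :=
      ae_all_iff.2 fun n => valV_sum_ae _ _
    filter_upwards [(hc m hm).2, P.ae_slab hm h1, P.ae_slab hm h2,
      P.ae_slab hm (valV_sum_ae (Finset.range P.N) fun n => ∑ k : Fin (r + 1), timesVec _
        ((BddMeasurable.pow T (k : ℕ)).indicator (P.t n) (P.t (n + 1))) (c n k)),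
      ae_restrict_mem (P.measurableSet_slab m)] with t e1 e2 e3 e4 ht
    rw [e1, hw, e4, ← hind c hm t ht]
    refine Finset.sum_congr rfl fun n _ => ?_
    rw [e3]
    exact Finset.sum_congr rfl fun k _ => (e2 n k).symm
  have hwT : val φ T = val w T := by
    obtain ⟨m, hm, htm⟩ := P.exists_mem_slab (t := T) ⟨hT, le_rfl⟩
    rw [(hc m hm).1 T htm, ← hind c hm T htm, hw, val_sum, map_sum]
    refine Finset.sum_congr rfl fun n _ => ?_
    rw [val_sum, map_sum]
    refine Finset.sum_congr rfl fun k _ => ?_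
    rw [val_timesVec _ _ ⟨hT.le, le_rfl⟩, map_smul]
  set G : ℕ → Fin (r + 1) → ℝ → ℝ := fun n k t =>
    deriv (fun t : ℝ => t ^ (k : ℕ)) t * inner ℝ (toL2 (c n k)) (val z t)
      + t ^ (k : ℕ) * D.aForm t (c n k) (valV z t) with hG
  set p : ℕ → ℝ → ℝ := fun n t =>
    inner ℝ (toL2 (∑ k : Fin (r + 1), t ^ (k : ℕ) • c n k)) (val z t) with hp
  have hpsum : ∀ n t, p n t
      = ∑ k : Fin (r + 1), t ^ (k : ℕ) * inner ℝ (toL2 (c n k)) (val z t) := fun n t => by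
    simp only [hp, map_sum, map_smul, sum_inner, real_inner_smul_left]
  have hGint : ∀ n < P.N, ∀ k, IntegrableOn (G n k) (P.slab n) := fun n hn k => by
    refine IntegrableOn.mono_set (t := Ioc 0 T) ?_ (P.slab_subset hn)
    refine Integrable.add ?_ ?_
    · exact ((((contDiff_id.pow _ : ContDiff ℝ 1 fun t : ℝ => t ^ (k : ℕ)).continuous_deriv
        le_rfl).continuousOn.mul (continuousOn_inner_val hz _)).integrableOn_Icc).mono_set
        Ioc_subset_Icc_self
    · obtain ⟨hm, C, hC⟩ := BddMeasurable.pow T (k : ℕ)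
      refine Integrable.bdd_mul (D.integrableOn_aForm_const z _) (c := C)
        hm.aestronglyMeasurable ?_
      filter_upwards [ae_restrict_mem measurableSet_Ioc] with t ht
      exact hC t ⟨ht.1.le, ht.2⟩
  -- Each slab contributes its integral plus the pairing with `z` at its start minus the pairing at
  -- its end, the latter only if the end lies before `T`.
  have hL : fderiv ℝ (goal Jt JT) u φ = ∑ n ∈ Finset.range P.N,
      ((∫ t in P.slab n, ∑ k, G n k t)
        + (p n (P.t n) - if n + 1 < P.N then p n (P.t (n + 1)) else 0)) := by
    rw [fderiv_goal_congr hd hwV hwT, hw, map_sum]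
    refine Finset.sum_congr rfl fun n hn => ?_
    have hn := Finset.mem_range.1 hn
    rw [map_sum, integral_finsetSum _ fun k _ => hGint n hn k, hpsum, hpsum]
    have h1 : (if n + 1 < P.N then ∑ k : Fin (r + 1), P.t (n + 1) ^ (k : ℕ)
          * inner ℝ (toL2 (c n k)) (val z (P.t (n + 1))) else 0)
        = ∑ k : Fin (r + 1), if P.t (n + 1) < T then P.t (n + 1) ^ (k : ℕ)
          * inner ℝ (toL2 (c n k)) (val z (P.t (n + 1))) else 0 := by
      simp only [P_t_lt_iff P (Nat.succ_le_of_lt hn)]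
      split_ifs <;> simp
    rw [h1, ← Finset.sum_sub_distrib, ← Finset.sum_add_distrib]
    refine Finset.sum_congr rfl fun k _ => ?_
    rw [D.fderiv_goal_slab hΩ hT hJt hd hz h (P.t_nonneg hn.le) (P.lt_succ n hn)
      (P.t_le hn) (ξ := fun t => t ^ (k : ℕ)) (contDiff_id.pow _) (.pow T k) (c n k), add_sub_assoc]
    rfl
  have hR : ∀ n < P.N, ∫ t in P.slab n, (slabTimeDeriv P φ t (valV z t)
      + D.a t (valV φ t) (valV z t)) = ∫ t in P.slab n, ∑ k, G n k t := fun n hn => by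
    refine integral_congr_ae ?_
    filter_upwards [slabTimeDeriv_ae_eq hreg hn (hasTimeDeriv_of_poly (c n) hT (hc n hn).1 hn
        (Eventually.of_forall fun t => rfl)), P.ae_slab hn (timeDeriv_timePoly (c n) hT.le),
      (hc n hn).2, P.ae_slab hn (val_ae_eq z),
      P.ae_slab hn (D.a_ae_eq_aForm hΩ (valV φ) (valV z))] with t e1 e2 e3 e4 e5
    rw [e5, e1, e2, e3, map_sum, LinearMap.sum_apply, sum_apply,
      ← Finset.sum_add_distrib]
    refine Finset.sum_congr rfl fun k _ => ?_
    simp only [hG, e4, map_smul, LinearMap.smul_apply, smul_apply, toDual_apply, smul_eq_mul]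
  have h00 := limR_of_poly hT P.one_le_N (hc 0 P.one_le_N).1
  have hz0 : limR z 0 = val z 0 := limR_energySpace hz le_rfl hT
  -- At an interior node the two slab polynomials are paired with the same value of the continuous
  -- `z`, so their difference is the jump of `φ`; the term at `0` is the initial term of `Aτ`.
  rw [hL, Finset.sum_add_distrib, sum_range_sub_sum_ite P.one_le_N
    (fun n => p n (P.t n)) (fun n => p n (P.t (n + 1))), Data.Aτ, ← add_assoc]
  congr 1
  · congr 1
    · exact Finset.sum_congr rfl fun n hn => (hR n (Finset.mem_range.1 hn)).symm
    · refine Finset.sum_congr rfl fun n hn => ?_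
      obtain ⟨h1, h2⟩ := Finset.mem_Ico.1 hn
      obtain ⟨m, rfl⟩ := Nat.exists_eq_add_of_le' h1
      have hm : m < P.N := Nat.lt_of_succ_lt h2
      rw [jump, limR_energySpace hz (P.t_nonneg h2.le) (P.t_lt h2),
        limR_of_poly hT h2 (hc _ h2).1, limL_of_poly hT hm (hc _ hm).1, inner_sub_left,
        Nat.add_sub_cancel]
  · rw [P.t_zero] at h00 ⊢
    rw [h00, hz0]

end

/-! ## The trapezoidal rule along a segment -/

section

/-- The trapezoidal rule with remainder on `[0,1]`. -/
theorem sub_eq_trapezoid {j : ℝ → ℝ} (hj : ContDiff ℝ 3 j) :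
    j 1 - j 0 = 1 / 2 * (deriv j 1 + deriv j 0)
      + 1 / 2 * ∫ s in (0 : ℝ)..1, iteratedDeriv 3 j s * (s * (s - 1)) := by
  have hd : ∀ k : ℕ, k < 3 → ∀ s,
      HasDerivAt (iteratedDeriv k j) (iteratedDeriv (k + 1) j s) s := fun k hk s => by
    rw [iteratedDeriv_succ]
    exact (hj.differentiable_iteratedDeriv k (by exact_mod_cast hk) s).hasDerivAt
  have h0 : ∀ s, HasDerivAt j (deriv j s) s := fun s => by
    simpa using hd 0 (by norm_num) s
  have h1 : ∀ s, HasDerivAt (deriv j) (iteratedDeriv 2 j s) s := fun s => by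
    have := hd 1 (by norm_num) s
    rwa [iteratedDeriv_one] at this
  -- The antiderivative obtained by integrating by parts twice. The weight `s(s-1)` vanishes at both
  -- ends, so its increment over `[0,1]` is `2 (j 1 - j 0) - (j' 1 + j' 0)`.
  have hK : ∀ s, HasDerivAt (fun s => iteratedDeriv 2 j s * (s * (s - 1))
      - deriv j s * (2 * s - 1) + 2 * j s) (iteratedDeriv 3 j s * (s * (s - 1))) s := fun s => by
    have e1 : HasDerivAt (fun s : ℝ => s * (s - 1)) (2 * s - 1) s :=
      ((hasDerivAt_id s).mul ((hasDerivAt_id s).sub_const 1)).congr_deriv (by simp; ring)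
    have e2 : HasDerivAt (fun s : ℝ => 2 * s - 1) 2 s :=
      (((hasDerivAt_id s).const_mul 2).sub_const 1).congr_deriv (by simp)
    refine ((((hd 2 (by norm_num) s).mul e1).sub ((h1 s).mul e2)).add
      ((h0 s).const_mul 2)).congr_deriv ?_
    ring
  have hc : Continuous fun s => iteratedDeriv 3 j s * (s * (s - 1)) :=
    (hj.continuous_iteratedDeriv 3 le_rfl).mul (by fun_prop)
  rw [intervalIntegral.integral_eq_sub_of_hasDerivAt (fun s _ => hK s)
    (hc.intervalIntegrable _ _)]
  ring

variable {X : Type*} [NormedAddCommGroup X] [NormedSpace ℝ X] {J : X → ℝ}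

/-- The scalar rule for `s ↦ J (y + s e)`; by the chain rule its derivatives are those of `J`
evaluated repeatedly in the direction `e`. -/
theorem sub_eq_fderiv_trapezoid (hJ : ContDiff ℝ 3 J) (x y : X) :
    J x - J y = 1 / 2 * (fderiv ℝ J x (x - y) + fderiv ℝ J y (x - y))
      + 1 / 2 * ∫ s in (0 : ℝ)..1,
        iteratedFDeriv ℝ 3 J (y + s • (x - y)) (fun _ => x - y) * (s * (s - 1)) := by
  set e := x - y with he
  set j : ℝ → ℝ := fun s => J (y + s • e) with hjdef
  have hj : ContDiff ℝ 3 j := hJ.comp (contDiff_const.add (contDiff_id.smul contDiff_const))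
  have hd : ∀ s, deriv j s = fderiv ℝ J (y + s • e) e := fun s => by
    have h1 : HasDerivAt (fun s : ℝ => y + s • e) e s :=
      (((hasDerivAt_id s).smul_const e).const_add y).congr_deriv (one_smul ℝ e)
    exact ((hJ.differentiable (by simp) _).hasFDerivAt.comp_hasDerivAt s h1).deriv
  have h3 : ∀ s, iteratedDeriv 3 j s = iteratedFDeriv ℝ 3 J (y + s • e) (fun _ => e) := fun s => by
    have hcomp : j = (fun v => J (y + v)) ∘ (ContinuousLinearMap.toSpanSingleton ℝ e) := by
      funext s
      simp [hjdef]
    have hJy : ContDiff ℝ 3 fun v => J (y + v) := hJ.comp (contDiff_const.add contDiff_id)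
    rw [iteratedDeriv_eq_iteratedFDeriv, hcomp,
      ContinuousLinearMap.iteratedFDeriv_comp_right _ hJy _ le_rfl, iteratedFDeriv_comp_add_left]
    simp only [ContinuousMultilinearMap.compContinuousLinearMap_apply,
      ContinuousLinearMap.toSpanSingleton_apply, one_smul]
  have h := sub_eq_trapezoid hj
  simp only [h3, hd] at h
  have hx : y + (1 : ℝ) • e = x := by rw [one_smul, he, add_sub_cancel]
  have hy : y + (0 : ℝ) • e = y := by rw [zero_smul, add_zero]
  rw [hx, hy] at h
  rw [← h]
  simp only [hjdef]
  rw [hx, hy]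

/-- The constant is `½ ∫ s(1-s) ds = 1/12`. -/
theorem abs_trapezoid_remainder_le {x y : X} {C : ℝ}
    (hC : ∀ s ∈ Icc (0 : ℝ) 1, ‖iteratedFDeriv ℝ 3 J (y + s • (x - y))‖ ≤ C) :
    |1 / 2 * ∫ s in (0 : ℝ)..1,
      iteratedFDeriv ℝ 3 J (y + s • (x - y)) (fun _ => x - y) * (s * (s - 1))|
      ≤ C / 12 * ‖x - y‖ ^ 3 := by
  have h1 : ‖∫ s in (0 : ℝ)..1, iteratedFDeriv ℝ 3 J (y + s • (x - y)) (fun _ => x - y)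
      * (s * (s - 1))‖ ≤ ∫ s in (0 : ℝ)..1, C * ‖x - y‖ ^ 3 * (s * (1 - s)) := by
    refine intervalIntegral.norm_integral_le_of_norm_le zero_le_one
      (Eventually.of_forall fun s hs => ?_) ((by fun_prop : Continuous fun s : ℝ =>
        C * ‖x - y‖ ^ 3 * (s * (1 - s))).intervalIntegrable _ _)
    have h2 : ‖iteratedFDeriv ℝ 3 J (y + s • (x - y)) (fun _ => x - y)‖ ≤ C * ‖x - y‖ ^ 3 := by
      refine (ContinuousMultilinearMap.le_opNorm _ _).trans ?_
      rw [Finset.prod_const, Finset.card_univ, Fintype.card_fin]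
      exact mul_le_mul_of_nonneg_right (hC s ⟨hs.1.le, hs.2⟩) (by positivity)
    rw [norm_mul]
    have h3 : ‖s * (s - 1)‖ = s * (1 - s) := by
      rw [Real.norm_eq_abs, abs_mul, abs_of_pos hs.1, abs_of_nonpos (by linarith [hs.2])]
      ring
    rw [h3]
    exact mul_le_mul_of_nonneg_right h2 (mul_nonneg hs.1.le (by linarith [hs.2]))
  have h2 : ∫ s in (0 : ℝ)..1, C * ‖x - y‖ ^ 3 * (s * (1 - s)) = C * ‖x - y‖ ^ 3 / 6 := by
    rw [intervalIntegral.integral_const_mul]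
    have : ∫ s in (0 : ℝ)..1, s * (1 - s) = 1 / 6 := by
      have e : (fun s : ℝ => s * (1 - s)) = fun s => s ^ 1 - s ^ 2 := by funext s; ring
      rw [e, intervalIntegral.integral_sub (by simp) (by simp), integral_pow, integral_pow]
      norm_num
    rw [this]
    ring
  rw [h2, Real.norm_eq_abs] at h1
  rw [abs_mul, abs_of_pos (by norm_num : (0 : ℝ) < 1 / 2)]
  linarith

end

/-! ## Finite element functions on iso-parametric elements -/

section
variable {d : ℕ}

theorem contDiff_eval_mvPolynomial (q : MvPolynomial (Fin d) ℝ) {n : WithTop ℕ∞} :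
    ContDiff ℝ n (fun x : E d => MvPolynomial.eval (fun j => x j) q) := by
  induction q using MvPolynomial.induction_on with
  | C a => simpa using contDiff_const
  | add q q' h h' => simpa using h.add h'
  | mul_X q i h =>
    simp only [map_mul, MvPolynomial.eval_X]
    exact h.mul (contDiff_piLp_apply (p := 2) (i := i))

theorem isOpen_refCube : IsOpen (refCube d) := by
  have : refCube d = ⋂ i, (fun x : E d => x i) ⁻¹' Ioo 0 1 := by
    ext x; simp [refCube]
  rw [this]
  exact isOpen_iInter_of_finite fun i =>
    isOpen_Ioo.preimage (contDiff_piLp_apply (𝕜 := ℝ) (n := 0) (p := 2) (i := i)).continuous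

theorem isCompact_closedRefCube : IsCompact (closedRefCube d) := by
  have : closedRefCube d = (EuclideanSpace.equiv (Fin d) ℝ).symm ''
      (univ.pi fun _ => Icc (0 : ℝ) 1) := by
    rw [ContinuousLinearEquiv.image_symm_eq_preimage]
    ext x; simp [closedRefCube, Pi.le_def, forall_and]
  rw [this]
  exact (isCompact_univ_pi fun _ => isCompact_Icc).image
    (EuclideanSpace.equiv (Fin d) ℝ).symm.continuous

theorem refCube_subset_closedRefCube : refCube d ⊆ closedRefCube d :=
  fun _ hx i => Ioo_subset_Icc_self (hx i)

theorem laplacian_continuousAt {g : E d → ℝ} {x : E d} (h : ContDiffAt ℝ 2 g x) :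
    ContinuousAt (Δ g) x := by
  rw [InnerProductSpace.laplacian_eq_iteratedFDeriv_stdOrthonormalBasis]
  have h2 : ContinuousAt (iteratedFDeriv ℝ 2 g) x := h.continuousAt_iteratedFDeriv le_rfl
  refine tendsto_finsetSum _ fun i _ => ?_
  exact ((ContinuousMultilinearMap.apply ℝ (fun _ : Fin 2 => E d) ℝ _).continuous.tendsto _).comp h2

theorem laplacian_sum {ι : Type*} (s : Finset ι) (a : ι → ℝ) {g : ι → E d → ℝ} {x : E d}
    (h : ∀ k ∈ s, ContDiffAt ℝ 2 (g k) x) :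
    Δ (fun y => ∑ k ∈ s, a k * g k y) x = ∑ k ∈ s, a k * Δ (g k) x := by
  classical
  induction s using Finset.induction_on with
  | empty => simp [InnerProductSpace.laplacian_const]
  | insert i s hi ih =>
    have h1 : ContDiffAt ℝ 2 (a i • g i) x := (h i (Finset.mem_insert_self _ _)).const_smul (a i)
    have h2 : ContDiffAt ℝ 2 (fun y => ∑ k ∈ s, a k * g k y) x :=
      ContDiffAt.sum fun k hk => contDiffAt_const.mul (h k (Finset.mem_insert_of_mem hk))
    have : (fun y => ∑ k ∈ insert i s, a k * g k y)
        = a i • g i + fun y => ∑ k ∈ s, a k * g k y := by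
      funext y; simp [Finset.sum_insert hi]
    rw [this, h1.laplacian_add h2, Finset.sum_insert hi,
      ih fun k hk => h k (Finset.mem_insert_of_mem hk),
      InnerProductSpace.laplacian_smul _ (h i (Finset.mem_insert_self _ _)), smul_eq_mul]

/-! ### Regularity of mapped polynomials up to the element boundary -/

variable {Ω : Set (E d)} {p : ℕ} (M : Mesh Ω p) (K : Fin M.card)

theorem Mesh.contDiff_map {n : WithTop ℕ∞} : ContDiff ℝ n (M.map K) := by
  rw [contDiff_euclidean]
  intro i
  simp only [M.map_apply]
  exact contDiff_eval_mvPolynomial _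

/-- A function that is a polynomial in the reference coordinates is locally, up to the boundary of
an element, the restriction of a smooth function. -/
theorem Mesh.exists_local_extension {g : E d → ℝ} {q : MvPolynomial (Fin d) ℝ}
    (hg : ∀ x ∈ refCube d, g (M.map K x) = MvPolynomial.eval (fun j => x j) q)
    {ξ₀ : E d} (hξ : ξ₀ ∈ closedRefCube d) :
    ∃ Q : E d → ℝ, ContDiffAt ℝ 2 Q (M.map K ξ₀) ∧
      ∀ᶠ ξ in 𝓝 ξ₀, ξ ∈ refCube d → g =ᶠ[𝓝 (M.map K ξ)] Q ∧ M.elem K ∈ 𝓝 (M.map K ξ) := by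
  have hc : ContDiffAt ℝ 2 (M.map K) ξ₀ := (M.contDiff_map K).contDiffAt
  have hn : (2 : WithTop ℕ∞) ≠ 0 := two_ne_zero
  -- The determinant is positive on the closed cube, so the inverse function theorem applies at
  -- boundary points as well.
  have hd : HasFDerivAt (M.map K) (((fderiv ℝ (M.map K) ξ₀).toContinuousLinearEquivOfDetNeZero
      (M.det_pos K ξ₀ hξ).ne' : E d ≃L[ℝ] E d) : E d →L[ℝ] E d) ξ₀ := by
    rw [ContinuousLinearMap.coe_toContinuousLinearEquivOfDetNeZero]
    exact (hc.differentiableAt hn).hasFDerivAt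
  set Φ := hc.toOpenPartialHomeomorph (M.map K) hd hn with hΦ
  have hco : ∀ x, Φ x = M.map K x := fun x => rfl
  -- The extension is `q` composed with the local inverse of `T_K`. It is smooth across the element
  -- boundary, while `g` itself is only prescribed inside.
  refine ⟨fun y => MvPolynomial.eval (fun j => Φ.symm y j) q, ?_, ?_⟩
  · exact (contDiff_eval_mvPolynomial q).contDiffAt.comp _ (hc.to_localInverse hd hn)
  · filter_upwards [Φ.open_source.mem_nhds (hc.mem_toOpenPartialHomeomorph_source hd hn)]
      with ξ hs hr
    have hmem : Φ.target ∩ Φ.symm ⁻¹' refCube d ∈ 𝓝 (M.map K ξ) := by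
      refine (Φ.symm.isOpen_inter_preimage isOpen_refCube).mem_nhds ⟨Φ.map_source hs, ?_⟩
      rw [mem_preimage, ← hco, Φ.left_inv hs]
      exact hr
    constructor
    · filter_upwards [hmem] with y hy
      rw [← hg _ hy.2, ← hco, Φ.right_inv hy.1]
    · filter_upwards [hmem] with y hy
      exact ⟨_, hy.2, by rw [← hco, Φ.right_inv hy.1]⟩

/-- The second conclusion of `Mesh.exists_local_extension`, for the zero function, says that every
point of the element is interior. -/
theorem Mesh.isOpen_elem : IsOpen (M.elem K) := by
  refine isOpen_iff_mem_nhds.2 ?_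
  rintro _ ⟨ξ, hξ, rfl⟩
  obtain ⟨Q, -, h⟩ := M.exists_local_extension K (g := fun x => 0) (q := 0) (by simp)
    (refCube_subset_closedRefCube hξ)
  exact (h.self_of_nhds hξ).2

section
variable {M K} {g : E d → ℝ} {q : MvPolynomial (Fin d) ℝ}

theorem contDiffAt_of_mem_elem
    (hg : ∀ x ∈ refCube d, g (M.map K x) = MvPolynomial.eval (fun j => x j) q)
    {x : E d} (hx : x ∈ M.elem K) : ContDiffAt ℝ 2 g x := by
  obtain ⟨ξ, hξ, rfl⟩ := hx
  obtain ⟨Q, hQ, h⟩ := M.exists_local_extension K hg (refCube_subset_closedRefCube hξ)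
  exact hQ.congr_of_eventuallyEq (h.self_of_nhds hξ).1

/-- Inside the element nothing prevents `Δ g` from blowing up towards the boundary a priori. But
near each point of the closed reference cube it is the Laplacian of a function that is smooth across
the boundary, hence locally bounded, and the closed cube is compact. -/
theorem exists_laplacian_bound
    (hg : ∀ x ∈ refCube d, g (M.map K x) = MvPolynomial.eval (fun j => x j) q) :
    ∃ C, ∀ x ∈ M.elem K, |Δ g x| ≤ C := by
  have key : ∃ C, ∀ ξ ∈ closedRefCube d, ξ ∈ refCube d → |Δ g (M.map K ξ)| ≤ C := by
    refine isCompact_closedRefCube.induction_on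
      (p := fun s => ∃ C, ∀ ξ ∈ s, ξ ∈ refCube d → |Δ g (M.map K ξ)| ≤ C) ⟨0, by simp⟩ ?_ ?_ ?_
    · rintro s t hst ⟨C, hC⟩
      exact ⟨C, fun ξ h => hC ξ (hst h)⟩
    · rintro s t ⟨C, hC⟩ ⟨C', hC'⟩
      refine ⟨max C C', ?_⟩
      rintro ξ (h | h) hr
      · exact (hC ξ h hr).trans (le_max_left _ _)
      · exact (hC' ξ h hr).trans (le_max_right _ _)
    · intro ξ₀ hξ₀
      obtain ⟨Q, hQ, h⟩ := M.exists_local_extension K hg hξ₀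
      have hb : ∀ᶠ ξ in 𝓝 ξ₀, |Δ Q (M.map K ξ)| < |Δ Q (M.map K ξ₀)| + 1 := by
        have h1 : ContinuousAt (fun ξ => |Δ Q (M.map K ξ)|) ξ₀ :=
          ((laplacian_continuousAt hQ).comp
            (M.contDiff_map K (n := 0)).continuous.continuousAt).abs
        exact h1.eventually_lt_const (lt_add_one _)
      refine ⟨_, mem_nhdsWithin_of_mem_nhds (h.and hb), |Δ Q (M.map K ξ₀)| + 1, ?_⟩
      rintro ξ ⟨h1, h2⟩ hr
      rw [(InnerProductSpace.laplacian_congr_nhds (h1 hr).1).self_of_nhds]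
      exact h2.le
  obtain ⟨C, hC⟩ := key
  refine ⟨C, ?_⟩
  rintro _ ⟨ξ, hξ, rfl⟩
  exact hC ξ (refCube_subset_closedRefCube hξ) hξ

end

/-! ### The continuous representative -/

variable {M}

theorem contRep_spec {v : V Ω} (hv : v ∈ feSpace M) : ContinuousOn (contRep v) Ω ∧
    (toL2 v : E d → ℝ) =ᵐ[volume.restrict Ω] contRep v := by
  have h : ∃ g : E d → ℝ, ContinuousOn g Ω ∧ (toL2 v : E d → ℝ) =ᵐ[volume.restrict Ω] g := by
    obtain ⟨g, h1, h2, -⟩ := hv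
    exact ⟨g, h1.mono subset_closure, h2⟩
  unfold contRep
  rw [dif_pos h]
  exact h.choose_spec

/-- Continuous functions that agree almost everywhere on an open set agree there, so the choice in
`contRep` is immaterial on `Ω`. -/
theorem contRep_eqOn {v : V Ω} (hΩ : IsOpen Ω) {g : E d → ℝ} (hg : ContinuousOn g Ω)
    (h : (toL2 v : E d → ℝ) =ᵐ[volume.restrict Ω] g) : EqOn (contRep v) g Ω := by
  have hex : ∃ g : E d → ℝ, ContinuousOn g Ω ∧ (toL2 v : E d → ℝ) =ᵐ[volume.restrict Ω] g :=
    ⟨g, hg, h⟩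
  unfold contRep
  rw [dif_pos hex]
  exact Measure.eqOn_open_of_ae_eq (hex.choose_spec.2.symm.trans h) hΩ hex.choose_spec.1 hg

theorem exists_contRep_poly (hΩ : IsOpen Ω) {v : V Ω} (hv : v ∈ feSpace M) (K : Fin M.card) :
    ∃ q : MvPolynomial (Fin d) ℝ, ∀ x ∈ refCube d,
      contRep v (M.map K x) = MvPolynomial.eval (fun j => x j) q := by
  obtain ⟨g, h1, h2, h3⟩ := hv
  obtain ⟨q, -, hq⟩ := h3 K
  refine ⟨q, fun x hx => ?_⟩
  rw [contRep_eqOn hΩ (h1.mono subset_closure) h2 (M.subset K (mem_image_of_mem _ hx)), hq x hx]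

theorem contDiffAt_contRep (hΩ : IsOpen Ω) {v : V Ω} (hv : v ∈ feSpace M) {K : Fin M.card}
    {x : E d} (hx : x ∈ M.elem K) : ContDiffAt ℝ 2 (contRep v) x := by
  obtain ⟨q, hq⟩ := exists_contRep_poly hΩ hv K
  exact contDiffAt_of_mem_elem hq hx

theorem exists_laplacian_contRep_bound (hΩ : IsOpen Ω) {v : V Ω} (hv : v ∈ feSpace M)
    (K : Fin M.card) : ∃ C, ∀ x ∈ M.elem K, |Δ (contRep v) x| ≤ C := by
  obtain ⟨q, hq⟩ := exists_contRep_poly hΩ hv K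
  exact exists_laplacian_bound hq

theorem coeFn_sum_smul {X ι : Type*} [MeasurableSpace X] {μ : Measure X} (s : Finset ι)
    (a : ι → ℝ) (c : ι → Lp ℝ 2 μ) :
    ∀ᵐ x ∂μ, (∑ k ∈ s, a k • c k : Lp ℝ 2 μ) x = ∑ k ∈ s, a k * c k x := by
  classical
  induction s using Finset.induction_on with
  | empty =>
    rw [Finset.sum_empty]
    filter_upwards [Lp.coeFn_zero ℝ 2 μ] with x hx
    simpa using hx
  | insert i s hi ih =>
    rw [Finset.sum_insert hi]
    filter_upwards [ih, Lp.coeFn_add (a i • c i) (∑ k ∈ s, a k • c k),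
      Lp.coeFn_smul (a i) (c i)] with x h1 h2 h3
    rw [h2, Pi.add_apply, h1, h3, Finset.sum_insert hi, Pi.smul_apply, smul_eq_mul]

theorem toL2_sum_ae {ι : Type*} (s : Finset ι) (a : ι → ℝ) (c : ι → V Ω) :
    ∀ᵐ x ∂(volume.restrict Ω), toL2 (∑ k ∈ s, a k • c k) x = ∑ k ∈ s, a k * toL2 (c k) x := by
  simp only [map_sum, map_smul]
  exact coeFn_sum_smul s a fun k => toL2 (c k)

/-- The choice `contRep` is linear on `Ω` by uniqueness of the continuous representative, and the
Laplacian at a point of the open set `Ω` depends only on values nearby. -/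
theorem laplacian_contRep_sum (hΩ : IsOpen Ω) {ι : Type*} (s : Finset ι) (a : ι → ℝ) {c : ι → V Ω}
    (hc : ∀ k, c k ∈ feSpace M) {K : Fin M.card} {x : E d} (hx : x ∈ M.elem K) :
    Δ (contRep (∑ k ∈ s, a k • c k)) x = ∑ k ∈ s, a k * Δ (contRep (c k)) x := by
  have h1 : EqOn (contRep (∑ k ∈ s, a k • c k)) (fun y => ∑ k ∈ s, a k * contRep (c k) y) Ω := by
    refine contRep_eqOn hΩ (continuousOn_finsetSum _ fun k _ =>
      continuousOn_const.mul (contRep_spec (hc k)).1) ?_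
    have := (s.eventually_all (p := fun k x => toL2 (c k) x = contRep (c k) x)
      (l := ae (volume.restrict Ω))).2 fun k _ => (contRep_spec (hc k)).2
    filter_upwards [toL2_sum_ae s a c, this] with x h1 h2
    rw [h1]
    exact Finset.sum_congr rfl fun k hk => by rw [h2 k hk]
  rw [← laplacian_sum s a fun k _ => contDiffAt_contRep hΩ (hc k) hx]
  refine (InnerProductSpace.laplacian_congr_nhds ?_).self_of_nhds
  exact h1.eventuallyEq_of_mem (hΩ.mem_nhds (M.subset K hx))

theorem feSpace_add {v v' : V Ω} (h : v ∈ feSpace M) (h' : v' ∈ feSpace M) :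
    v + v' ∈ feSpace M := by
  obtain ⟨g, h1, h2, h3⟩ := h
  obtain ⟨g', h1', h2', h3'⟩ := h'
  refine ⟨g + g', h1.add h1', ?_, fun K => ?_⟩
  · rw [map_add]
    exact (Lp.coeFn_add _ _).trans (h2.add h2')
  · obtain ⟨q, hq, e⟩ := h3 K
    obtain ⟨q', hq', e'⟩ := h3' K
    exact ⟨q + q', add_mem hq hq', fun x hx => by simp [e x hx, e' x hx]⟩

theorem feSpace_smul (a : ℝ) {v : V Ω} (h : v ∈ feSpace M) : a • v ∈ feSpace M := by
  obtain ⟨g, h1, h2, h3⟩ := h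
  refine ⟨a • g, h1.const_smul a, ?_, fun K => ?_⟩
  · rw [map_smul]
    exact (Lp.coeFn_smul _ _).trans (h2.const_smul a)
  · obtain ⟨q, hq, e⟩ := h3 K
    exact ⟨a • q, Submodule.smul_mem _ a hq, fun x hx => by simp [e x hx]⟩

end

/-! ## Linearity of the stabilization in the test function -/

section
variable {X : Type*}

theorem norm_indicator_one_le (s : Set X) (x : X) : ‖s.indicator (fun _ => (1 : ℝ)) x‖ ≤ 1 :=
  (norm_indicator_le_norm_self _ _).trans (by simp)

variable [MeasurableSpace X] {μ : Measure X} {s : Set X}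

/-- Multiplication of an element of `L²` by the characteristic function of a set. -/
def cutoff (μ : Measure X) (hs : MeasurableSet s) : Lp ℝ 2 μ →L[ℝ] Lp ℝ 2 μ :=
  mulOp μ (s.indicator fun _ => (1 : ℝ)) (stronglyMeasurable_const.indicator hs) 1
    (norm_indicator_one_le s)

theorem inner_cutoff (hs : MeasurableSet s) (y q : Lp ℝ 2 μ) :
    inner ℝ (cutoff μ hs y) q = ∫ x in s, y x * q x ∂μ := by
  rw [L2.inner_def, ← integral_indicator hs]
  refine integral_congr_ae ?_
  filter_upwards [mulOp_ae (F := ℝ) (stronglyMeasurable_const.indicator hs)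
    (norm_indicator_one_le s) y] with x hx
  rw [cutoff, hx]
  by_cases h : x ∈ s <;> simp [h, mul_comm]

end

/-! ### The stabilization as integrals of linear functionals of the test function -/

section
variable {d : ℕ} {Ω : Set (E d)} {T : ℝ} (D : Data Ω T) {p : ℕ}

theorem Mesh.elem_subset (M : Mesh Ω p) (K : Fin M.card) : M.elem K ⊆ Ω := M.subset K

/-- The functional `v ↦ ∑_K δ_K (y_K, b(t)·∇v)_K`. -/
def Data.supg (M : Mesh Ω p) (δ : Fin M.card → ℝ) (t : ℝ) (y : Fin M.card → L2 Ω) :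
    V Ω →ₗ[ℝ] ℝ :=
  ∑ K, δ K • ((innerSL ℝ (cutoff (volume.restrict Ω) (M.isOpen_elem K).measurableSet (y K))).comp
    ((D.mulB t).comp grad)).toLinearMap

theorem Data.supg_apply (M : Mesh Ω p) (δ : Fin M.card → ℝ) (t : ℝ) (y : Fin M.card → L2 Ω)
    (v : V Ω) : D.supg M δ t y v = ∑ K, δ K * inner ℝ
      (cutoff (volume.restrict Ω) (M.isOpen_elem K).measurableSet (y K)) (D.mulB t (grad v)) := by
  simp [Data.supg, LinearMap.sum_apply]

/-- The residual exists only as a pointwise expression on each element. Replacing it by an element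
of `L²(Ω)` with the same values there exhibits linearity in `v` and gives access to the
integrability results in time. -/
theorem Data.sum_integral_elem_eq_supg (hΩ : MeasurableSet Ω) (M : Mesh Ω p)
    (δ : Fin M.card → ℝ) {t : ℝ} (ht : t ∈ Icc (0 : ℝ) T) {y : Fin M.card → L2 Ω}
    {q : Fin M.card → E d → ℝ}
    (hq : ∀ K, ∀ᵐ x ∂(volume.restrict (M.elem K)), q K x = y K x) (v : V Ω) :
    ∑ K, δ K * ∫ x in M.elem K, q K x * inner ℝ (D.b t x) (grad v x) = D.supg M δ t y v := by
  rw [D.supg_apply]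
  refine Finset.sum_congr rfl fun K _ => ?_
  rw [inner_cutoff, Measure.restrict_restrict_of_subset (M.elem_subset K)]
  congr 1
  refine integral_congr_ae ?_
  filter_upwards [hq K, ae_restrict_of_ae_restrict_of_subset (M.elem_subset K)
    (D.mulB_ae hΩ ht (grad v))] with x h1 h2
  rw [h1, h2]

theorem Data.integrable_supg (M : Mesh Ω p) (δ : Fin M.card → ℝ) {s : Set ℝ}
    {y : ℝ → Fin M.card → L2 Ω} (hy : ∀ K, MemLp (fun t => y t K) 2 (volume.restrict s))
    {φ : ℝ → V Ω} (hφ : MemLp φ 2 (volume.restrict s)) :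
    IntegrableOn (fun t => D.supg M δ t (y t) (φ t)) s := by
  simp only [D.supg_apply]
  refine integrable_finsetSum _ fun K _ => Integrable.const_mul ?_ _
  exact integrable_inner_of_memLp ((cutoff _ (M.isOpen_elem K).measurableSet).comp_memLp' (hy K))
    (D.memLp_mulB ((grad (Ω := Ω)).comp_memLp' hφ))

/-- The Laplacian of a finite element function on an element, extended by zero, is in `L²(Ω)`. -/
theorem exists_laplacian_L2 (hΩ : IsOpen Ω) (hb : Bornology.IsBounded Ω) {M : Mesh Ω p} {v : V Ω}
    (hv : v ∈ feSpace M) (K : Fin M.card) :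
    ∃ y : L2 Ω, ∀ᵐ x ∂(volume.restrict (M.elem K)), y x = Δ (contRep v) x := by
  obtain ⟨C, hC⟩ := exists_laplacian_contRep_bound hΩ hv K
  have hm := (M.isOpen_elem K).measurableSet
  have hfin : IsFiniteMeasure (volume.restrict (M.elem K)) :=
    isFiniteMeasure_restrict.2 (hb.subset (M.elem_subset K)).measure_lt_top.ne
  have h1 : MemLp (Δ (contRep v)) 2 (volume.restrict (M.elem K)) := by
    refine MemLp.of_bound (ContinuousOn.aestronglyMeasurable (fun x hx => ?_) hm) C ?_
    · exact (laplacian_continuousAt (contDiffAt_contRep hΩ hv hx)).continuousWithinAt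
    · filter_upwards [ae_restrict_mem hm] with x hx using hC x hx
  rw [← Measure.restrict_restrict_of_subset (M.elem_subset K), ← memLp_indicator_iff_restrict hm] at h1
  refine ⟨h1.toLp _, ?_⟩
  filter_upwards [ae_restrict_of_ae_restrict_of_subset (M.elem_subset K) h1.coeFn_toLp,
    ae_restrict_mem hm] with x e1 e2
  rw [e1, indicator_of_mem e2]

variable {P : TimePartition T} {r : ℕ} {w w' φ φ' : W Ω T} {n : ℕ}

theorem hasDerivAt_val_of_poly {c : Fin (r + 1) → V Ω}
    (h : ∀ t ∈ P.slab n, val w t = toL2 (∑ k : Fin (r + 1), t ^ (k : ℕ) • c k)) {t : ℝ}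
    (ht : t ∈ Ioo (P.t n) (P.t (n + 1))) :
    HasDerivAt (val w) (∑ k : Fin (r + 1), ((k : ℕ) * t ^ ((k : ℕ) - 1)) • toL2 (c k)) t := by
  have h1 : HasDerivAt (fun s : ℝ => ∑ k : Fin (r + 1), s ^ (k : ℕ) • toL2 (c k))
      (∑ k : Fin (r + 1), ((k : ℕ) * t ^ ((k : ℕ) - 1)) • toL2 (c k)) t :=
    HasDerivAt.fun_sum fun k _ => (hasDerivAt_pow (k : ℕ) t).smul_const _
  refine h1.congr_of_eventuallyEq ?_
  filter_upwards [Ioo_mem_nhds ht.1 ht.2] with s hs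
  rw [h s ⟨hs.1, hs.2.le⟩]
  simp only [map_sum, map_smul]

/-- The element residuals of a fully discrete function are square integrable. -/
theorem Data.exists_res_L2 (hΩ : IsOpen Ω) (hb : Bornology.IsBounded Ω)
    (g : Lp (L2 Ω) 2 (volume.restrict (Ioc 0 T))) {M : Mesh Ω p} (hn : n < P.N)
    (hw : IsPolyOnSlab P r (feSpace M) w n) :
    ∃ y : ℝ → Fin M.card → L2 Ω,
      (∀ K, MemLp (fun t => y t K) 2 (volume.restrict (P.slab n))) ∧
      ∀ᵐ t ∂(volume.restrict (P.slab n)), ∀ K, ∀ᵐ x ∂(volume.restrict (M.elem K)),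
        D.res g w t x = y t K x := by
  obtain ⟨c, hc, h1, h2⟩ := hw
  choose L hL using fun k => exists_laplacian_L2 hΩ hb (hc k)
  have hsub := P.slab_subset hn
  have hmono : volume.restrict (P.slab n) ≤ volume.restrict (Ioc 0 T) :=
    Measure.restrict_mono_set _ hsub
  -- The residual term by term as an `L²(Ω)`-valued function of time; `L k K` stands for the
  -- elementwise Laplacian of the coefficient `c k`.
  refine ⟨fun t K => (∑ k : Fin (r + 1), ((k : ℕ) * t ^ ((k : ℕ) - 1)) • toL2 (c k))
    - D.ε • (∑ k : Fin (r + 1), t ^ (k : ℕ) • L k K) + D.mulB t (grad (valV w t))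
    + D.mulα t (toL2 (valV w t)) - g t, fun K => ?_, ?_⟩
  · have m1 : MemLp (fun t : ℝ => ∑ k : Fin (r + 1), ((k : ℕ) * t ^ ((k : ℕ) - 1)) • toL2 (c k)) 2
        (volume.restrict (Ioc 0 T)) :=
      memLp_finsetSum _ fun k _ => (BddMeasurable.of_continuous
        (θ := fun t : ℝ => (k : ℕ) * t ^ ((k : ℕ) - 1)) (by fun_prop)).memLp _
    have m2 : MemLp (fun t : ℝ => ∑ k : Fin (r + 1), t ^ (k : ℕ) • L k K) 2
        (volume.restrict (Ioc 0 T)) :=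
      memLp_finsetSum _ fun k _ => (BddMeasurable.pow T k).memLp _
    have m3 := D.memLp_mulB ((grad (Ω := Ω)).comp_memLp' (memLp_valV w))
    have m4 := D.memLp_mulα ((toL2 (Ω := Ω)).comp_memLp' (memLp_valV w))
    exact ((((m1.sub (m2.const_smul D.ε)).add m3).add m4).sub (Lp.memLp g)).mono_measure hmono
  -- The classical time derivative in `res` is under control only inside the slab: at its right end
  -- `w` may jump. That end is a null set.
  · have hIoo : ∀ᵐ t ∂(volume.restrict (P.slab n)), t ∈ Ioo (P.t n) (P.t (n + 1)) := by
      rw [TimePartition.slab, ← restrict_Ioo_eq_restrict_Ioc]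
      exact ae_restrict_mem measurableSet_Ioo
    filter_upwards [h2, hIoo] with t h2 ht K
    have ht' : t ∈ Icc (0 : ℝ) T := Ioc_subset_Icc_self (hsub ⟨ht.1, ht.2.le⟩)
    have hres {q : E d → Prop} (h : ∀ᵐ x ∂(volume.restrict Ω), q x) :
        ∀ᵐ x ∂(volume.restrict (M.elem K)), q x :=
      ae_restrict_of_ae_restrict_of_subset (M.elem_subset K) h
    set Y1 : L2 Ω := ∑ k : Fin (r + 1), ((k : ℕ) * t ^ ((k : ℕ) - 1)) • toL2 (c k) with hY1
    set Y2 : L2 Ω := ∑ k : Fin (r + 1), t ^ (k : ℕ) • L k K with hY2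
    set Y3 : L2 Ω := D.mulB t (grad (valV w t)) with hY3
    set Y4 : L2 Ω := D.mulα t (toL2 (valV w t)) with hY4
    have hLK : ∀ᵐ x ∂(volume.restrict (M.elem K)), ∀ k, L k K x = Δ (contRep (c k)) x :=
      ae_all_iff.2 fun k => hL k K
    filter_upwards [hres (Lp.coeFn_sub (Y1 - D.ε • Y2 + Y3 + Y4) (g t)),
      hres (Lp.coeFn_add (Y1 - D.ε • Y2 + Y3) Y4), hres (Lp.coeFn_add (Y1 - D.ε • Y2) Y3),
      hres (Lp.coeFn_sub Y1 (D.ε • Y2)), hres (Lp.coeFn_smul D.ε Y2),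
      hres (D.mulB_ae hΩ.measurableSet ht' (grad (valV w t))),
      hres (D.mulα_ae hΩ.measurableSet ht' (toL2 (valV w t))),
      hres (coeFn_sum_smul Finset.univ (fun k : Fin (r + 1) => t ^ (k : ℕ)) fun k => L k K), hLK,
      ae_restrict_mem (M.isOpen_elem K).measurableSet] with x e1 e2 e3 e4 e5 e6 e7 e8 e9 hx
    rw [e1, Pi.sub_apply, e2, Pi.add_apply, e3, Pi.add_apply, e4, Pi.sub_apply, e5,
      Pi.smul_apply, smul_eq_mul, hY3, e6, hY4, e7, hY2, e8, Data.res,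
      (hasDerivAt_val_of_poly h1 ht).deriv]
    congr 6
    rw [h2, laplacian_contRep_sum hΩ _ _ hc hx]
    exact Finset.sum_congr rfl fun k _ => by rw [e9 k]

/-! ### Right limits in `V` -/

/-- Right neighbourhoods have positive measure, so they meet every set of full measure. Limits along
this filter are therefore unique, and `limRV` computes them. -/
theorem neBot_nhdsGT_inf_ae (s : ℝ) : (𝓝[>] s ⊓ ae volume).NeBot := by
  refine Filter.inf_neBot_iff.2 fun A hA B hB => ?_
  obtain ⟨v, hv, hvA⟩ := mem_nhdsGT_iff_exists_Ioo_subset.1 hA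
  by_contra hne
  have : Ioo s v ⊆ Bᶜ := fun x hx hxB => hne ⟨x, hvA hx, hxB⟩
  have h0 := measure_mono_null this (mem_ae_iff.1 hB)
  rw [Real.volume_Ioo, ENNReal.ofReal_eq_zero] at h0
  have := mem_Ioi.1 hv
  linarith

theorem limRV_of_poly {c : Fin (r + 1) → V Ω} (hn : n < P.N)
    (h : ∀ᵐ t ∂(volume.restrict (P.slab n)), valV w t = ∑ k : Fin (r + 1), t ^ (k : ℕ) • c k) :
    limRV w (P.t n) = ∑ k : Fin (r + 1), P.t n ^ (k : ℕ) • c k := by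
  have := neBot_nhdsGT_inf_ae (P.t n)
  refine Tendsto.limUnder_eq ?_
  have hc : Continuous fun t : ℝ => ∑ k : Fin (r + 1), t ^ (k : ℕ) • c k :=
    continuous_finsetSum _ fun k _ => (continuous_id.pow _).smul continuous_const
  refine ((hc.tendsto (P.t n)).mono_left (inf_le_left.trans nhdsWithin_le_nhds)).congr' ?_
  have h1 : ∀ᶠ t in 𝓝[>] P.t n ⊓ ae volume, t ∈ P.slab n :=
    mem_inf_of_left (Ioc_mem_nhdsGT (P.lt_succ n hn))
  have h2 : ∀ᶠ t in 𝓝[>] P.t n ⊓ ae volume, t ∈ P.slab n →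
      valV w t = ∑ k : Fin (r + 1), t ^ (k : ℕ) • c k :=
    mem_inf_of_right ((ae_restrict_iff' (P.measurableSet_slab n)).1 h)
  filter_upwards [h1, h2] with t e1 e2 using (e2 e1).symm

theorem limRV_add (h : φ ∈ dGSpace Ω P r) (h' : φ' ∈ dGSpace Ω P r) (hn : n < P.N) :
    limRV (φ + φ') (P.t n) = limRV φ (P.t n) + limRV φ' (P.t n) := by
  obtain ⟨c, _, -, hc⟩ := h n hn
  obtain ⟨c', _, -, hc'⟩ := h' n hn
  rw [limRV_of_poly hn hc, limRV_of_poly hn hc', ← Finset.sum_add_distrib]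
  rw [limRV_of_poly (c := fun k => c k + c' k) hn]
  · simp only [smul_add]
  · filter_upwards [hc, hc', P.ae_slab hn (valV_add_ae φ φ')] with t e1 e2 e3
    rw [e3, e1, e2, ← Finset.sum_add_distrib]
    simp only [smul_add]

theorem limRV_smul (a : ℝ) (h : φ ∈ dGSpace Ω P r) (hn : n < P.N) :
    limRV (a • φ) (P.t n) = a • limRV φ (P.t n) := by
  obtain ⟨c, _, -, hc⟩ := h n hn
  rw [limRV_of_poly hn hc, Finset.smul_sum, limRV_of_poly (c := fun k => a • c k) hn]
  · simp only [smul_comm a]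
  · filter_upwards [hc, P.ae_slab hn (valV_smul_ae a φ)] with t e1 e3
    rw [e3, e1, Finset.smul_sum]
    simp only [smul_comm a]

/-! ### The stabilization -/

variable {M : ℕ → Mesh Ω p}

theorem fullSpace_subset_dGSpace : fullSpace P r M ⊆ dGSpace Ω P r := by
  rintro w ⟨h, -⟩ n hn
  obtain ⟨c, _, h1, h2⟩ := h n hn
  exact ⟨c, fun _ => mem_univ _, h1, h2⟩

theorem fullSpace_add (h : w ∈ fullSpace P r M) (h' : w' ∈ fullSpace P r M) :
    w + w' ∈ fullSpace P r M := by
  obtain ⟨h1, v, hv, e⟩ := h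
  obtain ⟨h1', v', hv', e'⟩ := h'
  refine ⟨fun n hn => (h1 n hn).add (fun _ hx _ hy => feSpace_add hx hy) (h1' n hn) hn,
    v + v', feSpace_add hv hv', ?_⟩
  rw [val_add, e, e', map_add]

theorem fullSpace_smul (a : ℝ) (h : w ∈ fullSpace P r M) : a • w ∈ fullSpace P r M := by
  obtain ⟨h1, v, hv, e⟩ := h
  refine ⟨fun n hn => (h1 n hn).smul (fun a _ hx => feSpace_smul a hx) a hn,
    a • v, feSpace_smul a hv, ?_⟩
  rw [val_smul, e, map_smul]

theorem fullSpace_sub (h : w ∈ fullSpace P r M) (h' : w' ∈ fullSpace P r M) :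
    w - w' ∈ fullSpace P r M := by
  have := fullSpace_add h (fullSpace_smul (-1) h')
  rwa [neg_one_smul, ← sub_eq_add_neg] at this

variable {δ : (n : ℕ) → Fin (M n).card → ℝ} {g : Lp (L2 Ω) 2 (volume.restrict (Ioc 0 T))}

/-- Linearity of the stabilization in the test function is read off from this form: for fixed `w`,
only linear functionals of `φ(t)` and of the right limits in `V` occur, and the integrands are
integrable because the element residuals are square integrable. -/
theorem Data.exists_S_eq (hΩ : IsOpen Ω) (hb : Bornology.IsBounded Ω) (hw : w ∈ fullSpace P r M) :
    ∃ (ℓ : ℕ → ℝ → V Ω →ₗ[ℝ] ℝ) (m : ℕ → V Ω →ₗ[ℝ] ℝ),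
      (∀ n < P.N, ∀ φ : W Ω T, IntegrableOn (fun t => ℓ n t (valV φ t)) (P.slab n)) ∧
      ∀ φ : W Ω T, D.S P M δ g w φ = (∑ n ∈ Finset.range P.N, ∫ t in P.slab n, ℓ n t (valV φ t))
        + ∑ n ∈ Finset.range P.N, m n (limRV φ (P.t n)) := by
  have hex : ∀ n, ∃ y : ℝ → Fin (M n).card → L2 Ω, n < P.N →
      (∀ K, MemLp (fun t => y t K) 2 (volume.restrict (P.slab n))) ∧
      ∀ᵐ t ∂(volume.restrict (P.slab n)), ∀ K, ∀ᵐ x ∂(volume.restrict ((M n).elem K)),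
        D.res g w t x = y t K x := fun n => by
    by_cases hn : n < P.N
    · obtain ⟨y, hy⟩ := D.exists_res_L2 hΩ hb g hn (hw.1 n hn)
      exact ⟨y, fun _ => hy⟩
    · exact ⟨0, fun h => absurd h hn⟩
  choose y hy using hex
  -- The initial term is treated as the node term of slab `0`, with `u(0⁺) - u₀` in the role of the
  -- jump.
  refine ⟨fun n t => D.supg (M n) (δ n) t (y n t), fun n => D.supg (M n) (δ n) (P.t n)
    fun _ => if n = 0 then limR w 0 - D.u₀ else jump w (P.t n), fun n hn φ => ?_, fun φ => ?_⟩
  · exact D.integrable_supg _ _ (hy n hn).1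
      ((memLp_valV φ).mono_measure (Measure.restrict_mono_set _ (P.slab_subset hn)))
  · have hm := hΩ.measurableSet
    rw [Finset.sum_range_eq_add_Ico (fun n => D.supg (M n) (δ n) (P.t n)
      (fun _ => if n = 0 then limR w 0 - D.u₀ else jump w (P.t n)) (limRV φ (P.t n)))
      (Nat.lt_of_lt_of_le Nat.zero_lt_one P.one_le_N), Data.S, add_assoc]
    congr 1
    · refine Finset.sum_congr rfl fun n hn => ?_
      have hn := Finset.mem_range.1 hn
      refine integral_congr_ae ?_
      filter_upwards [(hy n hn).2, ae_restrict_mem (P.measurableSet_slab n)] with t h1 h2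
      exact D.sum_integral_elem_eq_supg hm (M n) (δ n)
        (Ioc_subset_Icc_self (P.slab_subset hn h2)) h1 _
    · rw [add_comm]
      congr 1
      · rw [if_pos rfl, P.t_zero]
        refine D.sum_integral_elem_eq_supg hm (M 0) (δ 0) ?_
          (fun K => Eventually.of_forall fun x => rfl) _
        have := P.t_le (Nat.zero_le P.N)
        rw [P.t_zero] at this
        exact ⟨le_rfl, this⟩
      · refine Finset.sum_congr rfl fun n hn => ?_
        obtain ⟨h1, h2⟩ := Finset.mem_Ico.1 hn
        rw [if_neg (by omega)]
        exact D.sum_integral_elem_eq_supg hm (M n) (δ n) ⟨P.t_nonneg h2.le, P.t_le h2.le⟩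
          (fun K => Eventually.of_forall fun x => rfl) _

theorem Data.S_add_right (hΩ : IsOpen Ω) (hb : Bornology.IsBounded Ω)
    (hw : w ∈ fullSpace P r M) (h : φ ∈ dGSpace Ω P r) (h' : φ' ∈ dGSpace Ω P r) :
    D.S P M δ g w (φ + φ') = D.S P M δ g w φ + D.S P M δ g w φ' := by
  obtain ⟨ℓ, m, h1, h2⟩ := D.exists_S_eq (δ := δ) (g := g) hΩ hb hw
  rw [h2, h2, h2, add_add_add_comm]
  refine congrArg₂ (· + ·) (Eq.trans ?_ Finset.sum_add_distrib)
    (Eq.trans ?_ Finset.sum_add_distrib)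
  · refine Finset.sum_congr rfl fun n hn => ?_
    have hn := Finset.mem_range.1 hn
    rw [← integral_add (h1 n hn φ) (h1 n hn φ')]
    refine integral_congr_ae ?_
    filter_upwards [P.ae_slab hn (valV_add_ae φ φ')] with t e
    rw [e, map_add]
  · refine Finset.sum_congr rfl fun n hn => ?_
    rw [limRV_add h h' (Finset.mem_range.1 hn), map_add]

theorem Data.S_smul_right (hΩ : IsOpen Ω) (hb : Bornology.IsBounded Ω)
    (hw : w ∈ fullSpace P r M) (a : ℝ) (h : φ ∈ dGSpace Ω P r) :
    D.S P M δ g w (a • φ) = a * D.S P M δ g w φ := by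
  obtain ⟨ℓ, m, h1, h2⟩ := D.exists_S_eq (δ := δ) (g := g) hΩ hb hw
  rw [h2, h2, mul_add, Finset.mul_sum, Finset.mul_sum]
  congr 1
  · refine Finset.sum_congr rfl fun n hn => ?_
    have hn := Finset.mem_range.1 hn
    rw [← integral_const_mul]
    refine integral_congr_ae ?_
    filter_upwards [P.ae_slab hn (valV_smul_ae a φ)] with t e
    rw [e, map_smul, smul_eq_mul]
  · refine Finset.sum_congr rfl fun n hn => ?_
    rw [limRV_smul a h (Finset.mem_range.1 hn), map_smul, smul_eq_mul]

end

/-! ## Directional derivatives of the Lagrangians -/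

section
variable {d : ℕ} {Ω : Set (E d)} {T : ℝ} (D : Data Ω T) {P : TimePartition T} {r : ℕ}
  {J : W Ω T → ℝ} {x y φ ψ : W Ω T}

theorem Data.Aτ_sub_left (hΩ : MeasurableSet Ω) (hx : x ∈ slabRegular Ω P)
    (hy : y ∈ slabRegular Ω P) (φ : W Ω T) :
    D.Aτ P (x - y) φ = D.Aτ P x φ - D.Aτ P y φ := by
  rw [sub_eq_add_neg, ← neg_one_smul ℝ y, D.Aτ_add_left hΩ hx ((slabRegular Ω P).smul_mem _ hy),
    D.Aτ_smul_left hΩ _ hy]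
  ring

theorem Data.Aτ_sub_right (hΩ : MeasurableSet Ω) (u : W Ω T) (hx : x ∈ slabRegular Ω P)
    (hy : y ∈ slabRegular Ω P) : D.Aτ P u (x - y) = D.Aτ P u x - D.Aτ P u y := by
  rw [sub_eq_add_neg, ← neg_one_smul ℝ y, D.Aτ_add_right hΩ u hx ((slabRegular Ω P).smul_mem _ hy),
    D.Aτ_smul_right hΩ _ u hy]
  ring

theorem Data.Fτ_sub (hx : x ∈ slabRegular Ω P) (hy : y ∈ slabRegular Ω P) :
    D.Fτ (x - y) = D.Fτ x - D.Fτ y := by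
  rw [sub_eq_add_neg, ← neg_one_smul ℝ y, D.Fτ_add hx ((slabRegular Ω P).smul_mem _ hy),
    D.Fτ_smul _ hy]
  ring

theorem Data.ρ_sub (hΩ : MeasurableSet Ω) (u : W Ω T) (hx : x ∈ slabRegular Ω P)
    (hy : y ∈ slabRegular Ω P) : D.ρ P u (x - y) = D.ρ P u x - D.ρ P u y := by
  rw [Data.ρ, D.Fτ_sub hx hy, D.Aτ_sub_right hΩ u hx hy, Data.ρ, Data.ρ]
  ring

theorem hasDerivAt_affine (a b : ℝ) : HasDerivAt (fun t : ℝ => a + t * b) b 0 := by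
  simpa using ((hasDerivAt_id (0 : ℝ)).mul_const b).const_add a

theorem Data.hasLineDerivAt_Aτ_left (hΩ : MeasurableSet Ω) (hx : x ∈ slabRegular Ω P)
    (hφ : φ ∈ slabRegular Ω P) (y : W Ω T) :
    HasLineDerivAt ℝ (fun w => D.Aτ P w y) (D.Aτ P φ y) x φ := by
  have : (fun t : ℝ => D.Aτ P (x + t • φ) y) = fun t => D.Aτ P x y + t * D.Aτ P φ y := by
    funext t
    rw [D.Aτ_add_left hΩ hx ((slabRegular Ω P).smul_mem _ hφ), D.Aτ_smul_left hΩ _ hφ]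
  rw [HasLineDerivAt, this]
  exact hasDerivAt_affine _ _

theorem Data.hasLineDerivAt_ρ (hΩ : MeasurableSet Ω) (u : W Ω T) (hx : x ∈ slabRegular Ω P)
    (hφ : φ ∈ slabRegular Ω P) :
    HasLineDerivAt ℝ (D.ρ P u) (D.ρ P u φ) x φ := by
  have : (fun t : ℝ => D.ρ P u (x + t • φ)) = fun t => D.ρ P u x + t * D.ρ P u φ := by
    funext t
    have hs := (slabRegular Ω P).smul_mem t hφ
    rw [Data.ρ, D.Fτ_add hx hs, D.Fτ_smul _ hφ, D.Aτ_add_right hΩ u hx hs,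
      D.Aτ_smul_right hΩ _ u hφ, Data.ρ, Data.ρ]
    ring
  rw [HasLineDerivAt, this]
  exact hasDerivAt_affine _ _

theorem Data.ρstar_eq (hΩ : MeasurableSet Ω) (hx : x ∈ slabRegular Ω P)
    (hφ : φ ∈ slabRegular Ω P) (y : W Ω T) :
    D.ρstar P J x y φ = fderiv ℝ J x φ - D.Aτ P φ y := by
  rw [Data.ρstar, (D.hasLineDerivAt_Aτ_left hΩ hx hφ y).lineDeriv]

/-- The residuals are the partial derivatives of the semidiscrete Lagrangian. -/
theorem Data.hasLineDerivAt_lagrτ_snd (hΩ : MeasurableSet Ω) (u : W Ω T)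
    (hx : x ∈ slabRegular Ω P) (hφ : φ ∈ slabRegular Ω P) :
    HasLineDerivAt ℝ (fun y => D.lagrτ P J (u, y)) (D.ρ P u φ) x φ := by
  have := (D.hasLineDerivAt_ρ hΩ u hx hφ)
  simp only [HasLineDerivAt, Data.lagrτ, add_sub_assoc] at this ⊢
  exact this.const_add (J u)

theorem Data.hasLineDerivAt_lagrτ_fst (hΩ : MeasurableSet Ω) (hJ : DifferentiableAt ℝ J x)
    (hx : x ∈ slabRegular Ω P) (hφ : φ ∈ slabRegular Ω P) (y : W Ω T) :
    HasLineDerivAt ℝ (fun w => D.lagrτ P J (w, y)) (D.ρstar P J x y φ) x φ := by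
  rw [D.ρstar_eq hΩ hx hφ]
  have h1 := hJ.hasFDerivAt.hasLineDerivAt φ
  have h2 := D.hasLineDerivAt_Aτ_left hΩ hx hφ y
  simp only [HasLineDerivAt, Data.lagrτ] at h1 h2 ⊢
  exact (h1.add_const _).sub h2

/-- A line that moves only the second argument gives a partial directional derivative. -/
theorem hasLineDerivAt_snd_of_prod {L : W Ω T × W Ω T → ℝ} {l : ℝ}
    (h : HasLineDerivAt ℝ L l (x, y) (0, ψ)) : HasLineDerivAt ℝ (fun w => L (x, w)) l y ψ := by
  simpa [HasLineDerivAt] using h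

theorem hasLineDerivAt_fst_of_prod {L : W Ω T × W Ω T → ℝ} {l : ℝ}
    (h : HasLineDerivAt ℝ L l (x, y) (φ, 0)) : HasLineDerivAt ℝ (fun w => L (w, y)) l x φ := by
  simpa [HasLineDerivAt] using h

/-- At a stationary point, both residuals vanish. -/
theorem Data.residuals_of_stationary (hΩ : MeasurableSet Ω) (hJ : Differentiable ℝ J)
    {X : Set (W Ω T)} (hX : X ⊆ slabRegular Ω P) (h0 : 0 ∈ X)
    (h : StationaryOn (D.lagrτ P J) X (x, y)) :
    (∀ φ ∈ X, D.ρ P x φ = 0) ∧ ∀ φ ∈ X, fderiv ℝ J x φ = D.Aτ P φ y := by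
  obtain ⟨hx, hy, h⟩ := h
  refine ⟨fun φ hφ => ?_, fun φ hφ => ?_⟩
  · exact (D.hasLineDerivAt_lagrτ_snd hΩ x (hX hy) (hX hφ)).unique
      (hasLineDerivAt_snd_of_prod (h 0 h0 φ hφ))
  · have := (D.hasLineDerivAt_lagrτ_fst hΩ (hJ x) (hX hx) (hX hφ) y).unique
      (hasLineDerivAt_fst_of_prod (h φ hφ 0 h0))
    rw [D.ρstar_eq hΩ (hX hx) (hX hφ)] at this
    linarith

/-- On the energy space, the continuous and the semidiscrete Lagrangian have the same stationary
points. -/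
theorem Data.stationaryOn_lagrτ_energySpace (hΩ : MeasurableSet Ω) (hT : 0 < T)
    (h : StationaryOn (D.lagr J) (energySpace Ω T) (x, y)) :
    StationaryOn (D.lagrτ P J) (energySpace Ω T) (x, y) := by
  obtain ⟨hx, hy, h⟩ := h
  refine ⟨hx, hy, fun φ hφ ψ hψ => ?_⟩
  -- The whole line stays in the energy space in both components, where the two Lagrangians
  -- coincide.
  have key : (fun t : ℝ => D.lagrτ P J ((x, y) + t • (φ, ψ)))
      = fun t => D.lagr J ((x, y) + t • (φ, ψ)) := by
    funext t
    have h1 : x + t • φ ∈ energySpace Ω T := energySpace_add hx (energySpace_smul t hφ)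
    have h2 : y + t • ψ ∈ energySpace Ω T := energySpace_add hy (energySpace_smul t hψ)
    simp only [Data.lagrτ, Data.lagr, Prod.smul_mk, Prod.mk_add_mk]
    rw [D.Aτ_eq_A hΩ hT h1 h2, D.Fτ_eq_F hT h2]
  have := h φ hφ ψ hψ
  unfold HasLineDerivAt at this ⊢
  rwa [key]

theorem fullSpace_zero_mem {p : ℕ} {M : ℕ → Mesh Ω p} (h : x ∈ fullSpace P r M) :
    (0 : W Ω T) ∈ fullSpace P r M := by
  simpa using fullSpace_smul 0 h

/-- At a stationary point of the fully discrete Lagrangian, the stabilization equals the primal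
residual, and its derivative equals the adjoint residual. -/
theorem Data.stabilization_of_stationary (hΩ : IsOpen Ω) (hb : Bornology.IsBounded Ω) (hT : 0 < T)
    (hJ : Differentiable ℝ J) {p : ℕ} {M : ℕ → Mesh Ω p} {δ : (n : ℕ) → Fin (M n).card → ℝ}
    {g : Lp (L2 Ω) 2 (volume.restrict (Ioc 0 T))}
    (h : StationaryOn (D.lagrτh P M δ g J) (fullSpace P r M) (x, y)) :
    (∀ φ ∈ fullSpace P r M, D.S P M δ g x φ = D.ρ P x φ) ∧ ∀ φ ∈ fullSpace P r M,
      lineDeriv ℝ (fun w => D.S P M δ g w y) x φ = fderiv ℝ J x φ - D.Aτ P φ y := by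
  obtain ⟨hx, hy, h⟩ := h
  have h0 := fullSpace_zero_mem hx
  have hX : fullSpace P r M ⊆ dGSpace Ω P r := fullSpace_subset_dGSpace
  have hR : fullSpace P r M ⊆ slabRegular Ω P := hX.trans (dGSpace_subset_slabRegular hT)
  have hm := hΩ.measurableSet
  refine ⟨fun φ hφ => ?_, fun φ hφ => ?_⟩
  · have h1 := hasLineDerivAt_snd_of_prod (h 0 h0 φ hφ)
    have h2 := D.hasLineDerivAt_lagrτ_snd (J := J) hm x (hR hy) (hR hφ)
    have h3 : HasDerivAt (fun t : ℝ => D.S P M δ g x (y + t • φ)) (D.S P M δ g x φ) 0 := by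
      have : (fun t : ℝ => D.S P M δ g x (y + t • φ))
          = fun t => D.S P M δ g x y + t * D.S P M δ g x φ := by
        funext t
        rw [D.S_add_right hΩ hb hx (hX hy) (dGSpace_smul t (hX hφ)),
          D.S_smul_right hΩ hb hx t (hX hφ)]
      rw [this]
      exact hasDerivAt_affine _ _
    unfold HasLineDerivAt at h1 h2
    -- Along the line, the fully discrete Lagrangian, whose derivative vanishes, is the semidiscrete
    -- one minus the stabilization.
    have h4 := (h2.sub h3).unique (h1.congr_of_eventuallyEq (Eventually.of_forall fun t => by
      simp only [Pi.sub_apply, Data.lagrτ, Data.lagrτh, Data.AS]; ring))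
    linarith
  -- Linearity of `S` in its first argument is not needed: `S` is the difference of two Lagrangians
  -- that both have directional derivatives here, one of them zero by stationarity.
  · refine HasLineDerivAt.lineDeriv ?_
    have h1 := hasLineDerivAt_fst_of_prod (h φ hφ 0 h0)
    have h2 := D.hasLineDerivAt_lagrτ_fst hm (hJ x) (hR hx) (hR hφ) y
    rw [D.ρstar_eq hm (hR hx) (hR hφ)] at h2
    unfold HasLineDerivAt at h1 h2 ⊢
    have h3 := h2.sub h1
    rw [sub_zero] at h3
    exact h3.congr_of_eventuallyEq (Eventually.of_forall fun t => by
      simp only [Pi.sub_apply, Data.lagrτ, Data.lagrτh, Data.AS]; ring)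

/-! ## The error representations -/

theorem sub_eq_fderiv_add_remainder (hJ : ContDiff ℝ 3 J) (x y : W Ω T) :
    J x - J y = 1 / 2 * (fderiv ℝ J x (x - y) + fderiv ℝ J y (x - y)) + remainder J x y :=
  sub_eq_fderiv_trapezoid hJ x y

theorem abs_remainder_le {C : ℝ}
    (hC : ∀ s ∈ Icc (0 : ℝ) 1, ‖iteratedFDeriv ℝ 3 J (y + s • (x - y))‖ ≤ C) :
    |remainder J x y| ≤ C / 12 * ‖x - y‖ ^ 3 :=
  abs_trapezoid_remainder_le hC

variable {u z uτ zτ : W Ω T}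

/-- The representation of the temporal error. -/
theorem Data.temporal_error (hΩ : MeasurableSet Ω) (hT : 0 < T) (hJ : ContDiff ℝ 3 J)
    (hu : u ∈ slabRegular Ω P) (hz : z ∈ slabRegular Ω P)
    (hu1 : D.ρ P u z = 0) (hu2 : ∀ φ ∈ dGSpace Ω P r, D.ρ P u φ = 0)
    (hz1 : fderiv ℝ J u u = D.Aτ P u z)
    (hz2 : ∀ φ ∈ dGSpace Ω P r, fderiv ℝ J u φ = D.Aτ P φ z)
    (huτ : uτ ∈ dGSpace Ω P r) (hzτ : zτ ∈ dGSpace Ω P r)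
    (hρ : ∀ φ ∈ dGSpace Ω P r, D.ρ P uτ φ = 0)
    (hρ' : ∀ φ ∈ dGSpace Ω P r, fderiv ℝ J uτ φ = D.Aτ P φ zτ)
    {u' z' : W Ω T} (hu' : u' ∈ dGSpace Ω P r) (hz' : z' ∈ dGSpace Ω P r) :
    J u - J uτ = 1 / 2 * D.ρ P uτ (z - z') + 1 / 2 * D.ρstar P J uτ zτ (u - u')
      + remainder J u uτ := by
  have hX : dGSpace Ω P r ⊆ slabRegular Ω P := dGSpace_subset_slabRegular hT
  rw [sub_eq_fderiv_add_remainder hJ, D.ρ_sub hΩ uτ hz (hX hz'), hρ z' hz',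
    D.ρstar_eq hΩ (hX huτ) (sub_mem hu (hX hu')), D.Aτ_sub_left hΩ hu (hX hu'), map_sub, map_sub,
    map_sub, hz1, hz2 uτ huτ, hρ' u' hu', hρ' uτ huτ]
  have e1 := hu2 zτ hzτ
  have e2 := hρ zτ hzτ
  unfold Data.ρ at hu1 e1 e2 ⊢
  -- What is left over is half of `ρ_τ(u_τ)(z_τ) - ρ_τ(u)(z_τ) - ρ_τ(u)(z)`, and each of these
  -- residuals vanishes; the middle one is the extended primal equation.
  linear_combination (1 / 2 : ℝ) * (e2 - e1 - hu1)

/-- The representation of the spatial error. -/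
theorem Data.spatial_error (hΩ : IsOpen Ω) (hb : Bornology.IsBounded Ω) (hT : 0 < T)
    (hJ : ContDiff ℝ 3 J) (huτ : uτ ∈ dGSpace Ω P r) (hzτ : zτ ∈ dGSpace Ω P r)
    (hρ : ∀ φ ∈ dGSpace Ω P r, D.ρ P uτ φ = 0)
    (hρ' : ∀ φ ∈ dGSpace Ω P r, fderiv ℝ J uτ φ = D.Aτ P φ zτ)
    {p : ℕ} {M : ℕ → Mesh Ω p} {δ : (n : ℕ) → Fin (M n).card → ℝ}
    {g : Lp (L2 Ω) 2 (volume.restrict (Ioc 0 T))} {uτh zτh : W Ω T}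
    (h : StationaryOn (D.lagrτh P M δ g J) (fullSpace P r M) (uτh, zτh))
    {u' z' : W Ω T} (hu' : u' ∈ fullSpace P r M) (hz' : z' ∈ fullSpace P r M) :
    J uτ - J uτh = 1 / 2 * D.ρ P uτh (zτ - z') + 1 / 2 * D.ρstar P J uτh zτh (uτ - u')
      + 1 / 2 * D.S P M δ g uτh (z' + zτh)
      + 1 / 2 * lineDeriv ℝ (fun w => D.S P M δ g w zτh) uτh (u' - uτh)
      + remainder J uτ uτh := by
  have hm := hΩ.measurableSet
  have hF : fullSpace P r M ⊆ dGSpace Ω P r := fullSpace_subset_dGSpace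
  have hX : dGSpace Ω P r ⊆ slabRegular Ω P := dGSpace_subset_slabRegular hT
  obtain ⟨hS, hS'⟩ := D.stabilization_of_stationary hΩ hb hT (hJ.differentiable (by norm_num)) h
  obtain ⟨hx, hy, -⟩ := h
  -- Stationarity trades the stabilization terms for residuals of the fully discrete pair, so the
  -- contributions of `u'` and `z'` cancel against those in the weights.
  rw [sub_eq_fderiv_add_remainder hJ, D.ρ_sub hm uτh (hX hzτ) (hX (hF hz')),
    D.ρstar_eq hm (hX (hF hx)) (sub_mem (hX huτ) (hX (hF hu'))),
    D.Aτ_sub_left hm (hX huτ) (hX (hF hu')), D.S_add_right hΩ hb hx (hF hz') (hF hy),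
    hS _ hz', hS _ hy, hS' _ (fullSpace_sub hu' hx),
    D.Aτ_sub_left hm (hX (hF hu')) (hX (hF hx))]
  simp only [map_sub]
  rw [hρ' uτ huτ, hρ' uτh (hF hx)]
  have e1 := hρ zτ hzτ
  have e2 := hρ zτh (hF hy)
  unfold Data.ρ at e1 e2 ⊢
  -- The leftover consists of `ρ_τ(u_τ)` tested with `z_τ` and with `z_τh`; the latter vanishes
  -- because the fully discrete space is contained in the semidiscrete one.
  linear_combination (1 / 2 : ℝ) * (-e1 - e2)

end

end CDR

end

/-- Error representation for the goal functional `J`, split into the temporal and the spatial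
discretization error, with remainders that are of third order in the errors. -/
theorem theorem3p3 {d : ℕ} {Ω : Set (CDR.E d)} (hΩ : IsOpen Ω) (hΩb : Bornology.IsBounded Ω)
    {T : ℝ} (hT : 0 < T) (D : CDR.Data Ω T)
    (Jt : ℝ → CDR.V Ω → ℝ) (JT : CDR.L2 Ω → ℝ) (J : CDR.W Ω T → ℝ) (hJ : J = CDR.goal Jt JT)
    (hJt : ∀ w : CDR.W Ω T, IntegrableOn (fun t => Jt t (CDR.valV w t)) (Ioc 0 T))
    (hJC3 : ContDiff ℝ 3 J)
    (P : CDR.TimePartition T) (r : ℕ)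
    (u z uτ zτ : CDR.W Ω T)
    (huz : CDR.StationaryOn (D.lagr J) (CDR.energySpace Ω T) (u, z))
    (huzτ : CDR.StationaryOn (D.lagrτ P J) (CDR.dGSpace Ω P r) (uτ, zτ)) :
    -- the continuous pair is also stationary for the semidiscrete Lagrangian
    CDR.StationaryOn (D.lagrτ P J) (CDR.energySpace Ω T) (u, z) ∧
    -- the residuals are the partial derivatives of the semidiscrete Lagrangian
    (∀ v₁ ∈ CDR.energySpace Ω T, ∀ v₂ ∈ CDR.dGSpace Ω P r,
      ∀ w₁ ∈ CDR.energySpace Ω T, ∀ w₂ ∈ CDR.dGSpace Ω P r,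
      ∀ φ₁ ∈ CDR.energySpace Ω T, ∀ φ₂ ∈ CDR.dGSpace Ω P r,
        HasLineDerivAt ℝ (fun y => D.lagrτ P J (v₁ + v₂, y))
          (D.ρ P (v₁ + v₂) (φ₁ + φ₂)) (w₁ + w₂) (φ₁ + φ₂) ∧
        HasLineDerivAt ℝ (fun y => D.lagrτ P J (y, w₁ + w₂))
          (D.ρstar P J (v₁ + v₂) (w₁ + w₂) (φ₁ + φ₂)) (v₁ + v₂) (φ₁ + φ₂)) ∧
    -- the temporal error
    (∀ u' ∈ CDR.dGSpace Ω P r, ∀ z' ∈ CDR.dGSpace Ω P r,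
      J u - J uτ = 1 / 2 * D.ρ P uτ (z - z') + 1 / 2 * D.ρstar P J uτ zτ (u - u')
        + CDR.remainder J u uτ) ∧
    (∀ C : ℝ, (∀ s ∈ Icc (0 : ℝ) 1, ‖iteratedFDeriv ℝ 3 J (uτ + s • (u - uτ))‖ ≤ C) →
      |CDR.remainder J u uτ| ≤ C / 12 * ‖u - uτ‖ ^ 3) ∧
    -- the spatial error; the stabilization needs a right-hand side in `L²(I;L²(Ω))`
    (∀ g : Lp (CDR.L2 Ω) 2 (volume.restrict (Ioc 0 T)),
      (∀ᵐ t ∂(volume.restrict (Ioc 0 T)), D.f t = CDR.toDual (g t)) →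
      ∀ (p : ℕ) (M : ℕ → CDR.Mesh Ω p) (δ : (n : ℕ) → Fin (M n).card → ℝ)
        (uτh zτh : CDR.W Ω T),
      CDR.StationaryOn (D.lagrτh P M δ g J) (CDR.fullSpace P r M) (uτh, zτh) →
      (∀ u' ∈ CDR.fullSpace P r M, ∀ z' ∈ CDR.fullSpace P r M,
        J uτ - J uτh = 1 / 2 * D.ρ P uτh (zτ - z')
          + 1 / 2 * D.ρstar P J uτh zτh (uτ - u')
          + 1 / 2 * D.S P M δ g uτh (z' + zτh)
          + 1 / 2 * lineDeriv ℝ (fun w => D.S P M δ g w zτh) uτh (u' - uτh)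
          + CDR.remainder J uτ uτh) ∧
      (∀ C : ℝ, (∀ s ∈ Icc (0 : ℝ) 1, ‖iteratedFDeriv ℝ 3 J (uτh + s • (uτ - uτh))‖ ≤ C) →
        |CDR.remainder J uτ uτh| ≤ C / 12 * ‖uτ - uτh‖ ^ 3)) := by
  have hm := hΩ.measurableSet
  have hd : Differentiable ℝ J := hJC3.differentiable (by norm_num)
  have hE := CDR.energySpace_subset_slabRegular (Ω := Ω) P
  have hG : CDR.dGSpace Ω P r ⊆ CDR.slabRegular Ω P := CDR.dGSpace_subset_slabRegular hT
  have huz' := D.stationaryOn_lagrτ_energySpace (P := P) hm hT huz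
  obtain ⟨hρ, hρ'⟩ := D.residuals_of_stationary hm hd hE CDR.zero_mem_energySpace huz'
  obtain ⟨hρτ, hρτ'⟩ := D.residuals_of_stationary hm hd hG CDR.zero_mem_dGSpace huzτ
  refine ⟨huz', fun v₁ hv₁ v₂ hv₂ w₁ hw₁ w₂ hw₂ φ₁ hφ₁ φ₂ hφ₂ => ⟨?_, ?_⟩, ?_,
    fun C hC => CDR.abs_remainder_le hC, fun g _ p M δ uτh zτh h =>
    ⟨fun u' hu' z' hz' => ?_, fun C hC => CDR.abs_remainder_le hC⟩⟩
  · exact D.hasLineDerivAt_lagrτ_snd hm _ (add_mem (hE hw₁) (hG hw₂)) (add_mem (hE hφ₁) (hG hφ₂))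
  · exact D.hasLineDerivAt_lagrτ_fst hm (hd _) (add_mem (hE hv₁) (hG hv₂))
      (add_mem (hE hφ₁) (hG hφ₂)) _
  · intro u' hu' z' hz'
    -- Back to the continuous weak equations, the starting point for extending them to discontinuous
    -- test functions.
    have hA : ∀ φ ∈ CDR.energySpace Ω T, D.A u φ = D.F φ := fun φ hφ => by
      rw [← D.Aτ_eq_A (P := P) hm hT huz.1 hφ, ← D.Fτ_eq_F hT hφ]
      exact (sub_eq_zero.1 (hρ φ hφ)).symm
    have hA' : ∀ φ ∈ CDR.energySpace Ω T, fderiv ℝ J u φ = D.A φ z := fun φ hφ => by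
      rw [← D.Aτ_eq_A (P := P) hm hT hφ huz.2.1]
      exact hρ' φ hφ
    refine D.temporal_error hm hT hJC3 (hE huz.1) (hE huz.2.1) (hρ z huz.2.1)
      (fun φ hφ => ?_) (hρ' u huz.1) (fun φ hφ => ?_) huzτ.1 huzτ.2.1 hρτ hρτ' hu' hz'
    · exact sub_eq_zero.2 (D.Aτ_eq_Fτ_of_weak hm hT huz.1 hA hφ).symm
    -- The only place where the integral structure of `J` matters; everything else uses `J` as a
    -- `C³` functional on `W`.
    · subst hJ
      exact D.fderiv_goal_eq_Aτ hm hT hJt (hd u) huz.2.1 hA' hφ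
  · exact D.spatial_error hΩ hΩb hT hJC3 huzτ.1 huzτ.2.1 hρτ hρτ' h hu' hz'
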